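/- **Setting.** For positive integers $p,d$ put $n=p^d$, $\omega=e^{2\pi i/p}$, and index $[p]^d$ by $\{0,\dots,p-1\}^d$. For $x\in\mathbb C^{[p]^d}$ let $\hat x_f=\frac1{\sqrt n}\sum_{t\in[p]^d}x_t\,\omega^{f^\top t}$. For a vector $v$ let $v_{-k}$ be $v$ with its $k$ coordinates of largest absolute value set to zero. A vector is $m$-sparse if at most $m$ of its coordinates are nonzero. Algorithms are programs for a probabilistic real RAM: unit-cost exact arithmetic on complex numbers ($+,-,\times,\div$, real and imaginary part, square root, comparison of reals, roots of unity $e^{2\pi i a/b}$), unit-cost addition, subtraction and comparison of natural numbers, arrays with indirect addressing, no rounding of reals to integers, and draws of independent uniform elements of $[0,1]$. The signal $x$ is accessible only through independent uniform samples: one sampling step draws $t\in[p]^d$ uniformly at random, independently of everything else, and reveals $t$ and $x_t$. The input is $p,d,k,\mu,R^*$, and the output is a vector $y\in\mathbb C^{[p]^d}$. One program serves all inputs. **Theorem.** There is an absolute constant $C_0$ such that for every $c\in\mathbb N$ there are a program and a constant $C_1=C_1(c)$ such that for every $A\in\mathbb R$ there are constants $C_2,C_3$, depending only on $c$ and $A$,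 with the following property. Let $p,d$ be positive integers, $n=p^d$, $k\in\{1,\dots,n\}$ and $x\in\mathbb C^{[p]^d}$. Suppose that $$\mu=\frac1{\sqrt k}\|\hat x_{-k}\|_2>0,\qquad R^*\ge\frac{\|\hat x\|_\infty}{\mu},\qquad \log R^*\le A\log n .$$ Then, on input $p,d,k,\mu,R^*$, the program always halts, takes at most $C_1\,k\log(k+1)\log n$ uniform samples of $x$, runs for at most $C_2\,n\log^3 n\,\log(k+1)$ steps, and outputs a $C_0k$-sparse vector $y$; and, except with probability at most $C_3\,n^{-c}$ over the samples and the draws, $$\|\hat x-y\|_\infty\le\frac1{\sqrt k}\|\hat x_{-k}\|_2 .$$ -/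

import Mathlib

open MeasureTheory

namespace SparseFourier

/-! ### Signals, the normalized Fourier transform, best `k`-term tails -/

/-- The index set `[p]^d`, with coordinates in `{0, …, p - 1}`. -/
abbrev Idx (p d : ℕ) : Type := Fin d → Fin p

/-- `x̂_f = n^{-1/2} ∑_t x_t ω^{f·t}` with `n = p^d` and `ω = exp (2πi/p)`. -/
noncomputable def dft {p d : ℕ} (x : Idx p d → ℂ) (f : Idx p d) : ℂ :=
  (1 / (Real.sqrt ((p : ℝ) ^ d) : ℂ)) *
    ∑ t : Idx p d, x t *
      Complex.exp (2 * Real.pi * Complex.I / p) ^ (∑ i, (f i : ℕ) * (t i : ℕ))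

/-- The Euclidean norm. -/
noncomputable def l2norm {α : Type*} [Fintype α] (v : α → ℂ) : ℝ :=
  Real.sqrt (∑ f, ‖v f‖ ^ 2)

/-- The maximum norm. -/
noncomputable def linfNorm {α : Type*} [Fintype α] (v : α → ℂ) : ℝ := ‖v‖

/-- The number of nonzero coordinates. -/
noncomputable def nnzCount {α : Type*} [Fintype α] (v : α → ℂ) : ℕ :=
  Set.ncard {f : α | v f ≠ 0}

/-- `S` consists of `k` coordinates of `v` of largest absolute value
(of all coordinates, if there are fewer than `k`). -/
def IsTop {α : Type*} [Fintype α] (k : ℕ) (v : α → ℂ) (S : Finset α) : Prop :=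
  S.card = min k (Fintype.card α) ∧ ∀ f ∈ S, ∀ g ∉ S, ‖v g‖ ≤ ‖v f‖

theorem exists_isTop {α : Type*} [Fintype α] (k : ℕ) (v : α → ℂ) :
    ∃ S : Finset α, IsTop k v S := by
  classical
  have key : ∀ m : ℕ, m ≤ Fintype.card α →
      ∃ S : Finset α, S.card = m ∧ ∀ f ∈ S, ∀ g ∉ S, ‖v g‖ ≤ ‖v f‖ := by
    intro m
    induction m with
    | zero => exact fun _ => ⟨∅, by simp, by simp⟩
    | succ m ih =>
      intro hm
      obtain ⟨S, hS, hmax⟩ := ih (by omega)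
      have hne : (Sᶜ).Nonempty := by
        rw [← Finset.card_pos, Finset.card_compl]
        omega
      obtain ⟨a, ha, hamax⟩ := Finset.exists_max_image Sᶜ (fun f => ‖v f‖) hne
      rw [Finset.mem_compl] at ha
      refine ⟨insert a S, by rw [Finset.card_insert_of_notMem ha, hS], ?_⟩
      intro f hf g hg
      rw [Finset.mem_insert, not_or] at hg
      rcases Finset.mem_insert.1 hf with rfl | hf
      · exact hamax g (by simpa using hg.2)
      · exact hmax f hf g hg.2
  obtain ⟨S, hS, h⟩ := key (min k (Fintype.card α)) (min_le_right _ _)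
  exact ⟨S, hS, h⟩

/-- `v_{-k}`: the `k` coordinates of largest absolute value are set to zero
(ties are broken arbitrarily, which does not affect any norm of the result). -/
noncomputable def zeroTop {α : Type*} [Fintype α] (k : ℕ) (v : α → ℂ) : α → ℂ :=
  open Classical in
  fun f => if f ∈ Classical.choose (exists_isTop k v) then 0 else v f

/-! ### A probabilistic real RAM

Programs are written in a small imperative language. The memory consists of arrays `0, 1, 2, …`
of natural numbers and arrays `0, 1, 2, …` of complex numbers, all unbounded and addressed
indirectly; a program can only name finitely many arrays. Natural numbers (indices and counters)
are added, subtracted and compared. On complex numbers there are the exact operations `+ - * /`,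
real and imaginary part, square root of the real part, comparison of real parts, and the roots of
unity `exp (2πi a/b)`. There is no rounding of numbers to integers and no constant besides
integers and `i`. Every operation, memory access, assignment, test and random draw takes one time
step.

The signal is accessible only through the command `sample`, which draws a fresh uniformly random
position `t` and reveals `t` together with `x_t`. -/

/-- Natural-number expressions; subtraction is truncated. -/
inductive NExp : Type
  | lit : ℕ → NExp
  | get : ℕ → NExp → NExp
  | add : NExp → NExp → NExp
  | sub : NExp → NExp → NExp

/-- Complex-number expressions. -/
inductive VExp : Type
  | ofNat : NExp → VExp
  | imagUnit : VExp
  | rootOfUnity : NExp → NExp → VExp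
  | get : ℕ → NExp → VExp
  | add : VExp → VExp → VExp
  | sub : VExp → VExp → VExp
  | mul : VExp → VExp → VExp
  | div : VExp → VExp → VExp
  | re : VExp → VExp
  | im : VExp → VExp
  | sqrt : VExp → VExp

/-- Tests. -/
inductive BExp : Type
  | nle : NExp → NExp → BExp
  | vle : VExp → VExp → BExp
  | not : BExp → BExp
  | and : BExp → BExp → BExp

/-- Programs. In `sample a i b j` the position drawn is stored in entry `i` of the number array
`a` and the value of the signal there in entry `j` of the complex array `b`; `rand b j` stores a
uniform random element of `[0,1]` in entry `j` of the complex array `b`. -/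
inductive Prog : Type
  | skip : Prog
  | seq : Prog → Prog → Prog
  | cond : BExp → Prog → Prog → Prog
  | loop : BExp → Prog → Prog
  | setN : ℕ → NExp → NExp → Prog
  | setV : ℕ → NExp → VExp → Prog
  | sample : ℕ → NExp → ℕ → NExp → Prog
  | rand : ℕ → NExp → Prog

/-- A machine configuration: the memory, the number of time steps spent, the number of samples
of the signal taken, and the number of elements of `[0,1]` drawn. -/
structure State : Type where
  nats : ℕ → ℕ → ℕ
  vals : ℕ → ℕ → ℂ
  time : ℕ
  samples : ℕ
  rands : ℕ

def NExp.eval (s : State) : NExp → ℕ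
  | .lit c => c
  | .get a i => s.nats a (i.eval s)
  | .add e₁ e₂ => e₁.eval s + e₂.eval s
  | .sub e₁ e₂ => e₁.eval s - e₂.eval s

def NExp.cost : NExp → ℕ
  | .lit _ => 1
  | .get _ i => i.cost + 1
  | .add e₁ e₂ => e₁.cost + e₂.cost + 1
  | .sub e₁ e₂ => e₁.cost + e₂.cost + 1

noncomputable def VExp.eval (s : State) : VExp → ℂ
  | .ofNat e => (e.eval s : ℂ)
  | .imagUnit => Complex.I
  | .rootOfUnity a b => Complex.exp (2 * Real.pi * Complex.I * (a.eval s : ℂ) / (b.eval s : ℂ))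
  | .get a i => s.vals a (i.eval s)
  | .add u v => u.eval s + v.eval s
  | .sub u v => u.eval s - v.eval s
  | .mul u v => u.eval s * v.eval s
  | .div u v => u.eval s / v.eval s
  | .re u => ((u.eval s).re : ℂ)
  | .im u => ((u.eval s).im : ℂ)
  | .sqrt u => (Real.sqrt (u.eval s).re : ℂ)

def VExp.cost : VExp → ℕ
  | .ofNat e => e.cost + 1
  | .imagUnit => 1
  | .rootOfUnity a b => a.cost + b.cost + 1
  | .get _ i => i.cost + 1
  | .add u v => u.cost + v.cost + 1
  | .sub u v => u.cost + v.cost + 1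
  | .mul u v => u.cost + v.cost + 1
  | .div u v => u.cost + v.cost + 1
  | .re u => u.cost + 1
  | .im u => u.cost + 1
  | .sqrt u => u.cost + 1

def BExp.eval (s : State) : BExp → Prop
  | .nle e₁ e₂ => e₁.eval s ≤ e₂.eval s
  | .vle u v => (u.eval s).re ≤ (v.eval s).re
  | .not b => ¬ b.eval s
  | .and b₁ b₂ => b₁.eval s ∧ b₂.eval s

def BExp.cost : BExp → ℕ
  | .nle e₁ e₂ => e₁.cost + e₂.cost + 1
  | .vle u v => u.cost + v.cost + 1
  | .not b => b.cost + 1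
  | .and b₁ b₂ => b₁.cost + b₂.cost + 1

/-- Entry `i` of array `a` is overwritten by `v`. -/
def store {β : Type} (m : ℕ → ℕ → β) (a i : ℕ) (v : β) : ℕ → ℕ → β :=
  fun a' i' => if a' = a ∧ i' = i then v else m a' i'

def State.tick (s : State) (c : ℕ) : State := { s with time := s.time + c }

/-- The number in `{0, …, p^d - 1}` by which the machine refers to `t ∈ [p]^d`. -/
def addr {p d : ℕ} (t : Idx p d) : ℕ := ∑ i, (t i : ℕ) * p ^ (i : ℕ)

/-- The randomness of a run: the sequence of positions at which the signal is sampled, and the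
sequence of elements of `[0,1]` that the machine draws. -/
abbrev Tape (p d : ℕ) : Type := (ℕ → Idx p d) × (ℕ → unitInterval)

/-- All positions are uniform on `[p]^d`, all numbers uniform on `[0,1]`, and everything is
independent. -/
noncomputable def tapeMeasure (p d : ℕ) : Measure (Tape p d) :=
  (Measure.infinitePi fun _ : ℕ => ProbabilityTheory.uniformOn (Set.univ : Set (Idx p d))).prod
    (Measure.infinitePi fun _ : ℕ => (volume : Measure unitInterval))

instance {p d : ℕ} [NeZero p] : IsProbabilityMeasure (tapeMeasure p d) := by
  unfold tapeMeasure
  infer_instance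

/-- `Exec x ω P s s'`: program `P` on signal `x` and random tape `ω`, started in configuration
`s`, halts in configuration `s'`. -/
inductive Exec {p d : ℕ} (x : Idx p d → ℂ) (ω : Tape p d) : Prog → State → State → Prop
  | skip (s : State) : Exec x ω .skip s (s.tick 1)
  | seq {P Q : Prog} {s s' s'' : State} :
      Exec x ω P s s' → Exec x ω Q s' s'' → Exec x ω (.seq P Q) s s''
  | condTrue {b : BExp} {P Q : Prog} {s s' : State} :
      b.eval s → Exec x ω P (s.tick (b.cost + 1)) s' → Exec x ω (.cond b P Q) s s'
  | condFalse {b : BExp} {P Q : Prog} {s s' : State} :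
      ¬ b.eval s → Exec x ω Q (s.tick (b.cost + 1)) s' → Exec x ω (.cond b P Q) s s'
  | loopTrue {b : BExp} {P : Prog} {s s' s'' : State} :
      b.eval s → Exec x ω P (s.tick (b.cost + 1)) s' → Exec x ω (.loop b P) s' s'' →
      Exec x ω (.loop b P) s s''
  | loopFalse {b : BExp} {P : Prog} {s : State} :
      ¬ b.eval s → Exec x ω (.loop b P) s (s.tick (b.cost + 1))
  | setN (a : ℕ) (i e : NExp) (s : State) :
      Exec x ω (.setN a i e) s
        { s with
          nats := store s.nats a (i.eval s) (e.eval s)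
          time := s.time + (i.cost + e.cost + 1) }
  | setV (b : ℕ) (j : NExp) (v : VExp) (s : State) :
      Exec x ω (.setV b j v) s
        { s with
          vals := store s.vals b (j.eval s) (v.eval s)
          time := s.time + (j.cost + v.cost + 1) }
  | sample (a : ℕ) (i : NExp) (b : ℕ) (j : NExp) (s : State) :
      Exec x ω (.sample a i b j) s
        { s with
          nats := store s.nats a (i.eval s) (addr (ω.1 s.samples))
          vals := store s.vals b (j.eval s) (x (ω.1 s.samples))
          time := s.time + (i.cost + j.cost + 1)
          samples := s.samples + 1 }
  | rand (b : ℕ) (j : NExp) (s : State) :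
      Exec x ω (.rand b j) s
        { s with
          vals := store s.vals b (j.eval s) ((ω.2 s.rands : ℝ) : ℂ)
          time := s.time + (j.cost + 1)
          rands := s.rands + 1 }

/-- For a given signal and random tape, a program has at most one outcome. -/
theorem Exec.unique {p d : ℕ} {x : Idx p d → ℂ} {ω : Tape p d} {P : Prog} {s s₁ s₂ : State}
    (h₁ : Exec x ω P s s₁) (h₂ : Exec x ω P s s₂) : s₁ = s₂ := by
  induction h₁ generalizing s₂ with
  | skip s => cases h₂; rfl
  | seq _ _ ih₁ ih₂ =>
    cases h₂ with
    | seq g₁ g₂ => cases ih₁ g₁; exact ih₂ g₂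
  | condTrue hb _ ih =>
    cases h₂ with
    | condTrue _ g => exact ih g
    | condFalse hn _ => exact absurd hb hn
  | condFalse hb _ ih =>
    cases h₂ with
    | condTrue hn _ => exact absurd hn hb
    | condFalse _ g => exact ih g
  | loopTrue hb _ _ ih₁ ih₂ =>
    cases h₂ with
    | loopTrue _ g₁ g₂ => cases ih₁ g₁; exact ih₂ g₂
    | loopFalse hn => exact absurd hb hn
  | loopFalse hb =>
    cases h₂ with
    | loopTrue hn _ _ => exact absurd hn hb
    | loopFalse _ => rfl
  | setN a i e s => cases h₂; rfl
  | setV b j v s => cases h₂; rfl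
  | sample a i b j s => cases h₂; rfl
  | rand b j s => cases h₂; rfl

/-- The start of a run: `p, d, k` are the first entries of the number array `0` and `μ, R*` the
first entries of the complex array `0`; all other memory is zero and nothing is spent yet. -/
noncomputable def initState (p d k : ℕ) (μ Rstar : ℝ) : State where
  nats := fun a i =>
    if a = 0 ∧ i = 0 then p else if a = 0 ∧ i = 1 then d else if a = 0 ∧ i = 2 then k else 0
  vals := fun b j => if b = 0 ∧ j = 0 then (μ : ℂ) else if b = 0 ∧ j = 1 then (Rstar : ℂ) else 0
  time := 0
  samples := 0
  rands := 0

/-- The vector that the machine has written to the complex array `1`. -/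
def output {p d : ℕ} (s : State) : Idx p d → ℂ := fun f => s.vals 1 (addr f)

end SparseFourier

namespace SparseFourier

/-! ### A program logic -/

/-! Write X for `dft x`. It is approximated by successive halving of the error. Suppose that e is
within a ≥ μ of X everywhere and vanishes wherever |X| < μ/8. Since X has a small tail, the residual
X - e has square sum at most 67 k a² (`Approx.sum_le`). By Parseval and Chebyshev, averaging B = 2²²
k uniform samples of x - `invDft e` against a character estimates X_f - e_f to within a/24, except
with probability 1/16 (`measure_est_le`). Taking a value near the majority of R = (c+4)·⌈log₂ n⌉
such batches gives error a/8 at a fixed frequency, except with probability 2^(-R)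
(`norm_pick_sub_le`, `measure_badAt_le`). Adding only corrections of size at least a/4 halves the
error and preserves the support condition (`approx_stepFn`).

Chebyshev requires e to be independent of the samples. Fresh samples for each of the log R* halvings
would cost a factor log R* instead of log k. So only b + 4 = O(log k) blocks of R·B samples are
drawn, all at the start, and every iteration of b + 4 halvings reads them again. The dependence is
cut by rounding. After b + 4 halvings the error is at most half of g/2^b, where g is the mesh to
which real and imaginary parts are rounded. Only 4k of these parts are large, and each spoils at
most two of the 2^b - 1 shifts j·g/2^b of the grid. As 2^b ≥ 8k + 2, the algorithm can find, from
its approximation alone, a shift for which the approximation and X round to the same vector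
(`exists_not_marked`, `rnd_eq_of_close`, `rndC_eq_of_selected`). Hence the next iteration starts
from a vector `cand X μ b E j` that is determined by X, a level E and a shift j. A union bound over
the (E₀+1)(2^b+1) pairs replaces independence between iterations (`measure_not_goodRun_le`); within
an iteration the blocks are fresh (`measure_adaptive_le`). Each iteration, rounding included, gains
a factor 2. A last run of at most b + 4 halvings without rounding reaches μ/2.

One halving costs R + 1 transforms of O(n log n) steps (Bluestein along each axis, on top of a
radix-2 transform) and R² comparisons per coordinate. With O(log n) iterations of O(log k) halvings
this gives n log³ n log k. The program is verified by triples that carry time bounds. It never draws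
numbers from [0,1]. All loop counts depend on the input only, and the result is copied to the output
only if it is sparse, so the bounds on time, samples and sparsity hold on every tape; only accuracy
is probabilistic. -/

/-- The part of a configuration that influences a run that draws no random numbers. -/
structure Mem : Type where
  n : ℕ → ℕ → ℕ
  v : ℕ → ℕ → ℂ
  c : ℕ

namespace Mem

/-- The counter of random draws is frozen at 0, which is legitimate because the program contains no
`rand`. The clock is separated from the rest because no expression can read it. -/
def st (m : Mem) (t : ℕ) : State := ⟨m.n, m.v, t, m.c, 0⟩

def setN (m : Mem) (a i e : ℕ) : Mem := { m with n := store m.n a i e }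

def setV (m : Mem) (a i : ℕ) (e : ℂ) : Mem := { m with v := store m.v a i e }

def setC (m : Mem) (c : ℕ) : Mem := { m with c := c }

variable (m : Mem) (a i e c : ℕ) (z : ℂ)

@[simp] theorem setN_v : (m.setN a i e).v = m.v := rfl
@[simp] theorem setN_c : (m.setN a i e).c = m.c := rfl
@[simp] theorem setV_n : (m.setV a i z).n = m.n := rfl
@[simp] theorem setV_c : (m.setV a i z).c = m.c := rfl
@[simp] theorem setC_n : (m.setC c).n = m.n := rfl
@[simp] theorem setC_v : (m.setC c).v = m.v := rfl
@[simp] theorem setC_c : (m.setC c).c = c := rfl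

theorem setN_n (i' : ℕ) : (m.setN a i e).n a i' = if i' = i then e else m.n a i' := by
  simp [setN, store]

theorem setV_v (i' : ℕ) : (m.setV a i z).v a i' = if i' = i then z else m.v a i' := by
  simp [setV, store]

@[simp] theorem setN_n_same : (m.setN a i e).n a i = e := by simp [setN_n]
@[simp] theorem setV_v_same : (m.setV a i z).v a i = z := by simp [setV_v]

@[simp] theorem setN_n_ne {a a' : ℕ} (h : a' ≠ a) : (m.setN a i e).n a' = m.n a' := by
  funext i'; simp [setN, store, h]

@[simp] theorem setV_v_ne {a a' : ℕ} (h : a' ≠ a) : (m.setV a i z).v a' = m.v a' := by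
  funext i'; simp [setV, store, h]

theorem setV_v_idx {i i' : ℕ} (h : i' ≠ i) : (m.setV a i z).v a i' = m.v a i' := by
  simp [setV_v, h]

end Mem

/-! ### Evaluation of expressions, independent of the clock. -/

def NExp.ev (m : Mem) (e : NExp) : ℕ := e.eval (m.st 0)
noncomputable def VExp.ev (m : Mem) (e : VExp) : ℂ := e.eval (m.st 0)
def BExp.ev (m : Mem) (e : BExp) : Prop := e.eval (m.st 0)

theorem NExp.eval_st (m : Mem) (t : ℕ) (e : NExp) : e.eval (m.st t) = e.ev m := by
  induction e <;> simp_all [NExp.eval, NExp.ev, Mem.st]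

theorem VExp.eval_st (m : Mem) (t : ℕ) (e : VExp) : e.eval (m.st t) = e.ev m := by
  induction e <;> simp_all [VExp.eval, VExp.ev, NExp.eval_st] <;> simp [Mem.st]

theorem BExp.eval_st (m : Mem) (t : ℕ) (e : BExp) : e.eval (m.st t) ↔ e.ev m := by
  induction e <;> simp_all [BExp.eval, BExp.ev, NExp.eval_st, VExp.eval_st]

section Evaluation

variable (m : Mem) (a c : ℕ) (i e f : NExp) (u w : VExp) (b b' : BExp)

@[simp] theorem NExp.ev_lit : (NExp.lit c).ev m = c := rfl
@[simp] theorem NExp.ev_get : (NExp.get a i).ev m = m.n a (i.ev m) := rfl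
@[simp] theorem NExp.ev_add : (NExp.add e f).ev m = e.ev m + f.ev m := rfl
@[simp] theorem NExp.ev_sub : (NExp.sub e f).ev m = e.ev m - f.ev m := rfl
@[simp] theorem VExp.ev_ofNat : (VExp.ofNat e).ev m = (e.ev m : ℂ) := rfl
@[simp] theorem VExp.ev_imagUnit : VExp.imagUnit.ev m = Complex.I := rfl
@[simp] theorem VExp.ev_rootOfUnity : (VExp.rootOfUnity e f).ev m =
    Complex.exp (2 * Real.pi * Complex.I * (e.ev m : ℂ) / (f.ev m : ℂ)) := rfl
@[simp] theorem VExp.ev_get : (VExp.get a i).ev m = m.v a (i.ev m) := rfl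
@[simp] theorem VExp.ev_add : (VExp.add u w).ev m = u.ev m + w.ev m := rfl
@[simp] theorem VExp.ev_sub : (VExp.sub u w).ev m = u.ev m - w.ev m := rfl
@[simp] theorem VExp.ev_mul : (VExp.mul u w).ev m = u.ev m * w.ev m := rfl
@[simp] theorem VExp.ev_div : (VExp.div u w).ev m = u.ev m / w.ev m := rfl
@[simp] theorem VExp.ev_re : (VExp.re u).ev m = ((u.ev m).re : ℂ) := rfl
@[simp] theorem VExp.ev_im : (VExp.im u).ev m = ((u.ev m).im : ℂ) := rfl
@[simp] theorem VExp.ev_sqrt : (VExp.sqrt u).ev m = (Real.sqrt (u.ev m).re : ℂ) := rfl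
@[simp] theorem BExp.ev_nle : (BExp.nle e f).ev m ↔ e.ev m ≤ f.ev m := Iff.rfl
@[simp] theorem BExp.ev_vle : (BExp.vle u w).ev m ↔ (u.ev m).re ≤ (w.ev m).re := Iff.rfl
@[simp] theorem BExp.ev_not : (BExp.not b).ev m ↔ ¬ b.ev m := Iff.rfl
@[simp] theorem BExp.ev_and : (BExp.and b b').ev m ↔ b.ev m ∧ b'.ev m := Iff.rfl

end Evaluation

/-- The number arrays a program may write to. -/
def Prog.wN : Prog → List ℕ
  | .skip => []
  | .seq P Q => P.wN ++ Q.wN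
  | .cond _ P Q => P.wN ++ Q.wN
  | .loop _ P => P.wN
  | .setN a _ _ => [a]
  | .setV _ _ _ => []
  | .sample a _ _ _ => [a]
  | .rand _ _ => []

/-- The complex arrays a program may write to. -/
def Prog.wV : Prog → List ℕ
  | .skip => []
  | .seq P Q => P.wV ++ Q.wV
  | .cond _ P Q => P.wV ++ Q.wV
  | .loop _ P => P.wV
  | .setN _ _ _ => []
  | .setV b _ _ => [b]
  | .sample _ _ b _ => [b]
  | .rand b _ => [b]

/-- Whether a program contains a sampling command. -/
def Prog.samples : Prog → Bool
  | .skip => false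
  | .seq P Q => P.samples || Q.samples
  | .cond _ P Q => P.samples || Q.samples
  | .loop _ P => P.samples
  | .setN _ _ _ => false
  | .setV _ _ _ => false
  | .sample _ _ _ _ => true
  | .rand _ _ => false

/-- `m'` differs from `m` only in what the program `P` may change. -/
structure Frame (P : Prog) (m m' : Mem) : Prop where
  n : ∀ a, a ∉ P.wN → m'.n a = m.n a
  v : ∀ a, a ∉ P.wV → m'.v a = m.v a
  c : P.samples = false → m'.c = m.c

theorem Frame.refl (P : Prog) (m : Mem) : Frame P m m := ⟨fun _ _ => rfl, fun _ _ => rfl, fun _ => rfl⟩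

theorem Frame.trans {P : Prog} {m m' m'' : Mem} (h : Frame P m m') (h' : Frame P m' m'') :
    Frame P m m'' :=
  ⟨fun a ha => (h'.n a ha).trans (h.n a ha), fun a ha => (h'.v a ha).trans (h.v a ha),
    fun hc => (h'.c hc).trans (h.c hc)⟩

/-- Array names are literals in the syntax, so the arrays that a run may change can be read off the
program. Specifications then need to mention only what a program computes; that everything else
survives is mostly settled by `decide` on lists of array numbers. -/
theorem Exec.frame {p d : ℕ} {x : Idx p d → ℂ} {ω : Tape p d} {P : Prog} {s s' : State}
    (h : Exec x ω P s s') :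
    (∀ a, a ∉ P.wN → s'.nats a = s.nats a) ∧ (∀ a, a ∉ P.wV → s'.vals a = s.vals a) ∧
      (P.samples = false → s'.samples = s.samples) := by
  induction h with
  | skip s => simp [State.tick]
  | seq _ _ ih₁ ih₂ =>
    simp only [Prog.wN, Prog.wV, Prog.samples, List.mem_append, not_or, Bool.or_eq_false_iff]
    exact ⟨fun a ha => (ih₂.1 a ha.2).trans (ih₁.1 a ha.1),
      fun a ha => (ih₂.2.1 a ha.2).trans (ih₁.2.1 a ha.1),
      fun ha => (ih₂.2.2 ha.2).trans (ih₁.2.2 ha.1)⟩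
  | condTrue _ _ ih =>
    simp only [Prog.wN, Prog.wV, Prog.samples, List.mem_append, not_or, Bool.or_eq_false_iff]
    exact ⟨fun a ha => ih.1 a ha.1, fun a ha => ih.2.1 a ha.1, fun ha => ih.2.2 ha.1⟩
  | condFalse _ _ ih =>
    simp only [Prog.wN, Prog.wV, Prog.samples, List.mem_append, not_or, Bool.or_eq_false_iff]
    exact ⟨fun a ha => ih.1 a ha.2, fun a ha => ih.2.1 a ha.2, fun ha => ih.2.2 ha.2⟩
  | loopTrue _ _ _ ih₁ ih₂ =>
    exact ⟨fun a ha => (ih₂.1 a ha).trans (ih₁.1 a ha),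
      fun a ha => (ih₂.2.1 a ha).trans (ih₁.2.1 a ha),
      fun ha => (ih₂.2.2 ha).trans (ih₁.2.2 ha)⟩
  | loopFalse _ => simp [State.tick]
  | setN a i e s =>
    refine ⟨fun b hb => ?_, fun _ _ => rfl, fun _ => rfl⟩
    funext j
    simp_all [Prog.wN, store]
  | setV a i e s =>
    refine ⟨fun _ _ => rfl, fun b hb => ?_, fun _ => rfl⟩
    funext j
    simp_all [Prog.wV, store]
  | sample a i b j s =>
    refine ⟨fun c hc => ?_, fun c hc => ?_, fun h => by simp [Prog.samples] at h⟩ <;>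
    · funext j
      simp_all [Prog.wN, Prog.wV, store]
  | rand b j s =>
    refine ⟨fun _ _ => rfl, fun c hc => ?_, fun _ => rfl⟩
    funext j
    simp_all [Prog.wV, store]

/-! ### Total-correctness triples with a time bound. -/

section Triples

variable {p d : ℕ} (x : Idx p d → ℂ) (ω : Tape p d)

/-- Started in memory `m`, the program `P` halts after at most `T` steps with memory in `Q`. -/
def Tri (P : Prog) (m : Mem) (T : ℕ) (Q : Mem → Prop) : Prop :=
  ∀ t, ∃ m' t', Exec x ω P (m.st t) (m'.st t') ∧ t' ≤ t + T ∧ Q m'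

variable {x ω} {P P₁ P₂ : Prog} {m : Mem} {T T₁ T₂ : ℕ} {Q Q' : Mem → Prop}

theorem Tri.le (h : Tri x ω P m T₁ Q) (hT : T₁ ≤ T) : Tri x ω P m T Q := fun t => by
  obtain ⟨m', t', he, ht, hq⟩ := h t
  exact ⟨m', t', he, by omega, hq⟩

/-- The consequence rule, with the frame of the program made available. -/
theorem Tri.imp (h : Tri x ω P m T Q) (hQ : ∀ m', Q m' → Frame P m m' → Q' m') :
    Tri x ω P m T Q' := fun t => by
  obtain ⟨m', t', he, ht, hq⟩ := h t
  exact ⟨m', t', he, ht, hQ m' hq ⟨he.frame.1, he.frame.2.1, he.frame.2.2⟩⟩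

theorem Tri.seq (h : Tri x ω P₁ m T₁ fun m₁ => Tri x ω P₂ m₁ T₂ Q) :
    Tri x ω (.seq P₁ P₂) m (T₁ + T₂) Q := fun t => by
  obtain ⟨m₁, t₁, he₁, ht₁, h₂⟩ := h t
  obtain ⟨m₂, t₂, he₂, ht₂, hq⟩ := h₂ t₁
  exact ⟨m₂, t₂, he₁.seq he₂, by omega, hq⟩

/-- Sequential composition where the first part is specified beforehand. -/
theorem Tri.bind (h : Tri x ω P₁ m T₁ Q')
    (h₂ : ∀ m', Q' m' → Frame P₁ m m' → Tri x ω P₂ m' T₂ Q) :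
    Tri x ω (.seq P₁ P₂) m (T₁ + T₂) Q := Tri.seq (h.imp h₂)

theorem Tri.skip (h : Q m) : Tri x ω .skip m 1 Q := fun t =>
  ⟨m, t + 1, Exec.skip _, le_rfl, h⟩

theorem Tri.setN {a : ℕ} {i e : NExp} (h : Q (m.setN a (i.ev m) (e.ev m))) :
    Tri x ω (.setN a i e) m (i.cost + e.cost + 1) Q := fun t => by
  refine ⟨_, t + (i.cost + e.cost + 1), ?_, le_rfl, h⟩
  have := Exec.setN (x := x) (ω := ω) a i e (m.st t)
  rwa [NExp.eval_st, NExp.eval_st] at this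

theorem Tri.setV {a : ℕ} {i : NExp} {e : VExp} (h : Q (m.setV a (i.ev m) (e.ev m))) :
    Tri x ω (.setV a i e) m (i.cost + e.cost + 1) Q := fun t => by
  refine ⟨_, t + (i.cost + e.cost + 1), ?_, le_rfl, h⟩
  have := Exec.setV (x := x) (ω := ω) a i e (m.st t)
  rwa [NExp.eval_st, VExp.eval_st] at this

theorem Tri.sample {a b : ℕ} {i j : NExp}
    (h : Q (((m.setN a (i.ev m) (addr (ω.1 m.c))).setV b (j.ev m) (x (ω.1 m.c))).setC (m.c + 1))) :
    Tri x ω (.sample a i b j) m (i.cost + j.cost + 1) Q := fun t => by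
  refine ⟨_, t + (i.cost + j.cost + 1), ?_, le_rfl, h⟩
  have := Exec.sample (x := x) (ω := ω) a i b j (m.st t)
  rwa [NExp.eval_st, NExp.eval_st] at this

theorem Tri.cond {b : BExp} (h₁ : b.ev m → Tri x ω P₁ m T Q) (h₂ : ¬ b.ev m → Tri x ω P₂ m T Q) :
    Tri x ω (.cond b P₁ P₂) m (b.cost + 1 + T) Q := fun t => by
  by_cases hb : b.ev m
  · obtain ⟨m', t', he, ht, hq⟩ := h₁ hb (t + (b.cost + 1))
    exact ⟨m', t', Exec.condTrue ((BExp.eval_st m t b).2 hb) he, by omega, hq⟩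
  · obtain ⟨m', t', he, ht, hq⟩ := h₂ hb (t + (b.cost + 1))
    exact ⟨m', t', Exec.condFalse (fun h => hb ((BExp.eval_st m t b).1 h)) he, by omega, hq⟩

/-- A loop that runs `N` times. -/
theorem Tri.loop {b : BExp} (I : ℕ → Mem → Prop) (N : ℕ) (h0 : I 0 m)
    (hs : ∀ j < N, ∀ m', I j m' → Frame P m m' → b.ev m' ∧ Tri x ω P m' T (I (j + 1)))
    (hN : ∀ m', I N m' → Frame P m m' → ¬ b.ev m' ∧ Q m') :
    Tri x ω (.loop b P) m (N * (b.cost + 1 + T) + (b.cost + 1)) Q := by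
  -- Induction on the number k of rounds still to run, so that the time bound unwinds from the end.
  have key : ∀ k j m', j + k = N → I j m' → Frame P m m' →
      Tri x ω (.loop b P) m' (k * (b.cost + 1 + T) + (b.cost + 1)) Q := by
    intro k
    induction k with
    | zero =>
      intro j m' hj hI hF t
      obtain rfl : j = N := by omega
      obtain ⟨hb, hq⟩ := hN m' hI hF
      exact ⟨m', t + (b.cost + 1), Exec.loopFalse (fun h => hb ((BExp.eval_st m' t b).1 h)),
        by omega, hq⟩
    | succ k ih =>
      intro j m' hj hI hF t
      obtain ⟨hb, hP⟩ := hs j (by omega) m' hI hF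
      obtain ⟨m₁, t₁, he₁, ht₁, hI₁, hF₁⟩ :=
        (hP.imp (Q' := fun m'' => I (j + 1) m'' ∧ Frame P m' m'')
          fun _ h h' => ⟨h, h'⟩) (t + (b.cost + 1))
      obtain ⟨m₂, t₂, he₂, ht₂, hq⟩ := ih (j + 1) m₁ (by omega) hI₁ (hF.trans hF₁) t₁
      refine ⟨m₂, t₂, Exec.loopTrue ((BExp.eval_st m' t b).2 hb) he₁ he₂, ?_, hq⟩
      rw [Nat.succ_mul]
      omega
  exact key N 0 m (by omega) h0 (Frame.refl _ _)

end Triples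

/-! ### Registers and counted loops. -/

/-- The register `a`: entry `0` of the number array `a`. -/
abbrev NExp.reg (a : ℕ) : NExp := .get a (.lit 0)

/-- The complex register `a`: entry `0` of the complex array `a`. -/
abbrev VExp.reg (a : ℕ) : VExp := .get a (.lit 0)

/-- Assignment to a register. -/
abbrev Prog.asg (a : ℕ) (e : NExp) : Prog := .setN a (.lit 0) e

/-- Assignment to a complex register. -/
abbrev Prog.asgV (a : ℕ) (e : VExp) : Prog := .setV a (.lit 0) e

/-- The program `P` is run with register `i` going through `0, …, N - 1`, where `N` is the content
of register `bd`. -/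
def Prog.for (i bd : ℕ) (P : Prog) : Prog :=
  .seq (.asg i (.lit 0)) (.loop (.not (.nle (.reg bd) (.reg i)))
    (.seq P (.asg i (.add (.reg i) (.lit 1)))))

section For

variable {p d : ℕ} {x : Idx p d → ℂ} {ω : Tape p d} {P : Prog} {m : Mem} {T : ℕ} {Q : Mem → Prop}

theorem Prog.wN_for (i bd : ℕ) (P : Prog) : (Prog.for i bd P).wN = i :: (P.wN ++ [i]) := rfl

/-- Each round adds 13 steps to the body: 7 for the test and 6 for the increment. The remaining 10
are the initialization (3) and the final failing test (7). The body has to establish the invariant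
for the memory after the increment. -/
theorem Tri.for {i bd N : ℕ} (I : ℕ → Mem → Prop) (hN : m.n bd 0 = N) (hi : i ∉ P.wN) (hbd : bd ∉ P.wN) (hne : bd ≠ i)
    (h0 : I 0 (m.setN i 0 0))
    (hs : ∀ j < N, ∀ m', I j m' → m'.n i 0 = j → Frame (Prog.for i bd P) m m' →
      Tri x ω P m' T fun m'' => I (j + 1) (m''.setN i 0 (j + 1)))
    (hQ : ∀ m', I N m' → Frame (Prog.for i bd P) m m' → Q m') :
    Tri x ω (Prog.for i bd P) m (N * (T + 13) + 10) Q := by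
  subst hN
  have hbd' : bd ∉ (Prog.for i bd P).wN := by
    rw [Prog.wN_for]; simp [hne, hbd]
  have hF : ∀ m', Frame (.seq P (.asg i (.add (.reg i) (.lit 1)))) (m.setN i 0 0) m' →
      Frame (Prog.for i bd P) m m' := fun m' h =>
    ⟨fun a ha => by
      rw [Prog.wN_for] at ha
      simp only [List.mem_cons, List.mem_append, not_or] at ha
      rw [h.n a (by simp [Prog.wN, ha.1, ha.2.1]), Mem.setN_n_ne _ _ _ ha.1],
      fun a ha => by
        rw [h.v a (by simpa [Prog.for, Prog.wV] using ha), Mem.setN_v],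
      fun hc => by rw [h.c (by simpa [Prog.for, Prog.samples] using hc), Mem.setN_c]⟩
  have := Tri.seq (x := x) (ω := ω) (P₁ := .asg i (.lit 0)) (m := m) (Q := Q)
    (P₂ := .loop (.not (.nle (.reg bd) (.reg i))) (.seq P (.asg i (.add (.reg i) (.lit 1)))))
    (Tri.setN (Tri.loop (T := T + 6) (fun j m' => I j m' ∧ m'.n i 0 = j) (m.n bd 0)
      ⟨h0, by simp⟩ (fun j hj m' hI hf => ⟨?_, ?_⟩) (fun m' hI hf => ⟨?_, ?_⟩)))
  · refine this.le ?_
    simp only [NExp.cost, BExp.cost]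
    ring_nf
    omega
  · have := (hF m' hf).n bd hbd'
    simp [this, hI.2, hj]
  · refine Tri.seq ((hs j hj m' hI.1 hI.2 (hF m' hf)).imp fun m'' h hf' => ?_)
    refine (Tri.setN ?_).le (T₁ := 6) (by simp)
    have := hf'.n i hi
    simpa [this, hI.2] using h
  · have := (hF m' hf).n bd hbd'
    simp [this, hI.2]
  · exact hQ m' hI.1 (hF m' hf)

end For

end SparseFourier

namespace SparseFourier

/-! ### Filling an array segment -/

section Fill

variable {p d : ℕ} {x : Idx p d → ℂ} {ω : Tape p d} {m : Mem}

/-- A loop whose body assigns to entry `base + q` of array `A` in its `q`-th round. -/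
theorem Tri.fill {i bd A N : ℕ} {idx : NExp} {e : VExp} (base : ℕ) (val : ℕ → ℂ)
    (hN : m.n bd 0 = N) (hne : bd ≠ i)
    (hev : ∀ q < N, ∀ m' : Mem, m'.n i 0 = q → (∀ a, a ≠ i → m'.n a = m.n a) →
      (∀ a, a ≠ A → m'.v a = m.v a) →
      (∀ o, o < base ∨ base + q ≤ o → m'.v A o = m.v A o) → m'.c = m.c →
      idx.ev m' = base + q ∧ e.ev m' = val q) :
    Tri x ω (.for i bd (.setV A idx e)) m (N * (idx.cost + e.cost + 1 + 13) + 10)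
      fun m' => (∀ q < N, m'.v A (base + q) = val q) ∧
        ∀ o, o < base ∨ base + N ≤ o → m'.v A o = m.v A o := by
  refine Tri.for (fun j m' => (∀ q < j, m'.v A (base + q) = val q) ∧
        ∀ o, o < base ∨ base + j ≤ o → m'.v A o = m.v A o) hN (by simp [Prog.wN]) (by simp [Prog.wN])
        hne (by simp) ?_ (fun m' h _ => h)
  intro j hj m' hI hij hF
  -- The evaluation hypothesis may use that entries of `A` not yet overwritten are intact, so the
  -- right-hand side is allowed to read `A` itself.
  obtain ⟨h1, h2⟩ := hev j hj m' hij (fun a ha => hF.n a (by simp [Prog.wN_for, Prog.wN, ha]))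
    (fun a ha => hF.v a (by simp [Prog.for, Prog.wV, ha])) hI.2
    (hF.c (by simp [Prog.for, Prog.samples]))
  refine Tri.setV ⟨fun q hq => ?_, fun o ho => ?_⟩
  · rw [Mem.setN_v, h1, h2, Mem.setV_v]
    rcases Nat.lt_succ_iff_lt_or_eq.1 hq with h | rfl
    · rw [if_neg (by omega)]; exact hI.1 q h
    · simp
  · rw [Mem.setN_v, h1, Mem.setV_v_idx _ _ _ (by omega)]
    exact hI.2 o (by omega)

end Fill

/-! ### Roots of unity -/

/-- `exp (2πi a/b)`. -/
noncomputable def ru (a b : ℕ) : ℂ := Complex.exp (2 * Real.pi * Complex.I * (a : ℂ) / (b : ℂ))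

theorem ru_add (a a' b : ℕ) : ru (a + a') b = ru a b * ru a' b := by
  rw [ru, ru, ru, ← Complex.exp_add]; congr 1; push_cast; ring

@[simp] theorem ru_zero (b : ℕ) : ru 0 b = 1 := by simp [ru]

theorem ru_self {b : ℕ} (hb : b ≠ 0) : ru b b = 1 := by
  have : (b : ℂ) ≠ 0 := by exact_mod_cast hb
  rw [ru, mul_div_assoc, div_self this, mul_one, Complex.exp_two_pi_mul_I]

theorem ru_mul_left {c : ℕ} (hc : c ≠ 0) (a b : ℕ) : ru (c * a) (c * b) = ru a b := by
  have : (c : ℂ) ≠ 0 := by exact_mod_cast hc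
  rw [ru, ru]; congr 1; push_cast
  rw [mul_left_comm, mul_div_mul_left _ _ this]

theorem ru_pow (a b k : ℕ) : ru a b ^ k = ru (k * a) b := by
  rw [ru, ru, ← Complex.exp_nat_mul]; congr 1; push_cast; ring

theorem ru_mul_self (a b : ℕ) : ru (a * b) b = 1 := by
  rcases eq_or_ne b 0 with rfl | hb
  · simp
  · rw [← ru_pow, ru_self hb, one_pow]

theorem ru_mod (a b : ℕ) : ru (a % b) b = ru a b := by
  conv_rhs => rw [← Nat.mod_add_div a b, ru_add, mul_comm b, ru_mul_self, mul_one]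

theorem ru_ne_zero (a b : ℕ) : ru a b ≠ 0 := Complex.exp_ne_zero _

theorem ru_eq_one_iff {a b : ℕ} (hb : b ≠ 0) : ru a b = 1 ↔ b ∣ a := by
  have h := Complex.isPrimitiveRoot_exp b hb
  have : ru a b = Complex.exp (2 * Real.pi * Complex.I / b) ^ a := by
    rw [ru, ← Complex.exp_nat_mul]; congr 1; ring
  rw [this, h.pow_eq_one_iff_dvd]

theorem sum_ru {N : ℕ} (hN : N ≠ 0) (a : ℕ) :
    ∑ i ∈ Finset.range N, ru (i * a) N = if N ∣ a then (N : ℂ) else 0 := by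
  simp_rw [← ru_pow]
  split_ifs with h
  · rw [(ru_eq_one_iff hN).2 h]; simp
  · have h1 : ru a N ≠ 1 := fun h' => h ((ru_eq_one_iff hN).1 h')
    rw [geom_sum_eq h1, ru_pow, mul_comm, ru_mul_self]; simp

/-! ### The fast Fourier transform of length `2 ^ m` -/

/-- The `j`-th Fourier coefficient of the subsequence `a q, a (q + G), a (q + 2 G), …` of
length `2 ^ s`, where `G = 2 ^ (m - s)`. -/
noncomputable def fftLev (a : ℕ → ℂ) (m s q j : ℕ) : ℂ :=
  ∑ i ∈ Finset.range (2 ^ s), a (q + i * 2 ^ (m - s)) * ru (i * j) (2 ^ s)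

theorem fftLev_zero (a : ℕ → ℂ) (m q j : ℕ) : fftLev a m 0 q j = a q := by
  simp [fftLev]

theorem fftLev_mod (a : ℕ → ℂ) (m s q j : ℕ) : fftLev a m s q (j % 2 ^ s) = fftLev a m s q j := by
  refine Finset.sum_congr rfl fun i _ => ?_
  rw [← ru_mod (i * (j % 2 ^ s)), ← ru_mod (i * j), Nat.mul_mod_mod]

theorem sum_range_two_mul (f : ℕ → ℂ) (n : ℕ) :
    ∑ i ∈ Finset.range (2 * n), f i =
      ∑ i ∈ Finset.range n, f (2 * i) + ∑ i ∈ Finset.range n, f (2 * i + 1) := by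
  induction n with
  | zero => simp
  | succ n ih =>
    rw [Nat.mul_succ, Finset.sum_range_succ, Finset.sum_range_succ, ih, Finset.sum_range_succ,
      Finset.sum_range_succ]
    ring

/-- Decimation in time: the even and the odd terms of the subsequence with gap 2^(m-s-1) form two
subsequences with twice that gap. The coefficient index is reduced mod 2^s because a transform of
length 2^s has that period. -/
theorem fftLev_succ (a : ℕ → ℂ) {m s : ℕ} (hs : s < m) (q j : ℕ) :
    fftLev a m (s + 1) q j = fftLev a m s q (j % 2 ^ s) +
      ru j (2 ^ (s + 1)) * fftLev a m s (q + 2 ^ (m - (s + 1))) (j % 2 ^ s) := by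
  have hG : 2 ^ (m - s) = 2 * 2 ^ (m - (s + 1)) := by
    rw [← pow_succ']; congr 1; omega
  rw [fftLev_mod, fftLev_mod, fftLev, pow_succ', sum_range_two_mul, fftLev, fftLev, Finset.mul_sum,
    ← pow_succ']
  congr 1 <;> refine Finset.sum_congr rfl fun i _ => ?_
  · rw [hG, pow_succ', mul_assoc 2 i j, ru_mul_left two_ne_zero]
    congr 2; ring
  · rw [hG, show (2 * i + 1) * j = 2 * (i * j) + j by ring, ru_add,
      show 2 ^ (s + 1) = 2 * 2 ^ s from pow_succ' _ _, ru_mul_left two_ne_zero,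
      show q + (2 * i + 1) * 2 ^ (m - (s + 1)) =
        q + 2 ^ (m - (s + 1)) + i * (2 * 2 ^ (m - (s + 1))) by ring]
    ring

/-! #### Registers -/

notation "nP" => (1 : ℕ)
notation "nD" => (2 : ℕ)
notation "nK" => (3 : ℕ)
notation "nN" => (4 : ℕ)
notation "nQ" => (5 : ℕ)
notation "nM" => (6 : ℕ)
notation "nLM" => (7 : ℕ)
notation "aPw" => (8 : ℕ)
notation "fS" => (10 : ℕ)
notation "fHalf" => (11 : ℕ)
notation "fNb" => (12 : ℕ)
notation "fSrc" => (13 : ℕ)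
notation "fDst" => (14 : ℕ)
notation "fJn" => (15 : ℕ)
notation "fJ" => (16 : ℕ)
notation "fSrcH" => (17 : ℕ)
notation "fQ" => (18 : ℕ)
notation "fBase" => (19 : ℕ)
notation "fCur" => (20 : ℕ)
notation "vA" => (2 : ℕ)

open NExp Prog

/-- One output segment of a butterfly stage. -/
def fftSeg : Prog :=
  .seq (asg fSrcH (.add (reg fSrc) (reg fHalf)))
  (.seq (.for fQ fHalf (.setV vA (.add (reg fDst) (reg fQ))
    (.add (.get vA (.add (reg fSrc) (reg fQ)))
      (.mul (.rootOfUnity (reg fJ) (reg fJn)) (.get vA (.add (reg fSrcH) (reg fQ)))))))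
  (.seq (asg fDst (.add (reg fDst) (reg fHalf)))
  (.seq (asg fSrc (.add (reg fSrcH) (reg fHalf)))
  (.cond (.and (.nle (.add (reg fJ) (.lit 1)) (reg fCur)) (.nle (reg fCur) (.add (reg fJ) (.lit 1))))
    (asg fSrc (reg fBase)) .skip))))

/-- One butterfly stage: level `s + 1` is written behind level `s`. -/
def fftStage : Prog :=
  .seq (asg fHalf (.get aPw (.sub (reg nLM) (.add (reg fS) (.lit 1)))))
  (.seq (asg fNb (.add (reg fBase) (reg nM)))
  (.seq (asg fSrc (reg fBase))
  (.seq (asg fDst (reg fNb))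
  (.seq (asg fJn (.add (reg fCur) (reg fCur)))
  (.seq (.for fJ fJn fftSeg)
  (.seq (asg fBase (reg fNb))
  (asg fCur (reg fJn))))))))

/-- The transform of entries `0, …, M - 1` of the array `vA`; the result starts at entry `m M`. -/
def fft : Prog :=
  .seq (asg fBase (.lit 0)) (.seq (asg fCur (.lit 1)) (.for fS nLM fftStage))

/-- The tables the transform relies on. -/
structure FFTReady (lm : ℕ) (m : Mem) : Prop where
  lm_eq : m.n nLM 0 = lm
  M_eq : m.n nM 0 = 2 ^ lm
  pw : ∀ i < lm, m.n aPw i = 2 ^ i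

/-! ### Correctness of the radix-2 transform. -/

section FFT

variable {p d : ℕ} {x : Idx p d → ℂ} {ω : Tape p d} {m : Mem} {a : ℕ → ℂ} {lm s : ℕ}

/-- Segment j of the new level needs segment j mod 2^s of the old one. There is no remainder
operation, so the source pointer moves along and is reset to `base` at the single moment when j + 1
= 2^s; after the last segment it may point anywhere. -/
theorem fftSeg_spec {j half base nb : ℕ} (hs : s < lm)
    (hhalf : half = 2 ^ (lm - (s + 1)))
    (hnb : nb = base + 2 ^ lm) (h1 : m.n fHalf 0 = half) (h3 : m.n fJn 0 = 2 ^ (s + 1))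
    (h4 : m.n fCur 0 = 2 ^ s) (h5 : m.n fBase 0 = base)
    (h6 : m.n fDst 0 = nb + j * half) (h7 : m.n fSrc 0 = base + (j % 2 ^ s) * (2 * half))
    (h8 : m.n fJ 0 = j)
    (hA : ∀ j < 2 ^ s, ∀ q < 2 * half, m.v vA (base + q + j * (2 * half)) = fftLev a lm s q j) :
    Tri x ω fftSeg m (half * 38 + 60) fun m' =>
      (∀ o < nb + j * half, m'.v vA o = m.v vA o) ∧
      (∀ q < half, m'.v vA (nb + q + j * half) = fftLev a lm (s + 1) q j) ∧
      m'.n fDst 0 = nb + (j + 1) * half ∧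
      (j + 1 < 2 ^ (s + 1) → m'.n fSrc 0 = base + ((j + 1) % 2 ^ s) * (2 * half)) := by
  have hjm : j % 2 ^ s < 2 ^ s := Nat.mod_lt _ (by positivity)
  have hMh : 2 ^ s * (2 * half) = 2 ^ lm := by
    rw [hhalf, ← pow_succ', ← pow_add]; congr 1; omega
  -- The source segment lies below `nb`, hence is not destroyed by the entries being written.
  have hlt : base + (j % 2 ^ s) * (2 * half) + 2 * half ≤ nb := by
    rw [hnb, ← hMh]; nlinarith
  apply Tri.le
  · apply Tri.seq
    apply Tri.setN
    apply Tri.bind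
    · refine Tri.fill (nb + j * half) (fun q => fftLev a lm (s + 1) q j) (N := half) (by simpa using h1)
        (by decide) ?_
      intro q hq m' hq' hn hv ho hc
      have hq2 : q < half := hq
      have e1 := hA (j % 2 ^ s) hjm q (by omega)
      have e2 := hA (j % 2 ^ s) hjm (q + half) (by omega)
      have o1 := ho (base + (j % 2 ^ s) * (2 * half) + q) (by left; omega)
      have o2 := ho (base + (j % 2 ^ s) * (2 * half) + half + q) (by left; omega)
      simp only [Mem.setN_v] at o1 o2
      refine ⟨by simp [hq', hn, h6], ?_⟩
      simp only [VExp.ev_add, VExp.ev_get, NExp.ev_add, NExp.ev_get, NExp.ev_lit, VExp.ev_mul,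
        VExp.ev_rootOfUnity, hq', hn fSrc (by decide), hn fSrcH (by decide), hn fJ (by decide),
        hn fJn (by decide), Mem.setN_n_same, Mem.setN_n_ne _ _ _ (show fSrc ≠ fSrcH by decide),
        Mem.setN_n_ne _ _ _ (show fJ ≠ fSrcH by decide),
        Mem.setN_n_ne _ _ _ (show fJn ≠ fSrcH by decide), h7, h1, h8, h3, o1, o2]
      rw [fftLev_succ a hs, ← hhalf, ← e1, ← e2, ru]
      rw [show base + j % 2 ^ s * (2 * half) + q = base + q + j % 2 ^ s * (2 * half) by ring,
        show base + j % 2 ^ s * (2 * half) + half + q =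
          base + (q + half) + j % 2 ^ s * (2 * half) by ring]
    · intro m1 ⟨hf1, hf2⟩ hF
      have hn : ∀ a, a ≠ fQ → m1.n a = (m.setN fSrcH 0 (m.n fSrc 0 + m.n fHalf 0)).n a :=
        fun a ha => hF.n a (by simp [Prog.wN_for, Prog.wN, ha])
      simp only [NExp.ev_lit, NExp.ev_add, NExp.ev_get, Mem.setN_v] at hf1 hf2
      apply Tri.seq
      apply Tri.setN
      apply Tri.seq
      apply Tri.setN
      have g1 : ∀ o < nb + j * half, m1.v vA o = m.v vA o := fun o ho => hf2 o (Or.inl ho)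
      have g2 : ∀ q < half, m1.v vA (nb + q + j * half) = fftLev a lm (s + 1) q j :=
        fun q hq => by rw [← hf1 q hq]; congr 1; ring
      refine Tri.cond (T := 5) (fun hb => ?_) (fun hb => ?_)
      · refine (Tri.setN ?_).le (by simp [NExp.cost])
        simp [hn, h1, h6, h7, h8, h4] at hb
        refine ⟨by simpa using g1, by simpa using g2, by simp [hn, h1, h6]; ring, fun _ => ?_⟩
        have : (j + 1) % 2 ^ s = 0 := by
          rw [show j + 1 = 2 ^ s by omega, Nat.mod_self]
        simp [hn, h5, this]
      · refine (Tri.skip ?_).le (by simp)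
        simp [hn, h1, h6, h7, h8, h4] at hb
        refine ⟨by simpa using g1, by simpa using g2, by simp [hn, h1, h6]; ring, fun hj1 => ?_⟩
        have : (j + 1) % 2 ^ s = j % 2 ^ s + 1 := by
          rw [pow_succ] at hj1
          rcases lt_or_ge j (2 ^ s) with h | h
          · rw [Nat.mod_eq_of_lt h, Nat.mod_eq_of_lt]; omega
          · rw [Nat.mod_eq_sub_mod h, Nat.mod_eq_sub_mod (show 2 ^ s ≤ j + 1 by omega),
              Nat.mod_eq_of_lt (show j - 2 ^ s < 2 ^ s by omega), Nat.mod_eq_of_lt (by omega)]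
            omega
        simp [hn, h1, h7, this]; ring
  · simp [NExp.cost, VExp.cost, BExp.cost]
    omega

/-- Level s fills the block of length 2^lm that starts at s·2^lm, with the coefficient (q, j) at
offset q + j·2^(lm-s). Every level gets a block of its own, so nothing has to be permuted. -/
theorem fftStage_spec (hR : FFTReady lm m) (hs : s < lm) (h1 : m.n fS 0 = s)
    (h2 : m.n fBase 0 = s * 2 ^ lm) (h3 : m.n fCur 0 = 2 ^ s)
    (hA : ∀ j < 2 ^ s, ∀ q < 2 ^ (lm - s),
      m.v vA (s * 2 ^ lm + q + j * 2 ^ (lm - s)) = fftLev a lm s q j) :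
    Tri x ω fftStage m (2 ^ lm * 200 + 60) fun m' =>
      m'.n fBase 0 = (s + 1) * 2 ^ lm ∧ m'.n fCur 0 = 2 ^ (s + 1) ∧
      ∀ j < 2 ^ (s + 1), ∀ q < 2 ^ (lm - (s + 1)),
        m'.v vA ((s + 1) * 2 ^ lm + q + j * 2 ^ (lm - (s + 1))) = fftLev a lm (s + 1) q j := by
  have hG : 2 ^ (lm - s) = 2 * 2 ^ (lm - (s + 1)) := by
    rw [← pow_succ']; congr 1; omega
  have hM : 2 ^ (s + 1) * 2 ^ (lm - (s + 1)) = 2 ^ lm := by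
    rw [← pow_add]; congr 1; omega
  rw [hG] at hA
  have hpw := hR.pw (lm - (s + 1)) (by omega)
  obtain ⟨half, hhalf⟩ : ∃ half, half = 2 ^ (lm - (s + 1)) := ⟨_, rfl⟩
  rw [← hhalf] at hA hpw hM ⊢
  have hpos : 0 < half := by rw [hhalf]; positivity
  apply Tri.le
  · apply Tri.seq
    apply Tri.setN
    apply Tri.seq
    apply Tri.setN
    apply Tri.seq
    apply Tri.setN
    apply Tri.seq
    apply Tri.setN
    apply Tri.seq
    apply Tri.setN
    simp [hR.lm_eq, h1, h2, h3, hpw, hR.M_eq]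
    apply Tri.bind
    · refine Tri.for (T := half * 38 + 60) (fun j m' =>
        m'.n fDst 0 = (s * 2 ^ lm + 2 ^ lm) + j * half ∧
        (j < 2 ^ (s + 1) → m'.n fSrc 0 = s * 2 ^ lm + (j % 2 ^ s) * (2 * half)) ∧
        (∀ o < s * 2 ^ lm + 2 ^ lm, m'.v vA o = m.v vA o) ∧
        ∀ j' < j, ∀ q < half,
          m'.v vA ((s * 2 ^ lm + 2 ^ lm) + q + j' * half) = fftLev a lm (s + 1) q j')
        (N := 2 ^ (s + 1)) (by simp [pow_succ, mul_two]) (by decide) (by decide) (by decide)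
        (by simp) ?_ (fun m' h _ => h)
      intro j hj2 m' hI hj' hF
      have hn : ∀ a, a ∉ (Prog.for fJ fJn fftSeg).wN → _ := hF.n
      refine (fftSeg_spec (a := a) (half := half) hs hhalf rfl ?_ ?_ ?_ ?_ hI.1 (hI.2.1 hj2) hj' ?_).imp ?_
      · rw [hn _ (by decide)]; simp
      · rw [hn _ (by decide)]; simp [pow_succ, mul_two]
      · rw [hn _ (by decide)]; simp [h3]
      · rw [hn _ (by decide)]; simp [h2]
      · intro j' hj' q hq
        rw [hI.2.2.1, hA j' hj' q hq]
        have : 2 ^ s * (2 * half) = 2 ^ lm := by rw [← hM]; ring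
        rw [← this]; nlinarith
      · rintro m'' ⟨k1, k2, k3, k4⟩ -
        simp only [Mem.setN_v]
        refine ⟨by simpa using k3, by simpa using k4, fun o ho => ?_, fun j' hj' q hq => ?_⟩
        · rw [k1 o (by omega), hI.2.2.1 o ho]
        · rcases Nat.lt_succ_iff_lt_or_eq.1 hj' with h | rfl
          · rw [k1 _ ?_, hI.2.2.2 j' h q hq]
            nlinarith
          · exact k2 q hq
    · intro m1 hI hF
      apply Tri.seq
      apply Tri.setN
      apply Tri.setN
      refine ⟨?_, ?_, ?_⟩
      · have := hF.n fNb (by decide)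
        simp [this]; ring
      · have := hF.n fJn (by decide)
        simp [this, pow_succ, mul_two]
      · intro j hj q hq
        simp only [Mem.setN_v]
        rw [← hI.2.2.2 j hj q hq]
        congr 1; ring
  · simp [NExp.cost]
    rw [← hM]
    have : 0 < 2 ^ (s + 1) := by positivity
    nlinarith

/-- At level 0 the subsequences are the single entries of the input; at level `lm` only q = 0 is
left and its coefficients are the full transform. -/
theorem fft_spec (hR : FFTReady lm m) :
    Tri x ω fft m (lm * (2 ^ lm * 280) + 20) fun m' =>
      ∀ j < 2 ^ lm, m'.v vA (lm * 2 ^ lm + j) =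
        ∑ i ∈ Finset.range (2 ^ lm), m.v vA i * ru (i * j) (2 ^ lm) := by
  apply Tri.le
  · apply Tri.seq
    apply Tri.setN
    apply Tri.seq
    apply Tri.setN
    refine Tri.for (T := 2 ^ lm * 200 + 60) (fun s m' =>
      m'.n fBase 0 = s * 2 ^ lm ∧ m'.n fCur 0 = 2 ^ s ∧
      ∀ j < 2 ^ s, ∀ q < 2 ^ (lm - s),
        m'.v vA (s * 2 ^ lm + q + j * 2 ^ (lm - s)) = fftLev (m.v vA) lm s q j)
      (N := lm) (by simpa using hR.lm_eq) (by decide) (by decide) (by decide)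
      (by simp [fftLev_zero]) ?_ ?_
    · intro s hs m' hI hs' hF
      have hR' : FFTReady lm m' := ⟨by rw [hF.n _ (by decide)]; simpa using hR.lm_eq,
        by rw [hF.n _ (by decide)]; simpa using hR.M_eq,
        fun i hi => by rw [hF.n _ (by decide)]; simpa using hR.pw i hi⟩
      refine (fftStage_spec hR' hs hs' hI.1 hI.2.1 hI.2.2).imp ?_
      intro m'' h _
      simpa using h
    · intro m' hI _ j hj
      have := hI.2.2
      have := this j hj 0 (by simp)
      simpa [fftLev] using this
  · have : 0 < 2 ^ lm := by positivity
    simp [NExp.cost]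
    nlinarith

end FFT

end SparseFourier

namespace SparseFourier

open NExp Prog

/-! ### Bluestein's algorithm -/

/-- The chirp `ω ^ (i choose 2)`. -/
noncomputable def chirp (p i : ℕ) : ℂ := ru (i.choose 2) p

theorem choose_two_add (f a : ℕ) : (f + a).choose 2 = f.choose 2 + a.choose 2 + a * f := by
  induction a with
  | zero => simp
  | succ a ih =>
    rw [← add_assoc, Nat.choose_succ_succ' (f + a) 1, Nat.choose_succ_succ' a 1, ih]
    simp only [Nat.choose_one_right]
    ring

/-- This identity drives Bluestein's algorithm: it turns ω^(af) into a quotient of chirps. With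
binomial coefficients instead of halved squares all exponents are integers, p may be even, and the
exponents can be generated by additions. -/
theorem chirp_add (p f a : ℕ) : chirp p (f + a) = chirp p f * chirp p a * ru (a * f) p := by
  simp only [chirp, choose_two_add, ru_add]

theorem chirp_ne_zero (p i : ℕ) : chirp p i ≠ 0 := ru_ne_zero _ _

/-- The reversed chirp that is convolved with. -/
noncomputable def revChirp (p M q : ℕ) : ℂ := if q = 0 then 1 else chirp p (M - q)

/-- The Fourier transform of the reversed chirp. -/
noncomputable def revChirpHat (p M j : ℕ) : ℂ :=
  ∑ q ∈ Finset.range M, revChirp p M q * ru (q * j) M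

/-- Only q ≡ -g mod M survives, which is q = 0 for g = 0 and q = M - g otherwise; the factor M comes
from summing over the M-th roots of unity. -/
theorem sum_revChirp {p M g : ℕ} (hg : g < M) :
    ∑ q ∈ Finset.range M, revChirp p M q * (if M ∣ q + g then (M : ℂ) else 0) =
      chirp p g * M := by
  rcases eq_or_ne g 0 with rfl | hg0
  · rw [Finset.sum_eq_single_of_mem 0 (Finset.mem_range.2 hg)]
    · simp [revChirp, chirp]
    · intro q hq hq0
      rw [if_neg, mul_zero]
      rw [add_zero]
      exact fun h => absurd (Nat.le_of_dvd (by omega) h) (by have := Finset.mem_range.1 hq; omega)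
  · rw [Finset.sum_eq_single_of_mem (M - g) (Finset.mem_range.2 (by omega))]
    · rw [if_pos (by rw [Nat.sub_add_cancel hg.le]), revChirp, if_neg (by omega)]
      congr 2; omega
    · intro q hq hq0
      have := Finset.mem_range.1 hq
      rw [if_neg, mul_zero]
      rintro ⟨k, hk⟩
      have : k < 2 := by
        by_contra hk2
        have : M * 2 ≤ M * k := Nat.mul_le_mul_left _ (by omega)
        omega
      interval_cases k <;> omega

/-- By `chirp_add` the transform of length p is a correlation of v/chirp with the chirp, divided by
the chirp at f. Since a + f < 2p ≤ M, it does not wrap around modulo M, so it becomes a product of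
transforms of length M. Because the chirp is stored in reverse, the final transform is again a
forward one. -/
theorem bluestein {p M f : ℕ} (hM : 2 * p ≤ M) (hf : f < p) (v b : ℕ → ℂ)
    (hb : ∀ a < p, b a = v a / chirp p a) (hb' : ∀ a, p ≤ a → a < M → b a = 0) :
    (∑ j ∈ Finset.range M, (∑ a ∈ Finset.range M, b a * ru (a * j) M) * revChirpHat p M j *
      ru (j * f) M) / M / chirp p f = ∑ a ∈ Finset.range p, v a * ru (a * f) p := by
  have hM0 : (M : ℂ) ≠ 0 := by norm_cast; omega
  have h1 : ∀ j, (∑ a ∈ Finset.range M, b a * ru (a * j) M) * revChirpHat p M j *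
      ru (j * f) M = ∑ a ∈ Finset.range M, b a * ∑ q ∈ Finset.range M, revChirp p M q *
        ru (j * (q + (a + f))) M := by
    intro j
    rw [revChirpHat, Finset.sum_mul, Finset.sum_mul]
    refine Finset.sum_congr rfl fun a _ => ?_
    rw [mul_assoc, mul_assoc, Finset.sum_mul, Finset.mul_sum]
    congr 1
    refine Finset.sum_congr rfl fun q _ => ?_
    rw [show j * (q + (a + f)) = q * j + a * j + j * f by ring, ru_add, ru_add]
    ring
  simp_rw [h1]
  rw [Finset.sum_comm]
  -- Summing over j first leaves only the q with M ∣ q + a + f, for which the reversed chirp is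
  -- chirp(a + f).
  have h2 : ∀ a ∈ Finset.range M, (∑ j ∈ Finset.range M, b a * ∑ q ∈ Finset.range M,
      revChirp p M q * ru (j * (q + (a + f))) M) =
      if a < p then v a * ru (a * f) p * M * chirp p f else 0 := by
    intro a ha
    rw [← Finset.mul_sum, Finset.sum_comm]
    simp_rw [← Finset.mul_sum, sum_ru (show M ≠ 0 by omega)]
    split_ifs with hap
    · rw [sum_revChirp (by omega), hb a hap, add_comm a f, chirp_add]
      field_simp [chirp_ne_zero]
    · rw [hb' a (by omega) (Finset.mem_range.1 ha), zero_mul]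
  rw [Finset.sum_congr rfl h2, ← Finset.sum_filter]
  have h3 : (Finset.range M).filter (· < p) = Finset.range p := by
    ext a; simp only [Finset.mem_filter, Finset.mem_range]; omega
  rw [h3, div_div, Finset.sum_div]
  refine Finset.sum_congr rfl fun a _ => ?_
  have := chirp_ne_zero p f
  field_simp

notation "nOff" => (9 : ℕ)
notation "dAx" => (21 : ℕ)
notation "dRest" => (22 : ℕ)
notation "dSrc" => (23 : ℕ)
notation "dA" => (24 : ℕ)
notation "dDst" => (25 : ℕ)
notation "vBuf" => (3 : ℕ)
notation "vOut" => (4 : ℕ)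
notation "vW" => (5 : ℕ)
notation "vCh" => (6 : ℕ)

/-- The transform of one line of length `p`. -/
def dftLine : Prog :=
  .seq (.for dA nM (.setV vA (reg dA) (.ofNat (.lit 0))))
  (.seq (.for dA nP (.setV vA (reg dA)
    (.div (.get vBuf (.add (reg dSrc) (reg dA))) (.get vW (reg dA)))))
  (.seq fft
  (.seq (.for dA nM (.setV vA (reg dA)
    (.mul (.get vA (.add (reg nOff) (reg dA))) (.get vCh (reg dA)))))
  (.seq fft
  (.seq (asg dDst (reg dRest))
  (.seq (.for dA nP (.seq
    (.setV vOut (reg dDst)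
      (.div (.div (.get vA (.add (reg nOff) (reg dA))) (.ofNat (reg nM))) (.get vW (reg dA))))
    (asg dDst (.add (reg dDst) (reg nQ)))))
  (asg dSrc (.add (reg dSrc) (reg nP)))))))))

/-- The transform along the first axis, followed by a rotation of the axes. -/
def dftAxis : Prog :=
  .seq (asg dSrc (.lit 0))
  (.seq (.for dRest nQ dftLine)
  (.for dA nN (.setV vBuf (reg dA) (.get vOut (reg dA)))))

/-- The transform of the array `vBuf`, in place. -/
def dftProg : Prog := .for dAx nD dftAxis

/-- The tables the transform relies on. -/
structure DFTReady (p d lm : ℕ) (m : Mem) : Prop extends FFTReady lm m where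
  two_mul_le : 2 * p ≤ 2 ^ lm
  p_eq : m.n nP 0 = p
  d_eq : m.n nD 0 = d
  n_eq : m.n nN 0 = p ^ d
  q_eq : m.n nQ 0 = p ^ (d - 1)
  off_eq : m.n nOff 0 = lm * 2 ^ lm
  w_eq : ∀ i < p, m.v vW i = chirp p i
  ch_eq : ∀ j < 2 ^ lm, m.v vCh j = revChirpHat p (2 ^ lm) j

/-- The number arrays holding parameters and tables of the transform. -/
def dftParams : List ℕ := [nP, nD, nN, nQ, nM, nLM, aPw, nOff]

theorem DFTReady.of_frame {p d lm : ℕ} {m m' : Mem} (h : DFTReady p d lm m)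
    (hn : ∀ a ∈ dftParams, m'.n a = m.n a) (hv : ∀ a ∈ [vW, vCh], m'.v a = m.v a) :
    DFTReady p d lm m' := by
  constructor
  · constructor
    · rw [hn _ (by decide)]; exact h.lm_eq
    · rw [hn _ (by decide)]; exact h.M_eq
    · rw [hn _ (by decide)]; exact h.pw
  · exact h.two_mul_le
  · rw [hn _ (by decide)]; exact h.p_eq
  · rw [hn _ (by decide)]; exact h.d_eq
  · rw [hn _ (by decide)]; exact h.n_eq
  · rw [hn _ (by decide)]; exact h.q_eq
  · rw [hn _ (by decide)]; exact h.off_eq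
  · rw [hv _ (by decide)]; exact h.w_eq
  · rw [hv _ (by decide)]; exact h.ch_eq

theorem DFTReady.frame {p d lm : ℕ} {m m' : Mem} {P : Prog} (h : DFTReady p d lm m)
    (hF : Frame P m m') (hn : ∀ a ∈ dftParams, a ∉ P.wN) (hv : ∀ a ∈ [vW, vCh], a ∉ P.wV) :
    DFTReady p d lm m' :=
  h.of_frame (fun a ha => hF.n a (hn a ha)) (fun a ha => hF.v a (hv a ha))

/-! ### Correctness of the transforms of one line and along one axis. -/

section DFT

variable {p' d' : ℕ} {x : Idx p' d' → ℂ} {ω : Tape p' d'} {m : Mem} {p d lm : ℕ}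

theorem dftLine_spec (hR : DFTReady p d lm m) {src rest : ℕ}
    (h1 : m.n dSrc 0 = src) (h2 : m.n dRest 0 = rest) (hQ : 0 < p ^ (d - 1)) (hp : 0 < p) :
    Tri x ω dftLine m (lm * (2 ^ lm * 800)) fun m' =>
      m'.n dSrc 0 = src + p ∧
      (∀ f < p, m'.v vOut (rest + f * p ^ (d - 1)) =
        ∑ a ∈ Finset.range p, m.v vBuf (src + a) * ru (a * f) p) ∧
      ∀ o, (∀ f < p, o ≠ rest + f * p ^ (d - 1)) → m'.v vOut o = m.v vOut o := by
  have hlm : 1 ≤ lm := by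
    rcases Nat.eq_zero_or_pos lm with rfl | h
    · have := hR.two_mul_le; omega
    · exact h
  have hoff : 2 ^ lm ≤ lm * 2 ^ lm := Nat.le_mul_of_pos_left _ hlm
  have hpM : p ≤ 2 ^ lm := by have := hR.two_mul_le; omega
  apply Tri.le
  · apply Tri.bind
    · refine Tri.fill 0 (fun _ => 0) hR.M_eq (by decide) ?_
      intro q hq m' hq' hn hv ho hc
      simp [hq']
    intro m1 ⟨hA1, hA2⟩ hF1
    have hR1 := hR.frame hF1 (by decide) (by decide)
    apply Tri.bind
    · refine Tri.fill 0 (fun a => m.v vBuf (src + a) / chirp p a) hR1.p_eq (by decide) ?_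
      intro q hq m' hq' hn hv ho hc
      have e1 : m1.n dSrc 0 = src := by rw [hF1.n _ (by decide), h1]
      simp [hq', hn, hv, e1, hR1.w_eq q hq, hF1.v vBuf (by decide)]
    intro m2 ⟨hB1, hB2⟩ hF2
    have hR2 := hR1.frame hF2 (by decide) (by decide)
    simp only [zero_add] at hA1 hB1 hB2
    -- Zero padding up to length 2^lm, left from the first fill.
    have hb' : ∀ a, p ≤ a → a < 2 ^ lm → m2.v vA a = 0 := fun a h h' => by
      rw [hB2 a (Or.inr h), hA1 a h']
    apply Tri.bind (fft_spec hR2.toFFTReady)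
    intro m3 hC hF3
    have hR3 := hR2.frame hF3 (by decide) (by decide)
    apply Tri.bind
    · refine Tri.fill 0 (fun j => m3.v vA (lm * 2 ^ lm + j) * revChirpHat p (2 ^ lm) j)
        hR3.M_eq (by decide) ?_
      intro q hq m' hq' hn hv ho hc
      simp [hq', hn, hv, hR3.ch_eq q hq, hR3.off_eq, ho (lm * 2 ^ lm + q) (by right; omega)]
    intro m4 ⟨hD1, _⟩ hF4
    have hR4 := hR3.frame hF4 (by decide) (by decide)
    simp only [zero_add] at hD1
    apply Tri.bind (fft_spec hR4.toFFTReady)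
    intro m5 hE hF5
    have hR5 := hR4.frame hF5 (by decide) (by decide)
    have hres : ∀ f < p, m5.v vA (lm * 2 ^ lm + f) / ((2 ^ lm : ℕ) : ℂ) / chirp p f =
        ∑ a ∈ Finset.range p, m.v vBuf (src + a) * ru (a * f) p := by
      intro f hf
      rw [← bluestein hR.two_mul_le hf (fun a => m.v vBuf (src + a)) (m2.v vA) hB1 hb',
        hE f (by omega)]
      congr 2
      refine Finset.sum_congr rfl fun j hj => ?_
      rw [hD1 j (Finset.mem_range.1 hj), hC j (Finset.mem_range.1 hj)]
    have hrest : m5.n dRest 0 = rest := by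
      rw [hF5.n _ (by decide), hF4.n _ (by decide), hF3.n _ (by decide), hF2.n _ (by decide),
        hF1.n _ (by decide), h2]
    have hsrc : m5.n dSrc 0 = src := by
      rw [hF5.n _ (by decide), hF4.n _ (by decide), hF3.n _ (by decide), hF2.n _ (by decide),
        hF1.n _ (by decide), h1]
    have hout : m5.v vOut = m.v vOut := by
      rw [hF5.v _ (by decide), hF4.v _ (by decide), hF3.v _ (by decide), hF2.v _ (by decide),
        hF1.v _ (by decide)]
    apply Tri.seq
    apply Tri.setN
    simp only [ev_lit, ev_get, hrest]
    apply Tri.bind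
    · refine Tri.for (T := 25) (fun f m' => m'.n dDst 0 = rest + f * p ^ (d - 1) ∧
        (∀ f' < f, m'.v vOut (rest + f' * p ^ (d - 1)) =
          ∑ a ∈ Finset.range p, m.v vBuf (src + a) * ru (a * f') p) ∧
        ∀ o, (∀ f' < f, o ≠ rest + f' * p ^ (d - 1)) → m'.v vOut o = m.v vOut o)
        (N := p) (by simpa using hR5.p_eq) (by decide) (by decide) (by decide) (by simp [hout]) ?_ (fun m' h _ => h)
      intro f hf m' hI hf' hF
      have g1 : m'.n nOff 0 = lm * 2 ^ lm := by
        rw [hF.n _ (by decide)]; simpa using hR5.off_eq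
      have g2 : m'.n nM 0 = 2 ^ lm := by
        rw [hF.n _ (by decide)]; simpa using hR5.M_eq
      have g3 : m'.v vA = m5.v vA := by
        rw [hF.v _ (by decide)]; rfl
      have g4 : m'.v vW f = chirp p f := by
        rw [hF.v _ (by decide)]; simpa using hR5.w_eq f hf
      have g5 : m'.n nQ 0 = p ^ (d - 1) := by
        rw [hF.n _ (by decide)]; simpa using hR5.q_eq
      apply Tri.le
      · apply Tri.seq
        apply Tri.setV
        apply Tri.setN
        simp only [ev_lit, ev_get, hI.1, VExp.ev_div, VExp.ev_get, ev_add, g1, hf', g3,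
          VExp.ev_ofNat, g2, g4, hres f hf, Mem.setV_n, g5]
        refine ⟨by simp; ring, fun f' h => ?_, fun o ho => ?_⟩
        · simp only [Mem.setN_v, Mem.setV_v]
          rcases Nat.lt_succ_iff_lt_or_eq.1 h with h | rfl
          · rw [if_neg, hI.2.1 f' h]
            intro he
            have := Nat.eq_of_mul_eq_mul_right hQ (Nat.add_left_cancel he)
            omega
          · simp
        · simp only [Mem.setN_v]
          rw [Mem.setV_v_idx _ _ _ (ho f (by omega)), hI.2.2 o fun f' h => ho f' (by omega)]
      · simp [NExp.cost, VExp.cost]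
    intro m6 hI hF6
    refine Tri.setN ⟨?_, ?_, ?_⟩
    · simp [hF6.n dSrc (by decide), hF6.n nP (by decide), hR5.p_eq, hsrc]
    · simpa using hI.2.1
    · simpa using hI.2.2
  · have h3 : 2 ≤ 2 ^ lm := by have := hR.two_mul_le; omega
    simp [NExp.cost, VExp.cost]
    nlinarith

/-- Reading at p·rest + a and writing at rest + f·p^(d-1) moves the transformed lowest digit to the
top. After d rounds every axis has been transformed and is back in its place, so one program serves
all axes. -/
theorem dftAxis_spec (hR : DFTReady p d lm m) (hp : 0 < p) (hd : 0 < d) :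
    Tri x ω dftAxis m (p ^ (d - 1) * (lm * (2 ^ lm * 900))) fun m' =>
      ∀ rest < p ^ (d - 1), ∀ f < p, m'.v vBuf (rest + f * p ^ (d - 1)) =
        ∑ a ∈ Finset.range p, m.v vBuf (p * rest + a) * ru (a * f) p := by
  have hQ : 0 < p ^ (d - 1) := by positivity
  have hn : p ^ d = p * p ^ (d - 1) := by rw [← pow_succ']; congr 1; omega
  apply Tri.le
  · apply Tri.seq
    apply Tri.setN
    apply Tri.bind
    · refine Tri.for (T := lm * (2 ^ lm * 800)) (fun r m' => m'.n dSrc 0 = p * r ∧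
        ∀ rest < r, ∀ f < p, m'.v vOut (rest + f * p ^ (d - 1)) =
          ∑ a ∈ Finset.range p, m.v vBuf (p * rest + a) * ru (a * f) p)
        (N := p ^ (d - 1)) (by simpa using hR.q_eq) (by decide) (by decide) (by decide) (by simp)
        ?_ (fun m' h _ => h)
      intro r hr m' hI hr' hF
      have hR' : DFTReady p d lm m' := hR.of_frame
        (fun a ha => (hF.n a (by fin_cases ha <;> decide)).trans
          (by fin_cases ha <;> simp))
        (fun a ha => (hF.v a (by fin_cases ha <;> decide)).trans rfl)
      refine (dftLine_spec hR' hI.1 hr' hQ hp).imp ?_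
      rintro m'' ⟨k1, k2, k3⟩ -
      refine ⟨by simp [k1]; ring, fun rest hrest f hf => ?_⟩
      rw [Mem.setN_v]
      rcases Nat.lt_succ_iff_lt_or_eq.1 hrest with h | rfl
      · rw [k3 _ ?_, hI.2 rest h f hf]
        intro f' hf' he
        -- Positions written for different values of `rest` differ modulo p^(d-1), so a line never
        -- overwrites an earlier one.
        have h1 := congrArg (· % p ^ (d - 1)) he
        simp only [Nat.add_mul_mod_self_right] at h1
        rw [Nat.mod_eq_of_lt (by omega), Nat.mod_eq_of_lt hr] at h1
        omega
      · rw [k2 f hf, hF.v _ (by decide)]; rfl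
    intro m1 hI hF1
    have hN : m1.n nN 0 = p ^ d := by rw [hF1.n _ (by decide)]; simpa using hR.n_eq
    refine (Tri.fill 0 (fun o => m1.v vOut o) hN (by decide) ?_).imp ?_
    · intro q hq m' hq' hn hv ho hc
      simp [hq', hv]
    · rintro m2 ⟨h1, -⟩ -
      intro rest hrest f hf
      have := h1 (rest + f * p ^ (d - 1)) (by rw [hn]; nlinarith)
      rw [zero_add] at this
      rw [this, hI.2 rest hrest f hf]
  · have h2 := hR.two_mul_le
    simp [NExp.cost, VExp.cost]
    have hlm : 1 ≤ lm := by
      rcases Nat.eq_zero_or_pos lm with rfl | h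
      · simp at h2; omega
      · exact h
    have h4 : 2 ^ lm ≤ lm * 2 ^ lm := Nat.le_mul_of_pos_left _ hlm
    obtain ⟨Y, hY⟩ : ∃ Y, Y = lm * 2 ^ lm := ⟨_, rfl⟩
    rw [hn]
    have e1 : p ^ (d - 1) * (2 * p) ≤ p ^ (d - 1) * Y := Nat.mul_le_mul_left _ (by omega)
    have e2 : p ^ (d - 1) * 2 ≤ p ^ (d - 1) * Y := Nat.mul_le_mul_left _ (by omega)
    have e3 : lm * (2 ^ lm * 800) = Y * 800 := by rw [hY]; ring
    have e4 : lm * (2 ^ lm * 900) = Y * 900 := by rw [hY]; ring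
    rw [e3, e4]
    nlinarith

end DFT

/-! ### The transform on `[p]^d` -/

/-- The character `t ↦ ω ^ (f · t)`. -/
noncomputable def chi {p d : ℕ} (f t : Idx p d) : ℂ := ru (∑ i, (f i : ℕ) * (t i : ℕ)) p

theorem chi_eq_prod {p d : ℕ} (f t : Idx p d) : chi f t = ∏ i, ru ((f i : ℕ) * (t i : ℕ)) p := by
  have : ∀ s : Finset (Fin d), ru (∑ i ∈ s, (f i : ℕ) * (t i : ℕ)) p =
      ∏ i ∈ s, ru ((f i : ℕ) * (t i : ℕ)) p := by
    intro s
    induction s using Finset.cons_induction with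
    | empty => simp
    | cons a s ha ih => rw [Finset.sum_cons, Finset.prod_cons, ru_add, ih]
  exact this _

/-- The unnormalized Fourier transform. -/
noncomputable def dftU {p d : ℕ} (v : Idx p d → ℂ) (f : Idx p d) : ℂ := ∑ t, v t * chi f t

/-- The factor contributed by place `j` after `i` rotated transforms. -/
noncomputable def rotFactor {p d : ℕ} (s : Idx p d) (i j b : ℕ) : ℂ :=
  if h : i + j < d then (if (s ⟨i + j, h⟩ : ℕ) = b then 1 else 0)
  else if h : i + j - d < d then ru ((s ⟨i + j - d, h⟩ : ℕ) * b) p else 0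

theorem addr_cons {p d : ℕ} (a : Fin p) (t : Idx p d) :
    addr (Fin.cons a t : Idx p (d + 1)) = p * addr t + a := by
  simp only [addr, Fin.sum_univ_succ, Fin.cons_zero, Fin.cons_succ, Finset.mul_sum]
  rw [add_comm]
  congr 1
  · refine Finset.sum_congr rfl fun i _ => ?_
    rw [Fin.val_succ, pow_succ]; ring
  · simp

theorem addr_init {p d : ℕ} (t : Idx p (d + 1)) :
    addr t = addr (Fin.init t : Idx p d) + (t (Fin.last d) : ℕ) * p ^ d := by
  simp only [addr, Fin.sum_univ_castSucc, Fin.init, Fin.val_castSucc, Fin.val_last]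

theorem addr_lt {p d : ℕ} (t : Idx p d) : addr t < p ^ d := by
  have := (finFunctionFinEquiv t).2
  rwa [finFunctionFinEquiv_apply] at this

theorem addr_injective {p d : ℕ} : Function.Injective (addr : Idx p d → ℕ) := by
  intro s t h
  apply finFunctionFinEquiv.injective
  apply Fin.ext
  rw [finFunctionFinEquiv_apply, finFunctionFinEquiv_apply]
  exact h

theorem exists_addr {p d q : ℕ} (hq : q < p ^ d) : ∃ t : Idx p d, addr t = q := by
  refine ⟨finFunctionFinEquiv.symm ⟨q, hq⟩, ?_⟩
  have := finFunctionFinEquiv_apply (finFunctionFinEquiv.symm (⟨q, hq⟩ : Fin (p ^ d)))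
  rw [Equiv.apply_symm_apply] at this
  exact this.symm

/-- Before round i the lowest place still holds the untransformed axis i, so its factor is a delta
that collapses the sum over a to a = s_i. The character this leaves is the factor of the top place
after the rotation. -/
theorem rot_step {p d i : ℕ} (hi : i < d + 1) (v : Idx p (d + 1) → ℂ) (u : ℕ → ℂ)
    (hu : ∀ t : Idx p (d + 1), u (addr t) = ∑ s, v s * ∏ j : Fin (d + 1), rotFactor s i j (t j))
    (t : Idx p (d + 1)) :
    ∑ a ∈ Finset.range p, u (p * addr (Fin.init t : Idx p d) + a) *
      ru (a * (t (Fin.last d) : ℕ)) p =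
    ∑ s, v s * ∏ j : Fin (d + 1), rotFactor s (i + 1) j (t j) := by
  rw [Finset.sum_range]
  have h1 : ∀ a : Fin p, u (p * addr (Fin.init t : Idx p d) + a) =
      ∑ s, v s * ((if (s ⟨i, hi⟩ : ℕ) = a then 1 else 0) *
        ∏ j : Fin d, rotFactor s (i + 1) j (t j.castSucc)) := by
    intro a
    rw [← addr_cons, hu]
    refine Finset.sum_congr rfl fun s _ => ?_
    rw [Fin.prod_univ_succ]
    congr 2
    · simp [rotFactor, hi]
    · refine Finset.prod_congr rfl fun j _ => ?_
      simp only [Fin.cons_succ, Fin.init, Fin.val_succ, rotFactor]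
      simp only [show i + (↑j + 1) = i + 1 + ↑j by ring]
  simp_rw [h1, Finset.sum_mul]
  rw [Finset.sum_comm]
  refine Finset.sum_congr rfl fun s _ => ?_
  rw [Fin.prod_univ_castSucc]
  have h2 : rotFactor s (i + 1) (Fin.last d : ℕ) (t (Fin.last d) : ℕ) =
      ru ((s ⟨i, hi⟩ : ℕ) * (t (Fin.last d) : ℕ)) p := by
    have e : i + 1 + d - (d + 1) = i := by omega
    rw [rotFactor, dif_neg (by simp), dif_pos (by simp; omega)]
    simp only [Fin.val_last, e]
  rw [h2, Finset.sum_eq_single (s ⟨i, hi⟩)]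
  · simp only [Fin.val_castSucc, if_true]; ring
  · intro b _ hb
    rw [if_neg]
    · simp
    · exact fun h => hb (Fin.ext h.symm)
  · simp

section DFT

variable {p d : ℕ} {x : Idx p d → ℂ} {ω : Tape p d} {m : Mem} {lm : ℕ}

/-- With no rounds done the product of the `rotFactor`s is the delta at s = t; after d rounds every
place contributes its character, and the product is `chi`. -/
theorem dftProg_spec (hR : DFTReady p d lm m) (hp : 0 < p) (hd : 0 < d) :
    Tri x ω dftProg m (d * (p ^ (d - 1) * (lm * (2 ^ lm * 930)))) fun m' =>
      ∀ f : Idx p d, m'.v vBuf (addr f) = dftU (fun t => m.v vBuf (addr t)) f := by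
  apply Tri.le
  · refine Tri.for (N := d) (T := p ^ (d - 1) * (lm * (2 ^ lm * 900))) (fun i m' => i ≤ d → ∀ t : Idx p d, m'.v vBuf (addr t) =
      ∑ s : Idx p d, m.v vBuf (addr s) * ∏ j : Fin d, rotFactor s i j (t j))
      hR.d_eq (by decide) (by decide) (by decide) ?_ ?_ ?_
    · intro _ t
      rw [Finset.sum_eq_single t]
      · simp [rotFactor]
      · intro s _ hs
        obtain ⟨j, hj⟩ := Function.ne_iff.1 hs
        rw [Finset.prod_eq_zero (Finset.mem_univ j), mul_zero]
        rw [rotFactor, dif_pos (by simp)]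
        exact if_neg fun h => hj (Fin.ext (by simpa using h))
      · simp
    · intro i hi m' hI hi' hF
      have hR' := hR.frame hF (by decide) (by decide)
      refine (dftAxis_spec hR' hp hd).imp ?_
      intro m'' h _ hid t
      rw [Mem.setN_v]
      obtain ⟨e, rfl⟩ : ∃ e, d = e + 1 := ⟨d - 1, by omega⟩
      simp only [Nat.add_sub_cancel] at h
      rw [addr_init t, h _ (addr_lt _) _ (t (Fin.last e)).2]
      exact rot_step hi (fun s => m.v vBuf (addr s)) (m'.v vBuf) (hI (by omega)) t
    · intro m' hI _ f
      rw [hI le_rfl f, dftU]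
      refine Finset.sum_congr rfl fun s _ => ?_
      rw [chi_eq_prod]
      congr 1
      refine Finset.prod_congr rfl fun j _ => ?_
      rw [rotFactor, dif_neg (by simp), dif_pos (by simp)]
      simp only [Nat.add_sub_cancel_left, Fin.eta]
      rw [mul_comm]
  · have h2 := hR.two_mul_le
    have hlm : 1 ≤ lm := by
      rcases Nat.eq_zero_or_pos lm with rfl | h
      · simp at h2; omega
      · exact h
    have h4 : 2 ^ lm ≤ lm * 2 ^ lm := Nat.le_mul_of_pos_left _ hlm
    obtain ⟨Z, hZ⟩ : ∃ Z, Z = p ^ (d - 1) * (lm * 2 ^ lm) := ⟨_, rfl⟩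
    have h5 : 2 ≤ Z := by
      rw [hZ]; calc 2 ≤ lm * 2 ^ lm := by omega
        _ ≤ _ := Nat.le_mul_of_pos_left _ (by positivity)
    rw [show p ^ (d - 1) * (lm * (2 ^ lm * 900)) = Z * 900 by rw [hZ]; ring,
      show p ^ (d - 1) * (lm * (2 ^ lm * 930)) = Z * 930 by rw [hZ]; ring]
    nlinarith

end DFT

end SparseFourier

namespace SparseFourier

open NExp Prog

/-! ### The estimation step -/

section Model

variable {p d : ℕ}

/-- The inverse Fourier transform. -/
noncomputable def invDft (e : Idx p d → ℂ) (t : Idx p d) : ℂ :=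
  (starRingEnd ℂ) (dftU (fun f => (starRingEnd ℂ) (e f)) t) / (Real.sqrt ((p : ℝ) ^ d) : ℂ)

/-- The estimate of the Fourier coefficient `f` of `w` from the `B` samples at positions
`τ s, …, τ (s + B - 1)`. -/
noncomputable def est (w : Idx p d → ℂ) (τ : ℕ → Idx p d) (s B : ℕ) (f : Idx p d) : ℂ :=
  (∑ i ∈ Finset.range B, w (τ (s + i)) * chi f (τ (s + i))) *
    (Real.sqrt ((p : ℝ) ^ d) : ℂ) / (B : ℂ)

open Classical in
/-- The last of the first `i` entries of `v` which is close to more than half of `v 0, …, v (R - 1)`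
(zero if there is none). -/
noncomputable def pick (R : ℕ) (θ : ℝ) (v : ℕ → ℂ) : ℕ → ℂ
  | 0 => 0
  | i + 1 => if R < 2 * ((Finset.range R).filter fun j => Complex.normSq (v i - v j) ≤ θ).card
      then v i else pick R θ v i

open Classical in
/-- One improvement of the approximation `e` of `dft x`, which is assumed to be at distance at
most `a`. -/
noncomputable def stepFn (x : Idx p d → ℂ) (τ : ℕ → Idx p d) (R B s : ℕ) (a : ℝ)
    (e : Idx p d → ℂ) (f : Idx p d) : ℂ :=
  let u := pick R (a / 12 * (a / 12)) (fun r => est (fun t => x t - invDft e t) τ (s + r * B) B f) R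
  if a / 4 * (a / 4) ≤ Complex.normSq u then e f + u else e f

/-- Repeated improvements with consecutive blocks of samples. -/
noncomputable def runSteps (x : Idx p d → ℂ) (τ : ℕ → Idx p d) (R B : ℕ) (a : ℝ)
    (e : Idx p d → ℂ) : ℕ → Idx p d → ℂ
  | 0 => e
  | h + 1 => stepFn x τ R B (h * (R * B)) (a / 2 ^ h) (runSteps x τ R B a e h)

end Model

notation "nR" => (30 : ℕ)
notation "nB" => (31 : ℕ)
notation "ePtr" => (32 : ℕ)
notation "eO" => (33 : ℕ)
notation "eR" => (34 : ℕ)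
notation "eI" => (35 : ℕ)
notation "eF" => (36 : ℕ)
notation "eJ" => (37 : ℕ)
notation "eCnt" => (38 : ℕ)
notation "eOi" => (39 : ℕ)
notation "eOj" => (40 : ℕ)
notation "aT" => (41 : ℕ)
notation "eH" => (42 : ℕ)
notation "eCount" => (43 : ℕ)
notation "vE" => (7 : ℕ)
notation "vInv" => (8 : ℕ)
notation "vEst" => (9 : ℕ)
notation "vX" => (10 : ℕ)
notation "vSc" => (11 : ℕ)
notation "vRt" => (12 : ℕ)
notation "vTh" => (13 : ℕ)
notation "vTg" => (14 : ℕ)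
notation "vU" => (15 : ℕ)
notation "vZ" => (16 : ℕ)

/-- Complex conjugation. -/
def conjE (z : VExp) : VExp := .sub (.re z) (.mul .imagUnit (.im z))

/-- The square of the absolute value. -/
def nsqE (z : VExp) : VExp := .add (.mul (.re z) (.re z)) (.mul (.im z) (.im z))

@[simp] theorem ev_conjE (m : Mem) (z : VExp) : (conjE z).ev m = (starRingEnd ℂ) (z.ev m) := by
  apply Complex.ext <;> simp [conjE]

@[simp] theorem ev_nsqE (m : Mem) (z : VExp) : (nsqE z).ev m = (Complex.normSq (z.ev m) : ℂ) := by
  simp [nsqE, Complex.normSq_apply]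

theorem cost_conjE (z : VExp) : (conjE z).cost = 2 * z.cost + 5 := by
  simp only [conjE, VExp.cost]; ring

theorem cost_nsqE (z : VExp) : (nsqE z).cost = 4 * z.cost + 7 := by
  simp only [nsqE, VExp.cost]; ring

def invProg : Prog :=
  .seq (.for eF nN (.setV vBuf (reg eF) (conjE (.get vE (reg eF)))))
  (.seq dftProg
  (.for eF nN (.setV vInv (reg eF) (.div (conjE (.get vBuf (reg eF))) (VExp.reg vRt)))))

def accProg : Prog :=
  .seq (.setV vBuf (.get aT (reg ePtr)) (.add (.get vBuf (.get aT (reg ePtr)))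
    (.sub (.get vX (reg ePtr)) (.get vInv (.get aT (reg ePtr))))))
  (asg ePtr (.add (reg ePtr) (.lit 1)))

/-- The residuals of a batch are accumulated, with multiplicity, at the sampled positions of a zero
vector. One transform of it then gives the estimates for all frequencies at once. -/
def batchProg : Prog :=
  .seq (.for eF nN (.setV vBuf (reg eF) (.ofNat (.lit 0))))
  (.seq (.for eI nB accProg)
  (.seq dftProg
  (.seq (.for eF nN (.setV vEst (.add (reg eO) (reg eF))
    (.div (.mul (.get vBuf (reg eF)) (VExp.reg vRt)) (.ofNat (reg nB)))))
  (asg eO (.add (reg eO) (reg nN))))))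

def countProg : Prog :=
  .seq (asgV vZ (.sub (.get vEst (reg eOi)) (.get vEst (reg eOj))))
  (.seq (.cond (.vle (nsqE (VExp.reg vZ)) (VExp.reg vTh)) (asg eCnt (.add (reg eCnt) (.lit 1))) .skip)
  (asg eOj (.add (reg eOj) (reg nN))))

def candProg : Prog :=
  .seq (asg eCnt (.lit 0))
  (.seq (asg eOj (reg eF))
  (.seq (.for eJ nR countProg)
  (.seq (.cond (.nle (.add (reg nR) (.lit 1)) (.add (reg eCnt) (reg eCnt)))
    (asgV vU (.get vEst (reg eOi))) .skip)
  (asg eOi (.add (reg eOi) (reg nN))))))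

def selectProg : Prog :=
  .seq (asgV vU (.ofNat (.lit 0)))
  (.seq (asg eOi (reg eF))
  (.seq (.for eI nR candProg)
  (.cond (.vle (VExp.reg vTg) (nsqE (VExp.reg vU)))
    (.setV vE (reg eF) (.add (.get vE (reg eF)) (VExp.reg vU))) .skip)))

def stepProg : Prog :=
  .seq (asgV vTh (.mul (.div (VExp.reg vSc) (.ofNat (.lit 12))) (.div (VExp.reg vSc) (.ofNat (.lit 12)))))
  (.seq (asgV vTg (.mul (.div (VExp.reg vSc) (.ofNat (.lit 4))) (.div (VExp.reg vSc) (.ofNat (.lit 4)))))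
  (.seq invProg
  (.seq (asg eO (.lit 0))
  (.seq (.for eR nR batchProg)
  (.seq (.for eF nN selectProg)
  (asgV vSc (.div (VExp.reg vSc) (.ofNat (.lit 2)))))))))

/-- `eCount` improvement steps. -/
def stepsProg : Prog := .seq (asg ePtr (.lit 0)) (.for eH eCount stepProg)

/-- The tables and samples that the estimation relies on. -/
structure EstReady {p d : ℕ} (x : Idx p d → ℂ) (τ : ℕ → Idx p d) (lm R B tot : ℕ) (m : Mem) : Prop
    extends DFTReady p d lm m where
  R_eq : m.n nR 0 = R
  B_eq : m.n nB 0 = B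
  rt_eq : m.v vRt 0 = (Real.sqrt ((p : ℝ) ^ d) : ℂ)
  t_eq : ∀ i < tot, m.n aT i = addr (τ i)
  x_eq : ∀ i < tot, m.v vX i = x (τ i)

/-! ### Correctness of the estimation programs. -/

section Spec

variable {p d : ℕ} {x : Idx p d → ℂ} {ω : Tape p d} {τ : ℕ → Idx p d} {m : Mem} {lm R B tot : ℕ}

theorem EstReady.of_frame {m' : Mem} (h : EstReady x τ lm R B tot m)
    (hn : ∀ a ∈ nR :: nB :: aT :: dftParams, m'.n a = m.n a)
    (hv : ∀ a ∈ [vW, vCh, vRt, vX], m'.v a = m.v a) :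
    EstReady x τ lm R B tot m' := by
  constructor
  · exact h.toDFTReady.of_frame (fun a ha => hn a (by simp [ha]))
      (fun a ha => hv a (by revert ha; simp; tauto))
  · rw [hn _ (by decide)]; exact h.R_eq
  · rw [hn _ (by decide)]; exact h.B_eq
  · rw [hv _ (by decide)]; exact h.rt_eq
  · rw [hn _ (by decide)]; exact h.t_eq
  · rw [hv _ (by decide)]; exact h.x_eq

theorem EstReady.frame {m' : Mem} {P : Prog} (h : EstReady x τ lm R B tot m)
    (hF : Frame P m m') (hn : ∀ a ∈ nR :: nB :: aT :: dftParams, a ∉ P.wN)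
    (hv : ∀ a ∈ [vW, vCh, vRt, vX], a ∉ P.wV) : EstReady x τ lm R B tot m' :=
  h.of_frame (fun a ha => hF.n a (hn a ha)) (fun a ha => hF.v a (hv a ha))

/-- The running time of the transform. -/
def dftTime (p d lm : ℕ) : ℕ := d * (p ^ (d - 1) * (lm * (2 ^ lm * 930)))

theorem invProg_spec (hR : EstReady x τ lm R B tot m) (hp : 0 < p) (hd : 0 < d) :
    Tri x ω invProg m (p ^ d * 100 + 40 + dftTime p d lm) fun m' =>
      ∀ t : Idx p d, m'.v vInv (addr t) = invDft (fun f => m.v vE (addr f)) t := by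
  apply Tri.le
  · apply Tri.bind
    · refine Tri.fill 0 (fun q => (starRingEnd ℂ) (m.v vE q)) hR.n_eq (by decide) ?_
      intro q hq m' hq' hn hv ho hc
      simp [hq', hv]
    intro m1 ⟨h1, _⟩ hF1
    have hR1 := hR.frame hF1 (by decide) (by decide)
    simp only [zero_add] at h1
    apply Tri.bind (dftProg_spec hR1.toDFTReady hp hd)
    intro m2 h2 hF2
    have hR2 := hR1.frame hF2 (by decide) (by decide)
    refine (Tri.fill 0 (fun q => (starRingEnd ℂ) (m2.v vBuf q) / (Real.sqrt ((p : ℝ) ^ d) : ℂ))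
      hR2.n_eq (by decide) ?_).imp ?_
    · intro q hq m' hq' hn hv ho hc
      simp [hq', hv, hR2.rt_eq]
    · rintro m3 ⟨h3, -⟩ -
      intro t
      have := h3 (addr t) (addr_lt t)
      rw [zero_add] at this
      rw [this, h2, invDft]
      congr 3
      funext f
      exact h1 (addr f) (addr_lt f)
  · simp [NExp.cost, VExp.cost, cost_conjE, dftTime]
    omega

theorem batchProg_spec (hR : EstReady x τ lm R B tot m) (hp : 0 < p) (hd : 0 < d) {s o : ℕ}
    (hs : s + B ≤ tot) (h1 : m.n ePtr 0 = s) (h2 : m.n eO 0 = o) (e : Idx p d → ℂ)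
    (hinv : ∀ t : Idx p d, m.v vInv (addr t) = invDft e t) :
    Tri x ω batchProg m (p ^ d * 60 + 80 + dftTime p d lm + B * 60) fun m' =>
      m'.n ePtr 0 = s + B ∧ m'.n eO 0 = o + p ^ d ∧
      (∀ f : Idx p d, m'.v vEst (o + addr f) = est (fun t => x t - invDft e t) τ s B f) ∧
      ∀ q < o, m'.v vEst q = m.v vEst q := by
  apply Tri.le
  · apply Tri.bind
    · refine Tri.fill 0 (fun _ => 0) hR.n_eq (by decide) ?_
      intro q hq m' hq' hn hv ho hc
      simp [hq']
    intro m1 ⟨hA, _⟩ hF1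
    have hR1 := hR.frame hF1 (by decide) (by decide)
    simp only [zero_add] at hA
    apply Tri.bind
    · refine Tri.for (T := 40) (N := B) (fun i m' => i ≤ B → m'.n ePtr 0 = s + i ∧
        ∀ t : Idx p d, m'.v vBuf (addr t) = ∑ i ∈ Finset.range i,
          if τ (s + i) = t then x (τ (s + i)) - invDft e (τ (s + i)) else 0)
        hR1.B_eq (by decide) (by decide) (by decide) ?_ ?_ (fun m' h _ => h le_rfl)
      · intro _
        refine ⟨by simpa [hF1.n ePtr (by decide)] using h1, fun t => ?_⟩
        simpa using hA (addr t) (addr_lt t)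
      · intro i hi m' hI _ hF
        have hR' := hR1.frame hF (by decide) (by decide)
        obtain ⟨g1, g2⟩ := hI hi.le
        have g3 : m'.v vInv = m.v vInv := by rw [hF.v _ (by decide), hF1.v _ (by decide)]
        apply Tri.le
        · apply Tri.seq
          apply Tri.setV
          apply Tri.setN
          intro _
          refine ⟨by simp [g1]; ring, fun t => ?_⟩
          simp only [Mem.setN_v, ev_get, ev_lit, g1, hR'.t_eq (s + i) (by omega), VExp.ev_add,
            VExp.ev_sub, VExp.ev_get, hR'.x_eq (s + i) (by omega), g3, hinv, Mem.setV_v]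
          rw [Finset.sum_range_succ, ← g2]
          by_cases ht : τ (s + i) = t
          · rw [if_pos (by rw [ht]), if_pos ht, ht]
          · rw [if_neg fun h => ht (addr_injective h).symm, if_neg ht, add_zero]
        · simp [NExp.cost, VExp.cost]
    intro m2 ⟨hB1, hB2⟩ hF2
    have hR2 := hR1.frame hF2 (by decide) (by decide)
    apply Tri.bind (dftProg_spec hR2.toDFTReady hp hd)
    intro m3 hC hF3
    have hR3 := hR2.frame hF3 (by decide) (by decide)
    have ho3 : m3.n eO 0 = o := by
      rw [hF3.n _ (by decide), hF2.n _ (by decide), hF1.n _ (by decide), h2]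
    apply Tri.bind
    · refine Tri.fill o (fun q => m3.v vBuf q * (Real.sqrt ((p : ℝ) ^ d) : ℂ) / (B : ℂ))
        hR3.n_eq (by decide) ?_
      intro q hq m' hq' hn hv ho hc
      simp [hq', hn, hv, ho3, hR3.rt_eq, hR3.B_eq]
    intro m4 ⟨hD1, hD2⟩ hF4
    have hR4 := hR3.frame hF4 (by decide) (by decide)
    refine Tri.setN ⟨?_, ?_, fun f => ?_, fun q hq => ?_⟩
    · simp [hF4.n ePtr (by decide), hF3.n ePtr (by decide), hB1]
    · simp [hF4.n eO (by decide), ho3, hR4.n_eq]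
    · rw [Mem.setN_v, hD1 _ (addr_lt f), hC, est, dftU]
      congr 2
      -- The transform of the accumulated vector equals the sum over the samples after interchanging
      -- the two sums.
      simp_rw [hB2, Finset.sum_mul]
      rw [Finset.sum_comm]
      refine Finset.sum_congr rfl fun i _ => ?_
      simp
    · rw [Mem.setN_v, hD2 q (Or.inl hq), hF3.v _ (by decide), hF2.v _ (by decide),
        hF1.v _ (by decide)]
  · simp [NExp.cost, VExp.cost, dftTime]
    omega

theorem candProg_spec (hR : EstReady x τ lm R B tot m) {v : ℕ → ℂ} {θ : ℝ} {q i : ℕ} (hi : i < R)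
    (hv : ∀ r < R, m.v vEst (q + r * p ^ d) = v r) (h1 : m.n eF 0 = q)
    (h2 : m.n eOi 0 = q + i * p ^ d) (h3 : m.v vTh 0 = (θ : ℂ)) (h4 : m.v vU 0 = pick R θ v i) :
    Tri x ω candProg m (R * 80 + 60) fun m' =>
      m'.n eOi 0 = q + (i + 1) * p ^ d ∧ m'.v vU 0 = pick R θ v (i + 1) := by
  classical
  apply Tri.le
  · apply Tri.seq
    apply Tri.setN
    apply Tri.seq
    apply Tri.setN
    simp only [ev_lit, ev_get, Mem.setN_n_ne _ _ _ (show eF ≠ eCnt by decide), h1]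
    apply Tri.bind
    · refine Tri.for (T := 65) (N := R) (fun j m' => m'.n eOj 0 = q + j * p ^ d ∧
        m'.n eCnt 0 = ((Finset.range j).filter fun j => Complex.normSq (v i - v j) ≤ θ).card)
        (by simpa using hR.R_eq) (by decide) (by decide) (by decide) (by simp) ?_
        (fun m' h _ => h)
      intro j hj m' hI _ hF
      have g1 : m'.v vEst = m.v vEst := hF.v _ (by decide)
      have g2 : m'.n eOi 0 = q + i * p ^ d := by rw [hF.n _ (by decide)]; simpa using h2
      have g3 : m'.n nN 0 = p ^ d := by rw [hF.n _ (by decide)]; simpa using hR.n_eq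
      have g4 : m'.v vTh 0 = (θ : ℂ) := by rw [hF.v _ (by decide)]; simpa using h3
      apply Tri.le
      · apply Tri.seq
        apply Tri.setV
        apply Tri.seq
        simp only [ev_lit, ev_get, VExp.ev_sub, VExp.ev_get, g1, g2, hI.1, hv i hi, hv j hj]
        rw [Finset.range_add_one, Finset.filter_insert]
        refine Tri.cond (T := 6) (fun hb => ?_) (fun hb => ?_)
        · refine (Tri.setN (Tri.setN ?_)).le (by simp [NExp.cost])
          simp [g4] at hb
          simp [hI.1, hI.2, g3, hb]
          ring
        · refine (Tri.skip (Tri.setN ?_)).le (by simp)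
          simp [g4] at hb
          simp [hI.1, hI.2, g3, not_le.2 hb]
          ring
      · simp [NExp.cost, VExp.cost, BExp.cost, cost_nsqE]
    intro m1 ⟨hA1, hA2⟩ hF1
    have g1 : m1.n eOi 0 = q + i * p ^ d := by rw [hF1.n _ (by decide)]; simpa using h2
    have g2 : m1.n nN 0 = p ^ d := by rw [hF1.n _ (by decide)]; simpa using hR.n_eq
    have g3 : m1.n nR 0 = R := by rw [hF1.n _ (by decide)]; simpa using hR.R_eq
    have g4 : m1.v vEst = m.v vEst := hF1.v _ (by decide)
    have g5 : m1.v vU 0 = pick R θ v i := by rw [hF1.v _ (by decide)]; simpa using h4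
    apply Tri.seq
    refine Tri.cond (T := 6) (fun hb => ?_) (fun hb => ?_)
    · refine (Tri.setV (Tri.setN ?_)).le (by simp [NExp.cost, VExp.cost])
      simp only [BExp.ev_nle, ev_add, ev_get, ev_lit, g3, hA2] at hb
      refine ⟨by simp [g1, g2]; ring, ?_⟩
      rw [pick, if_pos (by omega)]
      simp [g1, g4, hv i hi]
    · refine (Tri.skip (Tri.setN ?_)).le (by simp)
      simp only [BExp.ev_nle, ev_add, ev_get, ev_lit, g3, hA2] at hb
      refine ⟨by simp [g1, g2]; ring, ?_⟩
      rw [pick, if_neg (by omega)]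
      simp [g5]
  · simp [NExp.cost, BExp.cost]
    omega

open Classical in
theorem selectProg_spec (hR : EstReady x τ lm R B tot m) {v : ℕ → ℂ} {θ θ' : ℝ} {q : ℕ}
    (hv : ∀ r < R, m.v vEst (q + r * p ^ d) = v r) (h1 : m.n eF 0 = q)
    (h3 : m.v vTh 0 = (θ : ℂ)) (h4 : m.v vTg 0 = (θ' : ℂ)) :
    Tri x ω selectProg m (R * (R * 80 + 80) + 80) fun m' =>
      m'.v vE q = (if θ' ≤ Complex.normSq (pick R θ v R) then m.v vE q + pick R θ v R
        else m.v vE q) ∧ ∀ o, o ≠ q → m'.v vE o = m.v vE o := by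
  apply Tri.le
  · apply Tri.seq
    apply Tri.setV
    apply Tri.seq
    apply Tri.setN
    simp only [ev_lit, ev_get, Mem.setV_n, h1, VExp.ev_ofNat]
    apply Tri.bind
    · refine Tri.for (T := R * 80 + 60) (N := R) (fun i m' => m'.n eOi 0 = q + i * p ^ d ∧
        m'.v vU 0 = pick R θ v i)
        (by simpa using hR.R_eq) (by decide) (by decide) (by decide) (by simp [pick]) ?_
        (fun m' h _ => h)
      intro i hi m' hI _ hF
      have hR' : EstReady x τ lm R B tot m' := hR.of_frame
        (fun a ha => (hF.n a (by fin_cases ha <;> decide)).trans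
          (by fin_cases ha <;> simp))
        (fun a ha => (hF.v a (by fin_cases ha <;> decide)).trans (by fin_cases ha <;> simp))
      refine (candProg_spec hR' hi (fun r hr => ?_) ?_ hI.1 ?_ hI.2).imp ?_
      · rw [hF.v _ (by decide)]; simpa using hv r hr
      · rw [hF.n _ (by decide)]; simpa using h1
      · rw [hF.v _ (by decide)]; simpa using h3
      · rintro m'' ⟨k1, k2⟩ -
        simpa using ⟨k1, k2⟩
    intro m1 ⟨hA1, hA2⟩ hF1
    have g1 : m1.v vE = m.v vE := by rw [hF1.v _ (by decide)]; simp
    have g2 : m1.n eF 0 = q := by rw [hF1.n _ (by decide)]; simpa using h1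
    have g3 : m1.v vTg 0 = (θ' : ℂ) := by rw [hF1.v _ (by decide)]; simpa using h4
    refine Tri.cond (T := 10) (fun hb => ?_) (fun hb => ?_)
    · refine (Tri.setV ?_).le (by simp [NExp.cost, VExp.cost])
      simp [g3, hA2] at hb
      simp only [ev_lit, ev_get, VExp.ev_add, VExp.ev_get, g1, g2, hA2]
      rw [if_pos hb]
      refine ⟨by simp, fun o ho => ?_⟩
      rw [Mem.setV_v_idx _ _ _ ho, g1]
    · refine (Tri.skip ?_).le (by simp)
      simp [g3, hA2] at hb
      rw [if_neg (by linarith), g1]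
      exact ⟨rfl, fun _ _ => rfl⟩
  · simp [NExp.cost, VExp.cost, BExp.cost, cost_nsqE]
    nlinarith

/-- The running time of an improvement step. -/
def stepTime (p d lm R B : ℕ) : ℕ :=
  (R + 1) * (p ^ d * 100 + 100 + dftTime p d lm + B * 60) + p ^ d * (R * (R * 80 + 80) + 100) + 100

theorem stepProg_spec (hR : EstReady x τ lm R B tot m) (hp : 0 < p) (hd : 0 < d) {s : ℕ} {a : ℝ}
    (hs : s + R * B ≤ tot) (h1 : m.n ePtr 0 = s) (h2 : m.v vSc 0 = (a : ℂ)) :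
    Tri x ω stepProg m (stepTime p d lm R B) fun m' =>
      m'.n ePtr 0 = s + R * B ∧ m'.v vSc 0 = ((a / 2 : ℝ) : ℂ) ∧
      ∀ f : Idx p d, m'.v vE (addr f) = stepFn x τ R B s a (fun f => m.v vE (addr f)) f := by
  apply Tri.le
  · apply Tri.seq
    apply Tri.setV
    apply Tri.seq
    apply Tri.setV
    have hR0 : ∀ z z', EstReady x τ lm R B tot ((m.setV vTh 0 z).setV vTg 0 z') := fun z z' =>
      hR.of_frame (fun a ha => by fin_cases ha <;> rfl) (fun a ha => by fin_cases ha <;> simp)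
    apply Tri.bind (invProg_spec (hR0 _ _) hp hd)
    intro m1 hA hF1
    simp only [Mem.setV_v_ne _ _ _ (show vE ≠ vTg by decide),
      Mem.setV_v_ne _ _ _ (show vE ≠ vTh by decide)] at hA
    have hR1 := (hR0 _ _).frame hF1 (by decide) (by decide)
    apply Tri.seq
    apply Tri.setN
    apply Tri.bind
    · refine Tri.for (T := p ^ d * 60 + 80 + dftTime p d lm + B * 60) (N := R) (fun r m' =>
        m'.n ePtr 0 = s + r * B ∧ m'.n eO 0 = r * p ^ d ∧ ∀ r' < r, ∀ f : Idx p d,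
          m'.v vEst (r' * p ^ d + addr f) =
            est (fun t => x t - invDft (fun f => m.v vE (addr f)) t) τ (s + r' * B) B f)
        (by simpa using hR1.R_eq) (by decide) (by decide) (by decide) ?_ ?_ (fun m' h _ => h)
      · simpa [hF1.n ePtr (by decide)] using h1
      intro r hr m' hI _ hF
      have hR' : EstReady x τ lm R B tot m' := hR1.of_frame
        (fun a ha => (hF.n a (by fin_cases ha <;> decide)).trans
          (by fin_cases ha <;> simp))
        (fun a ha => (hF.v a (by fin_cases ha <;> decide)).trans (by fin_cases ha <;> simp))
      refine (batchProg_spec hR' hp hd (s := s + r * B) ?_ hI.1 hI.2.1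
        (fun f => m.v vE (addr f)) ?_).imp ?_
      · nlinarith
      · rw [hF.v _ (by decide)]; simpa using hA
      · rintro m'' ⟨k1, k2, k3, k4⟩ -
        refine ⟨by simp [k1]; ring, by simp [k2]; ring, fun r' hr' f => ?_⟩
        rw [Mem.setN_v]
        rcases Nat.lt_succ_iff_lt_or_eq.1 hr' with h | rfl
        · rw [k4 _ ?_, hI.2.2 r' h f]
          have := addr_lt f
          nlinarith
        · exact k3 f
    intro m2 ⟨hB1, _, hB2⟩ hF2
    have hR2 : EstReady x τ lm R B tot m2 := hR1.of_frame
        (fun a ha => (hF2.n a (by fin_cases ha <;> decide)).trans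
          (by fin_cases ha <;> simp))
        (fun a ha => (hF2.v a (by fin_cases ha <;> decide)).trans (by fin_cases ha <;> simp))
    have hE2 : m2.v vE = m.v vE := by
      rw [hF2.v _ (by decide), Mem.setN_v, hF1.v _ (by decide)]; simp
    have hTh2 : m2.v vTh 0 = ((a / 12 * (a / 12) : ℝ) : ℂ) := by
      rw [hF2.v _ (by decide), Mem.setN_v, hF1.v _ (by decide)]; simp [h2]
    have hTg2 : m2.v vTg 0 = ((a / 4 * (a / 4) : ℝ) : ℂ) := by
      rw [hF2.v _ (by decide), Mem.setN_v, hF1.v _ (by decide)]; simp [h2]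
    have hSc2 : m2.v vSc 0 = (a : ℂ) := by
      rw [hF2.v _ (by decide), Mem.setN_v, hF1.v _ (by decide)]; simp [h2]
    apply Tri.bind
    -- Coordinates are updated in place one by one. All estimates were computed before this loop
    -- from the old vector, so the updates do not interfere.
    · refine Tri.for (T := R * (R * 80 + 80) + 80) (N := p ^ d) (fun q m' =>
        ∀ f : Idx p d, m'.v vE (addr f) = if addr f < q then
          stepFn x τ R B s a (fun f => m.v vE (addr f)) f else m.v vE (addr f))
        hR2.n_eq (by decide) (by decide) (by decide) (by simp [hE2]) ?_ (fun m' h _ => h)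
      intro q hq m' hI hq' hF
      have hR' := hR2.frame hF (by decide) (by decide)
      obtain ⟨f, rfl⟩ := exists_addr hq
      refine (selectProg_spec hR' (v := fun r => est (fun t => x t -
        invDft (fun f => m.v vE (addr f)) t) τ (s + r * B) B f) (θ := a / 12 * (a / 12))
        (θ' := a / 4 * (a / 4)) (fun r hr => ?_) hq' ?_ ?_).imp ?_
      · rw [hF.v _ (by decide), add_comm]; exact hB2 r hr f
      · rw [hF.v _ (by decide)]; exact hTh2
      · rw [hF.v _ (by decide)]; exact hTg2
      · rintro m'' ⟨k1, k2⟩ - g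
        rw [Mem.setN_v]
        rcases eq_or_ne g f with rfl | hg
        · rw [k1, hI g, if_neg (lt_irrefl _), if_pos (Nat.lt_succ_self _), stepFn]
        · have hne : addr g ≠ addr f := fun h => hg (addr_injective h)
          rw [k2 _ hne, hI g]
          congr 1
          simp only [eq_iff_iff]
          omega
    intro m3 hC hF3
    refine Tri.setV ⟨?_, ?_, ?_⟩
    · rw [Mem.setV_n, hF3.n _ (by decide), hB1]
    · simp [hF3.v vSc (by decide), hSc2]
    · intro f
      rw [Mem.setV_v_ne _ _ _ (by decide), hC f, if_pos (addr_lt f)]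
  · simp [NExp.cost, VExp.cost, stepTime]
    generalize dftTime p d lm = D
    ring_nf
    omega

theorem stepsProg_spec (hR : EstReady x τ lm R B tot m) (hp : 0 < p) (hd : 0 < d) {a : ℝ} {H : ℕ}
    (hH : m.n eCount 0 = H) (hs : H * (R * B) ≤ tot) (h2 : m.v vSc 0 = (a : ℂ)) :
    Tri x ω stepsProg m (H * (stepTime p d lm R B + 13) + 13) fun m' =>
      m'.v vSc 0 = ((a / 2 ^ H : ℝ) : ℂ) ∧
      ∀ f : Idx p d, m'.v vE (addr f) = runSteps x τ R B a (fun f => m.v vE (addr f)) H f := by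
  apply Tri.le
  · apply Tri.seq
    apply Tri.setN
    refine Tri.for (T := stepTime p d lm R B) (N := H) (fun h m' => m'.n ePtr 0 = h * (R * B) ∧
      m'.v vSc 0 = ((a / 2 ^ h : ℝ) : ℂ) ∧
      ∀ f : Idx p d, m'.v vE (addr f) = runSteps x τ R B a (fun f => m.v vE (addr f)) h f)
      (by simpa using hH) (by decide) (by decide) (by decide) (by simp [h2, runSteps]) ?_
      (fun m' h _ => h.2)
    intro h hh m' hI _ hF
    have hR' : EstReady x τ lm R B tot m' := hR.of_frame
        (fun a ha => (hF.n a (by fin_cases ha <;> decide)).trans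
          (by fin_cases ha <;> simp))
        (fun a ha => (hF.v a (by fin_cases ha <;> decide)).trans (by fin_cases ha <;> simp))
    refine (stepProg_spec hR' hp hd (s := h * (R * B)) ?_ hI.1 hI.2.1).imp ?_
    · nlinarith
    · rintro m'' ⟨k1, k2, k3⟩ -
      refine ⟨by simp [k1]; ring, by simp [k2, pow_succ]; ring, fun f => ?_⟩
      rw [Mem.setN_v, k3, runSteps]
      congr 1
      funext g
      exact hI.2.2 g
  · simp [NExp.cost]
    omega

end Spec

end SparseFourier

namespace SparseFourier

open NExp Prog

/-! ### Rounding to a shifted grid -/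

/-- Rounding towards zero to the grid of mesh `g` shifted away from zero by `s`; everything below
`s + g` is rounded to zero. -/
noncomputable def rnd (g s v : ℝ) : ℝ :=
  if s + g ≤ |v| then
    if 0 ≤ v then s + g * ⌊(|v| - s) / g⌋₊ else -(s + g * ⌊(|v| - s) / g⌋₊)
  else 0

/-- The index of the cell of the grid of mesh `η` which contains `|v|` modulo `g`. -/
noncomputable def cell (g η v : ℝ) : ℕ := ⌊(|v| - g * ⌊|v| / g⌋₊) / η⌋₊

/-- The shift `j η` has one of the numbers `w q` close to a grid point. -/
def Marked (g η : ℝ) (N : ℕ) (w : ℕ → ℝ) (j : ℕ) : Prop :=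
  ∃ q < N, g / 2 ≤ |w q| ∧ (j = cell g η (w q) ∨ j = cell g η (w q) + 1)

/-- `j` is an index in `1, …, J - 1` that is not marked, if there is one. -/
def Selected (g η : ℝ) (N : ℕ) (w : ℕ → ℝ) (J j : ℕ) : Prop :=
  (∃ i, 1 ≤ i ∧ i < J ∧ ¬ Marked g η N w i) → 1 ≤ j ∧ j < J ∧ ¬ Marked g η N w j

notation "rI" => (50 : ℕ)
notation "rCnt" => (51 : ℕ)
notation "rRho" => (52 : ℕ)
notation "rQ" => (53 : ℕ)
notation "rNN" => (54 : ℕ)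
notation "aBad" => (55 : ℕ)
notation "rJsel" => (56 : ℕ)
notation "rJ" => (57 : ℕ)
notation "nJ" => (58 : ℕ)
notation "nLJ" => (59 : ℕ)
notation "rK" => (60 : ℕ)
notation "vPar" => (20 : ℕ)
notation "vrW" => (21 : ℕ)
notation "vrS" => (22 : ℕ)
notation "vG" => (23 : ℕ)
notation "vEta" => (24 : ℕ)
notation "vTop" => (25 : ℕ)
notation "vSh" => (26 : ℕ)

/-- Long division of register `vrW` by the `rCnt`-fold half of `vrS`. -/
def divProg : Prog :=
  .for rI rCnt
    (.seq (asgV vrS (.div (VExp.reg vrS) (.ofNat (.lit 2))))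
    (.seq (asg rRho (.add (reg rRho) (reg rRho)))
    (.cond (.vle (VExp.reg vrS) (VExp.reg vrW))
      (.seq (asgV vrW (.sub (VExp.reg vrW) (VExp.reg vrS))) (asg rRho (.add (reg rRho) (.lit 1))))
      .skip)))

def absE (z : VExp) : VExp := .sqrt (.mul z z)

theorem ev_absE {m : Mem} {z : VExp} {r : ℝ} (h : z.ev m = (r : ℂ)) :
    (absE z).ev m = ((|r| : ℝ) : ℂ) := by
  simp [absE, h, Real.sqrt_mul_self_eq_abs]

/-- Binary long division takes the place of the floor function. The first division starts from the
top scale and leaves |v| mod g in `vrW` and g in `vrS`; the second goes on from there to g/2^b, and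
its quotient is the index of the cell. -/
def markOne : Prog :=
  .seq (asgV vrW (absE (.get vPar (reg rQ))))
  (.cond (.vle (.div (VExp.reg vG) (.ofNat (.lit 2))) (VExp.reg vrW))
    (.seq (asgV vrS (VExp.reg vTop))
    (.seq (asg rRho (.lit 0))
    (.seq (asg rCnt (reg rK))
    (.seq divProg
    (.seq (asg rRho (.lit 0))
    (.seq (asg rCnt (reg nLJ))
    (.seq divProg
    (.seq (.setN aBad (reg rRho) (.lit 1))
    (.setN aBad (.add (reg rRho) (.lit 1)) (.lit 1))))))))))
    .skip)

def findProg : Prog :=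
  .seq (asg rJsel (.lit 0))
  (.for rJ nJ (.cond (.and (.nle (.lit 1) (reg rJ)) (.nle (.get aBad (reg rJ)) (.lit 0)))
    (asg rJsel (reg rJ)) .skip))

/-- The long division leaves the remainder of |v| - s modulo g; moving v towards zero by that
remainder puts it on the shifted grid. -/
def roundOne : Prog :=
  .seq (asgV vrW (absE (.get vPar (reg rQ))))
  (.cond (.vle (.add (VExp.reg vSh) (VExp.reg vG)) (VExp.reg vrW))
    (.seq (asgV vrW (.sub (VExp.reg vrW) (VExp.reg vSh)))
    (.seq (asgV vrS (VExp.reg vTop))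
    (.seq (asg rCnt (reg rK))
    (.seq divProg
    (.cond (.vle (.ofNat (.lit 0)) (.get vPar (reg rQ)))
      (.setV vPar (reg rQ) (.sub (.get vPar (reg rQ)) (VExp.reg vrW)))
      (.setV vPar (reg rQ) (.add (.get vPar (reg rQ)) (VExp.reg vrW))))))))
    (.setV vPar (reg rQ) (.ofNat (.lit 0))))

def roundProg : Prog :=
  .seq (.for eF nN (.setV vPar (reg eF) (.re (.get vE (reg eF)))))
  (.seq (.for eF nN (.setV vPar (.add (reg nN) (reg eF)) (.im (.get vE (reg eF)))))
  (.seq (.for rJ nJ (.setN aBad (reg rJ) (.lit 0)))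
  (.seq (.for rQ rNN markOne)
  (.seq findProg
  (.seq (asgV vSh (.mul (VExp.reg vEta) (.ofNat (reg rJsel))))
  (.seq (.for rQ rNN roundOne)
  (.for eF nN (.setV vE (reg eF) (.add (.get vPar (reg eF))
    (.mul .imagUnit (.get vPar (.add (reg nN) (reg eF)))))))))))))

/-- The parameters of the rounding. -/
structure RoundReady (n K b : ℕ) (g : ℝ) (m : Mem) : Prop where
  n_eq : m.n nN 0 = n
  nn_eq : m.n rNN 0 = 2 * n
  K_eq : m.n rK 0 = K
  b_eq : m.n nLJ 0 = b
  J_eq : m.n nJ 0 = 2 ^ b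
  g_eq : m.v vG 0 = (g : ℂ)
  eta_eq : m.v vEta 0 = ((g / 2 ^ b : ℝ) : ℂ)
  top_eq : m.v vTop 0 = ((g * 2 ^ K : ℝ) : ℂ)

theorem RoundReady.of_frame {n K b : ℕ} {g : ℝ} {m m' : Mem} (h : RoundReady n K b g m)
    (hn : ∀ a ∈ [nN, rNN, rK, nLJ, nJ], m'.n a = m.n a)
    (hv : ∀ a ∈ [vG, vEta, vTop], m'.v a = m.v a) : RoundReady n K b g m' := by
  constructor
  · rw [hn _ (by decide)]; exact h.n_eq
  · rw [hn _ (by decide)]; exact h.nn_eq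
  · rw [hn _ (by decide)]; exact h.K_eq
  · rw [hn _ (by decide)]; exact h.b_eq
  · rw [hn _ (by decide)]; exact h.J_eq
  · rw [hv _ (by decide)]; exact h.g_eq
  · rw [hv _ (by decide)]; exact h.eta_eq
  · rw [hv _ (by decide)]; exact h.top_eq

theorem RoundReady.frame {n K b : ℕ} {g : ℝ} {m m' : Mem} {P : Prog} (h : RoundReady n K b g m)
    (hF : Frame P m m') (hn : ∀ a ∈ [nN, rNN, rK, nLJ, nJ], a ∉ P.wN)
    (hv : ∀ a ∈ [vG, vEta, vTop], a ∉ P.wV) : RoundReady n K b g m' :=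
  h.of_frame (fun a ha => hF.n a (hn a ha)) (fun a ha => hF.v a (hv a ha))

/-! ### Correctness of the rounding programs. -/

section Spec

variable {p d : ℕ} {x : Idx p d → ℂ} {ω : Tape p d} {m : Mem} {n K b : ℕ} {g : ℝ}

/-- The invariant is that of binary division: after i halvings the remainder lies in [0, S/2^i) and
differs from w by a multiple of S/2^i. The range assumption on w sits inside the postcondition,
because running time and realness of the registers are also needed on runs where the estimates have
gone wrong. -/
theorem divProg_spec {S w : ℝ} (hK : m.n rCnt 0 = K) (hS : m.v vrS 0 = (S : ℂ))
    (hw : m.v vrW 0 = (w : ℂ)) :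
    Tri x ω divProg m (K * 50 + 10) fun m' => m'.v vrS 0 = ((S / 2 ^ K : ℝ) : ℂ) ∧
      ∃ r : ℝ, m'.v vrW 0 = (r : ℂ) ∧ (0 ≤ w → w < S → 0 ≤ r ∧ r < S / 2 ^ K ∧
        ∃ q : ℕ, r = w - S / 2 ^ K * q ∧ (m.n rRho 0 = 0 → m'.n rRho 0 = q)) := by
  apply Tri.le
  · refine Tri.for (T := 37) (N := K) (fun i m' => m'.v vrS 0 = ((S / 2 ^ i : ℝ) : ℂ) ∧
      ∃ r : ℝ, m'.v vrW 0 = (r : ℂ) ∧ (0 ≤ w → w < S → 0 ≤ r ∧ r < S / 2 ^ i ∧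
        ∃ q : ℕ, r = w - S / 2 ^ i * q ∧ (m.n rRho 0 = 0 → m'.n rRho 0 = q))) hK
        (by decide) (by decide) (by decide) ?_ ?_ (fun m' h _ => h)
    · refine ⟨by simp [hS], w, by simp [hw], fun h0 h1 => ⟨h0, by simpa using h1, 0, by simp, ?_⟩⟩
      simp
    · rintro i hi m' ⟨hs, r, hr, hI⟩ _ hF
      have hs2 : ((S / 2 ^ i : ℝ) : ℂ) / ((2 : ℕ) : ℂ) = ((S / 2 ^ (i + 1) : ℝ) : ℂ) := by
        push_cast; rw [pow_succ]; field_simp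
      have hS2 : S / 2 ^ i = 2 * (S / 2 ^ (i + 1)) := by rw [pow_succ]; field_simp
      apply Tri.le
      · apply Tri.seq
        apply Tri.setV
        apply Tri.seq
        apply Tri.setN
        simp only [ev_lit, VExp.ev_div, VExp.ev_get, hs, VExp.ev_ofNat, hs2, ev_add, ev_get,
          Mem.setV_n]
        refine Tri.cond (T := 14) (fun hb => ?_) (fun hb => ?_)
        · refine (Tri.seq (Tri.setV (Tri.setN ?_))).le (by simp [NExp.cost, VExp.cost])
          simp [hr, -Complex.ofReal_div, -Complex.ofReal_pow] at hb
          refine ⟨by simp, r - S / 2 ^ (i + 1), by simp [hr], fun h0 h1 => ?_⟩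
          obtain ⟨g1, g2, q, g3, g4⟩ := hI h0 h1
          refine ⟨by linarith, by linarith, 2 * q + 1, ?_, fun h => ?_⟩
          · rw [g3, hS2]; push_cast; ring
          · simp [g4 h]; ring
        · refine (Tri.skip ?_).le (by simp)
          simp [hr, -Complex.ofReal_div, -Complex.ofReal_pow] at hb
          refine ⟨by simp, r, by simp [hr], fun h0 h1 => ?_⟩
          obtain ⟨g1, g2, q, g3, g4⟩ := hI h0 h1
          refine ⟨by linarith, by linarith, 2 * q, ?_, fun h => ?_⟩
          · rw [g3, hS2]; push_cast; ring
          · simp [g4 h]; ring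
      · simp [NExp.cost, VExp.cost, BExp.cost]
  · omega

theorem eq_floor_div {g w r : ℝ} {q : ℕ} (hg : 0 < g) (hr : 0 ≤ r) (hr' : r < g)
    (h : r = w - g * q) : q = ⌊w / g⌋₊ := by
  symm
  have hw : 0 ≤ w := by
    have : 0 ≤ g * q := by positivity
    linarith
  rw [Nat.floor_eq_iff (by positivity), le_div_iff₀ hg, div_lt_iff₀ hg]
  constructor <;> nlinarith

theorem markOne_spec (hR : RoundReady n K b g m) (hg : 0 < g) {v : ℝ} {q : ℕ}
    (hq : m.n rQ 0 = q) (hv : m.v vPar q = (v : ℂ)) :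
    Tri x ω markOne m (K * 50 + b * 50 + 90) fun m' => |v| < g * 2 ^ K →
      ∀ j, m'.n aBad j = if g / 2 ≤ |v| ∧ (j = cell g (g / 2 ^ b) v ∨ j = cell g (g / 2 ^ b) v + 1)
        then 1 else m.n aBad j := by
  have hev : (absE (.get vPar (reg rQ))).ev m = ((|v| : ℝ) : ℂ) := ev_absE (by simp [hq, hv])
  apply Tri.le
  · apply Tri.seq
    apply Tri.setV
    rw [hev]
    refine Tri.cond (T := K * 50 + b * 50 + 60) (fun hb => ?_) (fun hb => ?_)
    · simp [hR.g_eq] at hb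
      apply Tri.le
      · apply Tri.seq
        apply Tri.setV
        apply Tri.seq
        apply Tri.setN
        apply Tri.seq
        apply Tri.setN
        apply Tri.bind (divProg_spec (K := K) (S := g * 2 ^ K) (w := |v|) ?_ ?_ ?_)
        · rintro m1 ⟨hs1, r1, hr1, h1⟩ hF1
          have hb1 : m1.n nLJ 0 = b := by
            rw [hF1.n _ (by decide)]; simpa using hR.b_eq
          have ha1 : m1.n aBad = m.n aBad := by
            rw [hF1.n _ (by decide)]; simp
          apply Tri.seq
          apply Tri.setN
          apply Tri.seq
          apply Tri.setN
          apply Tri.bind (divProg_spec (K := b) (S := g * 2 ^ K / 2 ^ K) (w := r1) ?_ ?_ ?_)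
          · rintro m2 ⟨-, r2, hr2, h2⟩ hF2
            have ha2 : m2.n aBad = m.n aBad := by
              rw [hF2.n _ (by decide), ← ha1]; simp
            apply Tri.seq
            apply Tri.setN
            apply Tri.setN
            intro hvK j
            have hgg : g * 2 ^ K / 2 ^ K = g := by field_simp
            rw [hgg] at h1 h2
            obtain ⟨i1, i2, q1, i3, -⟩ := h1 (abs_nonneg _) hvK
            obtain ⟨k1, k2, q2, k3, k4⟩ := h2 i1 i2
            have e1 := eq_floor_div hg i1 i2 i3
            have e2 := eq_floor_div (by positivity) k1 k2 k3
            rw [i3, e1] at e2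
            have e3 : m2.n rRho 0 = cell g (g / 2 ^ b) v := by
              rw [k4 (by simp), e2, cell]
            simp only [ev_get, ev_lit, ev_add, e3, Mem.setN_n_ne _ _ _ (show rRho ≠ aBad by decide),
              Mem.setN_n, ha2]
            by_cases hj1 : j = cell g (g / 2 ^ b) v
            · simp [hj1, hb]
            · by_cases hj2 : j = cell g (g / 2 ^ b) v + 1 <;> simp [hj1, hj2, hb]
          · simp [hb1]
          · simpa using hs1
          · simpa using hr1
        · simpa using hR.K_eq
        · simpa using hR.top_eq
        · simp
      · simp [NExp.cost, VExp.cost]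
        omega
    · simp [hR.g_eq] at hb
      refine (Tri.skip ?_).le (by omega)
      intro _ j
      rw [if_neg (fun h => absurd h.1 (not_le.2 hb))]
      simp
  · simp [NExp.cost, VExp.cost, BExp.cost, absE]
    omega

theorem findProg_spec (hR : RoundReady n K b g m) :
    Tri x ω findProg m (2 ^ b * 40 + 20) fun m' =>
      (∃ i, 1 ≤ i ∧ i < 2 ^ b ∧ m.n aBad i = 0) →
        1 ≤ m'.n rJsel 0 ∧ m'.n rJsel 0 < 2 ^ b ∧ m.n aBad (m'.n rJsel 0) = 0 := by
  apply Tri.le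
  · apply Tri.seq
    apply Tri.setN
    refine Tri.for (T := 20) (N := 2 ^ b) (fun j m' => (∃ i, 1 ≤ i ∧ i < j ∧ m.n aBad i = 0) →
        1 ≤ m'.n rJsel 0 ∧ m'.n rJsel 0 < j ∧ m.n aBad (m'.n rJsel 0) = 0)
        (by simpa using hR.J_eq) (by decide) (by decide) (by decide) (by simp) ?_
        (fun m' h _ => h)
    intro j hj m' hI hj' hF
    have ha : m'.n aBad = m.n aBad := by rw [hF.n _ (by decide)]; simp
    apply Tri.le
    · refine Tri.cond (T := 6) (fun hb => ?_) (fun hb => ?_)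
      · refine (Tri.setN ?_).le (by simp [NExp.cost])
        simp [hj', ha] at hb
        simp [hj', hb]
      · refine (Tri.skip ?_).le (by simp)
        simp [hj', ha] at hb
        rintro ⟨i, h1, h2, h3⟩
        simp only [Mem.setN_n_ne _ _ _ (show rJsel ≠ rJ by decide)]
        obtain ⟨i1, i2, i3⟩ := hI ⟨i, h1, by
          rcases Nat.lt_succ_iff_lt_or_eq.1 h2 with h | rfl
          · exact h
          · exact absurd h3 (hb h1), h3⟩
        exact ⟨i1, by omega, i3⟩
    · simp [NExp.cost, BExp.cost]
  · simp [NExp.cost]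
    omega

theorem roundOne_spec (hR : RoundReady n K b g m) (hg : 0 < g) {v s : ℝ} (hs : 0 ≤ s) {q : ℕ}
    (hq : m.n rQ 0 = q) (hv : m.v vPar q = (v : ℂ)) (hsh : m.v vSh 0 = (s : ℂ)) :
    Tri x ω roundOne m (K * 50 + 90) fun m' =>
      (∃ r : ℝ, m'.v vPar q = (r : ℂ) ∧ (|v| < g * 2 ^ K → r = rnd g s v)) ∧
      ∀ o, o ≠ q → m'.v vPar o = m.v vPar o := by
  have hev : (absE (.get vPar (reg rQ))).ev m = ((|v| : ℝ) : ℂ) := ev_absE (by simp [hq, hv])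
  apply Tri.le
  · apply Tri.seq
    apply Tri.setV
    rw [hev]
    refine Tri.cond (T := K * 50 + 60) (fun hb => ?_) (fun hb => ?_)
    · simp [hR.g_eq, hsh] at hb
      apply Tri.le
      · apply Tri.seq
        apply Tri.setV
        apply Tri.seq
        apply Tri.setV
        apply Tri.seq
        apply Tri.setN
        apply Tri.bind (divProg_spec (K := K) (S := g * 2 ^ K) (w := |v| - s) ?_ ?_ ?_)
        · rintro m1 ⟨-, r, hr, h1⟩ hF1
          have hq1 : m1.n rQ 0 = q := by rw [hF1.n _ (by decide)]; simpa using hq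
          have hp1 : m1.v vPar = m.v vPar := by rw [hF1.v _ (by decide)]; simp
          have hres : |v| < g * 2 ^ K → r = |v| - s - g * ⌊(|v| - s) / g⌋₊ := by
            intro hvK
            have hgg : g * 2 ^ K / 2 ^ K = g := by field_simp
            rw [hgg] at h1
            obtain ⟨i1, i2, q1, i3, -⟩ := h1 (by linarith) (by linarith)
            rw [← eq_floor_div hg i1 i2 i3]; exact i3
          refine Tri.cond (T := 12) (fun hb' => ?_) (fun hb' => ?_)
          · simp [hq1, hp1, hv] at hb'
            refine (Tri.setV ?_).le (by simp [NExp.cost, VExp.cost])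
            simp only [ev_get, ev_lit, hq1]
            refine ⟨⟨v - r, by simp [hq1, hp1, hv, hr], fun hvK => ?_⟩,
              fun o ho => by rw [Mem.setV_v_idx _ _ _ ho, hp1]⟩
            rw [rnd, if_pos hb, if_pos hb', hres hvK, abs_of_nonneg hb']
            ring
          · simp [hq1, hp1, hv] at hb'
            refine (Tri.setV ?_).le (by simp [NExp.cost, VExp.cost])
            simp only [ev_get, ev_lit, hq1]
            refine ⟨⟨v + r, by simp [hq1, hp1, hv, hr], fun hvK => ?_⟩,
              fun o ho => by rw [Mem.setV_v_idx _ _ _ ho, hp1]⟩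
            rw [rnd, if_pos hb, if_neg (not_le.2 hb'), hres hvK, abs_of_neg hb']
            ring
        · simpa using hR.K_eq
        · simpa using hR.top_eq
        · simp [hsh]
      · simp [NExp.cost, VExp.cost, BExp.cost]
        omega
    · simp [hR.g_eq, hsh] at hb
      refine (Tri.setV ?_).le (by simp [NExp.cost, VExp.cost])
      simp only [ev_get, ev_lit, Mem.setV_n, hq]
      refine ⟨⟨0, by simp, fun _ => ?_⟩, fun o ho => by rw [Mem.setV_v_idx _ _ _ ho]; simp⟩
      rw [rnd, if_neg (by linarith)]
  · simp [NExp.cost, VExp.cost, BExp.cost, absE]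
    omega

/-- The real parts of the entries of `z`, followed by their imaginary parts. -/
noncomputable def parts (n : ℕ) (z : ℕ → ℂ) (q : ℕ) : ℝ := if q < n then (z q).re else (z (q - n)).im

theorem roundProg_spec (hR : RoundReady n K b g m) (hg : 0 < g) :
    Tri x ω roundProg m (n * (K * 250 + b * 150 + 1500) + 2 ^ b * 100 + 200) fun m' =>
      (∀ q < 2 * n, |parts n (m.v vE) q| < g * 2 ^ K) →
      ∃ j, Selected g (g / 2 ^ b) (2 * n) (parts n (m.v vE)) (2 ^ b) j ∧ ∀ q < n,
        m'.v vE q = (rnd g (g / 2 ^ b * j) (m.v vE q).re : ℂ) +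
          Complex.I * (rnd g (g / 2 ^ b * j) (m.v vE q).im : ℂ) := by
  set w := parts n (m.v vE) with hw
  apply Tri.le
  · apply Tri.bind
    · refine Tri.fill 0 (fun q => ((m.v vE q).re : ℂ)) hR.n_eq (by decide) ?_
      intro q hq m' hq' hn hv ho hc
      simp [hq', hv]
    intro m1 ⟨h1, _⟩ hF1
    have hR1 := hR.frame hF1 (by decide) (by decide)
    simp only [zero_add] at h1
    apply Tri.bind
    · refine Tri.fill n (fun q => ((m.v vE q).im : ℂ)) hR1.n_eq (by decide) ?_
      intro q hq m' hq' hn hv ho hc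
      simp [hq', hv, hn, hR1.n_eq, hF1.v vE (by decide)]
    intro m2 ⟨h2, h2'⟩ hF2
    have hR2 := hR1.frame hF2 (by decide) (by decide)
    have hpar : ∀ q < 2 * n, m2.v vPar q = (w q : ℂ) := by
      intro q hq
      rw [hw, parts]
      split_ifs with hqn
      · rw [h2' q (Or.inl hqn), h1 q hqn]
      · rw [← h2 (q - n) (by omega)]; congr 1; omega
    apply Tri.bind
    · refine Tri.for (T := 10) (N := 2 ^ b) (fun j m' => ∀ i < j, m'.n aBad i = 0) hR2.J_eq
        (by decide) (by decide) (by decide) (by simp) ?_ (fun m' h _ => h)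
      intro j hj m' hI hj' _
      refine (Tri.setN fun i hi => ?_).le (by simp [NExp.cost])
      rcases Nat.lt_succ_iff_lt_or_eq.1 hi with h | rfl
      · simp [hj', Mem.setN_n, hI i h]
      · simp [hj']
    intro m3 h3 hF3
    have hR3 := hR2.frame hF3 (by decide) (by decide)
    apply Tri.bind
    · refine Tri.for (T := K * 50 + b * 50 + 90) (N := 2 * n) (fun q m' =>
        (∀ q < 2 * n, |w q| < g * 2 ^ K) →
        ∀ j < 2 ^ b, (m'.n aBad j = 0 ↔ ¬ Marked g (g / 2 ^ b) q w j)) hR3.nn_eq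
        (by decide) (by decide) (by decide) ?_ ?_ (fun m' h _ => h)
      · intro _ j hj
        simp [Marked, h3 j hj]
      · intro q hq m' hI hq' hF
        have hR' := hR3.frame hF (by decide) (by decide)
        refine (markOne_spec hR' hg (v := w q) hq' ?_).imp ?_
        · rw [hF.v _ (by decide), hF3.v _ (by decide)]; exact hpar q hq
        · intro m'' h _ hall j hj
          have h4 := h (hall q hq) j
          have h5 := hI hall j hj
          rw [Mem.setN_n_ne _ _ _ (by decide), h4]
          split_ifs with hc
          · simp only [false_iff, not_not]
            exact ⟨q, by omega, hc.1, hc.2⟩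
          · rw [h5, not_iff_not]
            constructor
            · rintro ⟨q', k1, k2⟩
              exact ⟨q', by omega, k2⟩
            · rintro ⟨q', k1, k2⟩
              rcases Nat.lt_succ_iff_lt_or_eq.1 k1 with k | rfl
              · exact ⟨q', k, k2⟩
              · exact absurd k2 hc
    intro m4 h4 hF4
    have hR4 := hR3.frame hF4 (by decide) (by decide)
    apply Tri.bind (findProg_spec hR4)
    intro m5 h5 hF5
    have hR5 := hR4.frame hF5 (by decide) (by decide)
    apply Tri.seq
    apply Tri.setV
    obtain ⟨j, hj⟩ : ∃ j, m5.n rJsel 0 = j := ⟨_, rfl⟩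
    rw [hj] at h5
    have hsel : (∀ q < 2 * n, |w q| < g * 2 ^ K) →
        Selected g (g / 2 ^ b) (2 * n) w (2 ^ b) j := by
      rintro hall ⟨i, i1, i2, i3⟩
      obtain ⟨k1, k2, k3⟩ := h5 ⟨i, i1, i2, (h4 hall i i2).2 i3⟩
      exact ⟨k1, k2, (h4 hall j k2).1 k3⟩
    have hpar5 : ∀ q < 2 * n, m5.v vPar q = (w q : ℂ) := by
      intro q hq
      rw [hF5.v _ (by decide), hF4.v _ (by decide), hF3.v _ (by decide)]
      exact hpar q hq
    have hs0 : 0 ≤ g / 2 ^ b * j := by positivity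
    apply Tri.bind
    -- The last clause does not assume that the numbers are in range: `roundOne_spec` needs the
    -- unprocessed entries to be real on failing runs as well.
    · refine Tri.for (T := K * 50 + 90) (N := 2 * n) (fun q m' =>
        ∀ o < 2 * n, ∃ r : ℝ, m'.v vPar o = (r : ℂ) ∧ (|w o| < g * 2 ^ K →
          r = if o < q then rnd g (g / 2 ^ b * j) (w o) else w o) ∧ (q ≤ o → r = w o))
        (by simpa using hR5.nn_eq) (by decide) (by decide) (by decide) ?_ ?_ (fun m' h _ => h)
      · intro o ho
        exact ⟨w o, by simpa using hpar5 o ho, by simp, fun _ => rfl⟩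
      · intro q hq m' hI hq' hF
        have hR' : RoundReady n K b g m' := hR5.of_frame
          (fun a ha => (hF.n a (by fin_cases ha <;> decide)).trans (by fin_cases ha <;> simp))
          (fun a ha => (hF.v a (by fin_cases ha <;> decide)).trans (by fin_cases ha <;> simp))
        refine (roundOne_spec hR' hg (v := w q) hs0 hq' ?_ ?_).imp ?_
        · obtain ⟨r, hr, -, hr'⟩ := hI q hq
          rw [hr, hr' le_rfl]
        · rw [hF.v _ (by decide)]
          simp [hR5.eta_eq, hj]
        · rintro m'' ⟨⟨r, k1, k1'⟩, k2⟩ - o ho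
          rw [Mem.setN_v]
          rcases eq_or_ne o q with rfl | hne
          · exact ⟨r, k1, by simpa using k1', by simp⟩
          · obtain ⟨r', l1, l2, l3⟩ := hI o ho
            refine ⟨r', by rw [k2 o hne, l1], fun h => ?_, fun h => l3 (by omega)⟩
            rw [l2 h]
            congr 1
            simp only [eq_iff_iff]
            omega
    intro m6 h6 hF6
    have hR6 : RoundReady n K b g m6 := hR5.of_frame
      (fun a ha => (hF6.n a (by fin_cases ha <;> decide)).trans (by fin_cases ha <;> simp))
      (fun a ha => (hF6.v a (by fin_cases ha <;> decide)).trans (by fin_cases ha <;> simp))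
    refine (Tri.fill 0 (fun q => m6.v vPar q + Complex.I * m6.v vPar (n + q)) hR6.n_eq
      (by decide) ?_).imp ?_
    · intro q hq m' hq' hn hv ho hc
      simp [hq', hv, hn, hR6.n_eq]
    · rintro m7 ⟨h7, -⟩ - hall
      refine ⟨j, hsel hall, fun q hq => ?_⟩
      have h8 := h7 q hq
      rw [zero_add] at h8
      obtain ⟨r1, k1, k1', -⟩ := h6 q (by omega)
      obtain ⟨r2, k2, k2', -⟩ := h6 (n + q) (by omega)
      rw [h8, k1, k2, k1' (hall _ (by omega)), k2' (hall _ (by omega)), if_pos (by omega),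
        if_pos (by omega), hw, parts, parts, if_pos hq, if_neg (by omega), Nat.add_sub_cancel_left]
  · simp [NExp.cost, VExp.cost]
    ring_nf
    omega

end Spec

end SparseFourier

namespace SparseFourier

/-! ### Properties of the rounding -/

section Rounding

variable {g s v e η : ℝ}

/-- A number of absolute value at least s + g moves by less than g; any other is replaced by zero
and is below s + g ≤ 2g. -/
theorem rnd_err (hg : 0 < g) (hsg : s ≤ g) (v : ℝ) : |v - rnd g s v| ≤ 2 * g := by
  rw [rnd]
  split_ifs with h1 h2
  · rw [abs_of_nonneg h2] at h1 ⊢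
    have h3 := Nat.floor_le (show 0 ≤ (v - s) / g by apply div_nonneg <;> linarith)
    have h4 := Nat.lt_floor_add_one ((v - s) / g)
    rw [le_div_iff₀ hg] at h3
    rw [div_lt_iff₀ hg] at h4
    rw [abs_le]; constructor <;> nlinarith
  · rw [abs_of_neg (not_le.1 h2)] at h1 ⊢
    have h3 := Nat.floor_le (show 0 ≤ (-v - s) / g by apply div_nonneg <;> linarith)
    have h4 := Nat.lt_floor_add_one ((-v - s) / g)
    rw [le_div_iff₀ hg] at h3
    rw [div_lt_iff₀ hg] at h4
    rw [abs_le]; constructor <;> nlinarith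
  · rw [sub_zero]; linarith

theorem le_abs_of_rnd_ne_zero (hs : 0 ≤ s) (h : rnd g s v ≠ 0) : g ≤ |v| := by
  by_contra hc
  refine h ?_
  rw [rnd, if_neg (by linarith)]

/-- The floor counts the grid points s + m g with m ≥ 1 that are at most a, hence agrees for two
numbers that no grid point separates. -/
theorem floor_eq_of_no_grid_point {a a' : ℝ} (hg : 0 < g)
    (h : ∀ m : ℕ, 1 ≤ m → (s + m * g ≤ a ↔ s + m * g ≤ a')) :
    ⌊(a - s) / g⌋₊ = ⌊(a' - s) / g⌋₊ := by
  have key : ∀ a a' : ℝ, (∀ m : ℕ, 1 ≤ m → (s + m * g ≤ a ↔ s + m * g ≤ a')) →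
      ⌊(a - s) / g⌋₊ ≤ ⌊(a' - s) / g⌋₊ := by
    intro a a' h
    rcases Nat.eq_zero_or_pos ⌊(a - s) / g⌋₊ with h0 | h0
    · omega
    · have h1 := (Nat.le_floor_iff' h0.ne').1 (le_refl ⌊(a - s) / g⌋₊)
      rw [le_div_iff₀ hg] at h1
      have h2 := (h _ h0).1 (by linarith)
      rw [Nat.le_floor_iff' h0.ne', le_div_iff₀ hg]
      linarith
  exact le_antisymm (key a a' h) (key a' a fun m hm => (h m hm).symm)

/-- A number whose distance to `v` is less than the mesh of the fine grid is rounded as `v` is,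
unless it lies next to a point of the coarse grid. -/
theorem rnd_eq_of_close {J j : ℕ} (hη : 0 < η) (hg : g = J * η) (hJ : 2 ≤ J) (hj : 1 ≤ j)
    (hjJ : j < J) (hclose : |e - v| < η)
    (hm : ¬ (g / 2 ≤ |e| ∧ (j = cell g η e ∨ j = cell g η e + 1))) :
    rnd g (η * j) e = rnd g (η * j) v := by
  have hJ' : (2 : ℝ) ≤ J := by exact_mod_cast hJ
  have hg0 : 0 < g := by rw [hg]; positivity
  have hηg : η * 2 ≤ g := by rw [hg]; nlinarith
  have hs : 0 < η * j := by
    have : (1 : ℝ) ≤ j := by exact_mod_cast hj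
    positivity
  have hs1 : η ≤ η * j := by
    have : (1 : ℝ) ≤ j := by exact_mod_cast hj
    nlinarith
  have habs : |(|e| - |v|)| < η := (abs_abs_sub_abs_le_abs_sub e v).trans_lt hclose
  rw [abs_lt] at habs
  -- no point of the coarse grid separates `|e|` from `|v|`
  have hsep : ∀ m : ℕ, 1 ≤ m → |(|e| - (η * j + m * g))| < η → False := by
    intro m hm1 hd
    rw [abs_lt] at hd
    have hm1' : (1 : ℝ) ≤ m := by exact_mod_cast hm1
    have hmg : g ≤ m * g := by nlinarith
    apply hm
    refine ⟨by linarith, ?_⟩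
    set Q := ⌊|e| / g⌋₊ with hQ
    have q1 := Nat.floor_le (show 0 ≤ |e| / g by positivity)
    have q2 := Nat.lt_floor_add_one (|e| / g)
    rw [le_div_iff₀ hg0, ← hQ] at q1
    rw [div_lt_iff₀ hg0, ← hQ] at q2
    set ρ := cell g η e with hρ
    have hr0 : 0 ≤ |e| - g * Q := by linarith
    have r1 := Nat.floor_le (show 0 ≤ (|e| - g * Q) / η by positivity)
    have r2 := Nat.lt_floor_add_one ((|e| - g * Q) / η)
    rw [le_div_iff₀ hη] at r1
    rw [div_lt_iff₀ hη] at r2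
    change (ρ : ℝ) * η ≤ _ at r1
    change _ < ((ρ : ℝ) + 1) * η at r2
    have hρJ : ρ < J := by
      have : (ρ : ℝ) * η < J * η := by rw [← hg]; linarith
      exact_mod_cast lt_of_mul_lt_mul_right this hη.le
    -- In units of η, the grid point is the integer j + mJ and |e| lies in the unit cell QJ + ρ.
    -- Distance less than one unit leaves only QJ + ρ and QJ + ρ + 1 for the grid point.
    have u1 : ((j + m * J : ℕ) : ℝ) * η < ((Q * J + ρ + 2 : ℕ) : ℝ) * η := by
      push_cast; rw [hg] at *; nlinarith
    have u2 : ((Q * J + ρ : ℕ) : ℝ) * η < ((j + m * J + 1 : ℕ) : ℝ) * η := by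
      push_cast; rw [hg] at *; nlinarith
    have v1 : j + m * J < Q * J + ρ + 2 := by exact_mod_cast lt_of_mul_lt_mul_right u1 hη.le
    have v2 : Q * J + ρ < j + m * J + 1 := by exact_mod_cast lt_of_mul_lt_mul_right u2 hη.le
    rcases lt_trichotomy m Q with h | h | h
    · have : (m + 1) * J ≤ Q * J := Nat.mul_le_mul_right _ h
      have h' : (m + 1) * J = m * J + J := by ring
      omega
    · subst h; omega
    -- This is where j ≥ 1 is needed: with j = 0, a number just below a multiple of g would be close
    -- to a grid point that its cell index modulo g does not reveal.
    · have : (Q + 1) * J ≤ m * J := Nat.mul_le_mul_right _ h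
      have h' : (Q + 1) * J = Q * J + J := by ring
      omega
  have hiff : ∀ m : ℕ, 1 ≤ m → (η * j + m * g ≤ |e| ↔ η * j + m * g ≤ |v|) := by
    intro m hm1
    constructor
    · intro h
      by_contra hc
      exact hsep m hm1 (by rw [abs_lt]; constructor <;> linarith)
    · intro h
      by_contra hc
      exact hsep m hm1 (by rw [abs_lt]; constructor <;> linarith)
  have hfl := floor_eq_of_no_grid_point hg0 hiff
  have h1 := hiff 1 le_rfl
  rw [Nat.cast_one, one_mul] at h1
  rw [abs_lt] at hclose
  by_cases hbig : η * j + g ≤ |e|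
  · rw [rnd, rnd, if_pos hbig, if_pos (h1.1 hbig), hfl]
    rcases le_or_gt 0 e with he | he
    · rw [abs_of_nonneg he] at hbig
      rw [if_pos he, if_pos (by linarith)]
    · rw [abs_of_neg he] at hbig
      rw [if_neg (not_le.2 he), if_neg (by linarith)]
  · rw [rnd, rnd, if_neg hbig, if_neg (fun h => hbig (h1.2 h))]

/-- If few numbers are far from zero, some shift is not marked. -/
theorem exists_not_marked {N J c : ℕ} {w : ℕ → ℝ}
    (hc : ((Finset.range N).filter fun q => g / 2 ≤ |w q|).card ≤ c) (hJ : 2 * c + 1 < J) :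
    ∃ i, 1 ≤ i ∧ i < J ∧ ¬ Marked g η N w i := by
  classical
  by_contra hcon
  push Not at hcon
  set F := (Finset.range N).filter fun q => g / 2 ≤ |w q| with hF
  have hsub : Finset.Ico 1 J ⊆ F.image (fun q => cell g η (w q)) ∪
      F.image (fun q => cell g η (w q) + 1) := by
    intro i hi
    rw [Finset.mem_Ico] at hi
    obtain ⟨q, hq, hq1, hq2⟩ := hcon i hi.1 hi.2
    have hqF : q ∈ F := Finset.mem_filter.2 ⟨Finset.mem_range.2 hq, hq1⟩
    rw [Finset.mem_union, Finset.mem_image, Finset.mem_image]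
    rcases hq2 with h | h
    · exact Or.inl ⟨q, hqF, h.symm⟩
    · exact Or.inr ⟨q, hqF, h.symm⟩
  have h1 := (Finset.card_le_card hsub).trans (Finset.card_union_le _ _)
  have h2 := Finset.card_image_le (s := F) (f := fun q => cell g η (w q))
  have h3 := Finset.card_image_le (s := F) (f := fun q => cell g η (w q) + 1)
  rw [Nat.card_Ico] at h1
  omega

end Rounding

/-- Rounding of real and imaginary part. -/
noncomputable def rndC (g s : ℝ) (z : ℂ) : ℂ := (rnd g s z.re : ℂ) + Complex.I * (rnd g s z.im : ℂ)

theorem norm_sub_rndC_le {g s : ℝ} (hg : 0 < g) (hsg : s ≤ g) (z : ℂ) :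
    ‖z - rndC g s z‖ ≤ 4 * g := by
  refine (Complex.norm_le_abs_re_add_abs_im _).trans ?_
  have h1 := rnd_err hg hsg z.re
  have h2 := rnd_err hg hsg z.im
  simp only [rndC, Complex.sub_re, Complex.add_re, Complex.ofReal_re, Complex.mul_re,
    Complex.I_re, Complex.I_im, Complex.ofReal_im, Complex.sub_im, Complex.add_im, Complex.mul_im]
  norm_num
  linarith

theorem le_norm_of_rndC_ne_zero {g s : ℝ} {z : ℂ} (hs : 0 ≤ s) (h : rndC g s z ≠ 0) : g ≤ ‖z‖ := by
  by_contra hc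
  refine h ?_
  have h1 : rnd g s z.re = 0 := by
    by_contra h'
    exact hc ((le_abs_of_rnd_ne_zero hs h').trans (Complex.abs_re_le_norm z))
  have h2 : rnd g s z.im = 0 := by
    by_contra h'
    exact hc ((le_abs_of_rnd_ne_zero hs h').trans (Complex.abs_im_le_norm z))
  simp [rndC, h1, h2]

/-! ### Vectors with a small tail -/

/-- `e` is within `a` of `X` and supported on the large coordinates of `X`. -/
structure Approx {α : Type*} (X : α → ℂ) (μ a : ℝ) (e : α → ℂ) : Prop where
  le : ∀ f, ‖X f - e f‖ ≤ a
  supp : ∀ f, e f ≠ 0 → μ / 8 ≤ ‖X f‖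

section Tail

variable {α : Type*} [Fintype α]

open Classical in
/-- Outside some `k` coordinates, the vector `X` has square sum at most `k μ²`. -/
def SmallTail (X : α → ℂ) (k : ℕ) (μ : ℝ) : Prop :=
  ∃ S : Finset α, S.card ≤ k ∧ ∑ f ∈ Finset.univ.filter (· ∉ S), ‖X f‖ ^ 2 ≤ k * μ ^ 2

-- At most k coordinates lie in the exceptional set. By Markov's inequality for squares, at most k
-- μ²/θ² ≤ c k others reach θ.
open Classical in
theorem SmallTail.card_le {X : α → ℂ} {k : ℕ} {μ θ : ℝ} (h : SmallTail X k μ) (hθ : 0 < θ)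
    {c : ℕ} (hc : μ ^ 2 ≤ c * θ ^ 2) :
    (Finset.univ.filter fun f => θ ≤ ‖X f‖).card ≤ (c + 1) * k := by
  obtain ⟨S, hS, hsum⟩ := h
  have hsub : (Finset.univ.filter fun f => θ ≤ ‖X f‖) ⊆
      S ∪ Finset.univ.filter fun f => f ∉ S ∧ θ ≤ ‖X f‖ := by
    intro f hf
    simp only [Finset.mem_filter, Finset.mem_univ, true_and, Finset.mem_union] at hf ⊢
    tauto
  have h2 : ((Finset.univ.filter fun f => f ∉ S ∧ θ ≤ ‖X f‖).card : ℝ) * θ ^ 2 ≤ k * μ ^ 2 := by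
    refine le_trans ?_ hsum
    rw [← nsmul_eq_mul]
    refine (Finset.card_nsmul_le_sum _ (fun f => ‖X f‖ ^ 2) _ fun f hf => ?_).trans ?_
    · have := (Finset.mem_filter.1 hf).2.2
      gcongr
    · refine Finset.sum_le_sum_of_subset_of_nonneg (fun f hf => ?_) fun _ _ _ => by positivity
      simp only [Finset.mem_filter, Finset.mem_univ, true_and] at hf ⊢
      exact hf.1
  have h3 : (Finset.univ.filter fun f => f ∉ S ∧ θ ≤ ‖X f‖).card ≤ k * c := by
    have : ((Finset.univ.filter fun f => f ∉ S ∧ θ ≤ ‖X f‖).card : ℝ) * θ ^ 2 ≤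
        ((k * c : ℕ) : ℝ) * θ ^ 2 := by
      push_cast
      have : (k : ℝ) * μ ^ 2 ≤ k * (c * θ ^ 2) := by gcongr
      linarith
    exact_mod_cast le_of_mul_le_mul_right this (by positivity)
  calc _ ≤ _ := Finset.card_le_card hsub
    _ ≤ _ := Finset.card_union_le _ _
    _ ≤ k + k * c := by omega
    _ = (c + 1) * k := by ring

theorem Approx.nnz_le {X : α → ℂ} {k : ℕ} {μ a : ℝ} {e : α → ℂ} (h : Approx X μ a e)
    (hX : SmallTail X k μ) (hμ : 0 < μ) : nnzCount e ≤ 65 * k := by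
  classical
  refine le_trans ?_ (hX.card_le (θ := μ / 8) (c := 64) (by positivity) (by ring_nf; rfl))
  rw [nnzCount, ← Set.ncard_coe_finset]
  refine Set.ncard_le_ncard (fun f hf => ?_) (Finset.finite_toSet _)
  simpa using h.supp f hf

/-- At most 65k coordinates have |X| ≥ μ/8, and each contributes at most a². Elsewhere e vanishes
and the residual is X itself: the k exceptional coordinates contribute less than μ² each, the tail
at most k μ² in total. -/
theorem Approx.sum_le {X : α → ℂ} {k : ℕ} {μ a : ℝ} {e : α → ℂ} (h : Approx X μ a e)
    (hX : SmallTail X k μ) (hμ : 0 < μ) (ha : μ ≤ a) :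
    ∑ f, ‖X f - e f‖ ^ 2 ≤ 67 * k * a ^ 2 := by
  classical
  set L := Finset.univ.filter fun f => μ / 8 ≤ ‖X f‖ with hL
  have hcard : L.card ≤ 65 * k :=
    hX.card_le (θ := μ / 8) (c := 64) (by positivity) (by ring_nf; rfl)
  have hcard' : (L.card : ℝ) ≤ 65 * k := by exact_mod_cast hcard
  obtain ⟨S, hS, hsum⟩ := hX
  have hS' : (S.card : ℝ) ≤ k := by exact_mod_cast hS
  have h1 : ∀ f, ‖X f - e f‖ ^ 2 ≤ (if f ∈ L then a ^ 2 else 0) + ((if f ∈ S then μ ^ 2 else 0) +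
      (if f ∉ S then ‖X f‖ ^ 2 else 0)) := by
    intro f
    by_cases hf : f ∈ L
    · rw [if_pos hf]
      have h2 : ‖X f - e f‖ ^ 2 ≤ a ^ 2 := by gcongr; exact h.le f
      have h3 : (0 : ℝ) ≤ (if f ∈ S then μ ^ 2 else 0) + (if f ∉ S then ‖X f‖ ^ 2 else 0) := by
        split_ifs <;> positivity
      linarith
    · have he : e f = 0 := by
        by_contra hne
        exact hf (by simpa [hL] using h.supp f hne)
      have hlt : ‖X f‖ < μ / 8 := by simpa [hL] using hf
      rw [if_neg hf, he, sub_zero, zero_add]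
      by_cases hfS : f ∈ S
      · rw [if_pos hfS, if_neg (not_not.2 hfS), add_zero]
        gcongr; linarith
      · rw [if_neg hfS, if_pos hfS, zero_add]
  calc ∑ f, ‖X f - e f‖ ^ 2 ≤ _ := Finset.sum_le_sum fun f _ => h1 f
    _ = L.card * a ^ 2 + (S.card * μ ^ 2 + ∑ f ∈ Finset.univ.filter (· ∉ S), ‖X f‖ ^ 2) := by
      rw [Finset.sum_add_distrib, Finset.sum_add_distrib, Finset.sum_ite_mem, Finset.sum_ite_mem,
        Finset.sum_filter]
      simp
    _ ≤ 65 * k * a ^ 2 + (k * μ ^ 2 + k * μ ^ 2) := by gcongr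
    _ ≤ 65 * k * a ^ 2 + (k * a ^ 2 + k * a ^ 2) := by gcongr
    _ = _ := by ring

end Tail

theorem approx_zero {α : Type*} {X : α → ℂ} {μ a : ℝ} (h : ∀ f, ‖X f‖ ≤ a) : Approx X μ a 0 :=
  ⟨by simpa using h, by simp⟩

theorem approx_rndC {α : Type*} {X : α → ℂ} {μ g s : ℝ} (hg : 0 < g) (hμ : μ / 8 ≤ g) (hs : 0 ≤ s)
    (hsg : s ≤ g) : Approx X μ (4 * g) fun f => rndC g s (X f) :=
  ⟨fun _ => norm_sub_rndC_le hg hsg _, fun _ hf => hμ.trans (le_norm_of_rndC_ne_zero hs hf)⟩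

/-! ### The improvement step -/

-- Two values within a/24 of z are within a/12 of each other, so every such value is close to a
-- majority and something is picked. Conversely, a value close to a majority is within a/12 of some
-- value that is within a/24 of z. This majority test avoids medians of complex numbers.
open Classical in
theorem norm_pick_sub_le {R : ℕ} {a : ℝ} {v : ℕ → ℂ} {z : ℂ} (ha : 0 < a)
    (h : 2 * ((Finset.range R).filter fun r => a / 24 < ‖v r - z‖).card < R) :
    ‖pick R (a / 12 * (a / 12)) v R - z‖ ≤ a / 8 := by
  obtain ⟨G, hG⟩ : ∃ G, G = Finset.range R \
    (Finset.range R).filter fun r => a / 24 < ‖v r - z‖ := ⟨_, rfl⟩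
  have hmem : ∀ r, r ∈ G ↔ r < R ∧ ‖v r - z‖ ≤ a / 24 := by
    intro r; simp [hG]; tauto
  have hcard : R < 2 * G.card := by
    rw [hG, Finset.card_sdiff_of_subset (Finset.filter_subset _ _), Finset.card_range]
    omega
  have hclose : ∀ w : ℂ, Complex.normSq w ≤ a / 12 * (a / 12) ↔ ‖w‖ ≤ a / 12 := by
    intro w
    rw [Complex.normSq_eq_norm_sq, ← sq]
    exact pow_le_pow_iff_left₀ (norm_nonneg _) (by positivity) two_ne_zero
  have h1 : ∀ i, R < 2 * ((Finset.range R).filter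
      fun j => Complex.normSq (v i - v j) ≤ a / 12 * (a / 12)).card → ‖v i - z‖ ≤ a / 8 := by
    intro i hi
    obtain ⟨j, hj⟩ : (((Finset.range R).filter
        fun j => Complex.normSq (v i - v j) ≤ a / 12 * (a / 12)) ∩ G).Nonempty := by
      by_contra hne
      rw [Finset.not_nonempty_iff_eq_empty] at hne
      have h2 := Finset.card_union_of_disjoint (Finset.disjoint_iff_inter_eq_empty.2 hne)
      have h3 := Finset.card_le_card (Finset.union_subset (Finset.filter_subset
        (fun j => Complex.normSq (v i - v j) ≤ a / 12 * (a / 12)) (Finset.range R))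
        (hG ▸ Finset.sdiff_subset : G ⊆ Finset.range R))
      rw [Finset.card_range] at h3
      omega
    rw [Finset.mem_inter, Finset.mem_filter, hmem, hclose] at hj
    calc ‖v i - z‖ = ‖(v i - v j) + (v j - z)‖ := by congr 1; ring
      _ ≤ _ := norm_add_le _ _
      _ ≤ a / 12 + a / 24 := add_le_add hj.1.2 hj.2.2
      _ = a / 8 := by ring
  have h2 : ∀ i, (∃ j < i, j ∈ G) → ‖pick R (a / 12 * (a / 12)) v i - z‖ ≤ a / 8 := by
    intro i
    induction i with
    | zero => rintro ⟨j, hj, -⟩; omega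
    | succ i ih =>
      rintro ⟨j, hj, hjG⟩
      rw [pick]
      split_ifs with hi
      · exact h1 i hi
      · rcases Nat.lt_succ_iff_lt_or_eq.1 hj with hj | rfl
        · exact ih ⟨j, hj, hjG⟩
        · refine absurd (hcard.trans_le ?_) hi
          refine Nat.mul_le_mul_left _ (Finset.card_le_card fun r hr => ?_)
          rw [hmem] at hr hjG
          rw [Finset.mem_filter, hclose]
          refine ⟨Finset.mem_range.2 hr.1, ?_⟩
          calc ‖v j - v r‖ = ‖(v j - z) - (v r - z)‖ := by congr 1; ring
            _ ≤ _ := norm_sub_le _ _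
            _ ≤ a / 24 + a / 24 := add_le_add hjG.2 hr.2
            _ = a / 12 := by ring
  obtain ⟨j, hj⟩ := Finset.card_pos.1 (show 0 < G.card by omega)
  exact h2 R ⟨j, ((hmem j).1 hj).1, hj⟩

section Steps

variable {p d : ℕ}

open Classical in
/-- At the frequency `f`, half of the estimates of `X - e` are far off. -/
def BadAt (x X : Idx p d → ℂ) (R B : ℕ) (a : ℝ) (e : Idx p d → ℂ) (s : ℕ) (f : Idx p d)
    (τ : ℕ → Idx p d) : Prop :=
  R ≤ 2 * ((Finset.range R).filter fun r =>
    a / 24 < ‖est (fun t => x t - invDft e t) τ (s + r * B) B f - (X f - e f)‖).card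

/-- After a correction the error is at most a/8; without one it is at most a/4 + a/8. A correction
where e vanishes has size at least a/4, which forces |X f| ≥ a/8 ≥ μ/8, so the support condition
persists. -/
theorem approx_stepFn {x X : Idx p d → ℂ} {R B s : ℕ} {a μ : ℝ} {e : Idx p d → ℂ}
    {τ : ℕ → Idx p d} (hμ : 0 < μ) (ha : μ ≤ a) (he : Approx X μ a e)
    (hgood : ∀ f, ¬ BadAt x X R B a e s f τ) : Approx X μ (a / 2) (stepFn x τ R B s a e) := by
  classical
  have ha0 : 0 < a := by linarith
  have key : ∀ f, ‖X f - stepFn x τ R B s a e f‖ ≤ a / 2 ∧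
      (stepFn x τ R B s a e f ≠ 0 → μ / 8 ≤ ‖X f‖) := by
    intro f
    have hu := norm_pick_sub_le ha0 (not_le.1 (hgood f))
    rw [stepFn]
    set u := pick R (a / 12 * (a / 12))
      (fun r => est (fun t => x t - invDft e t) τ (s + r * B) B f) R with hu_def
    have hiff : a / 4 * (a / 4) ≤ Complex.normSq u ↔ a / 4 ≤ ‖u‖ := by
      rw [Complex.normSq_eq_norm_sq, ← sq]
      exact pow_le_pow_iff_left₀ (by positivity) (norm_nonneg _) two_ne_zero
    simp only [hiff]
    split_ifs with h
    · refine ⟨?_, fun _ => ?_⟩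
      · rw [← norm_neg, show -(X f - (e f + u)) = u - (X f - e f) by ring]
        linarith
      · by_cases hef : e f = 0
        · rw [hef, sub_zero] at hu
          have h1 := norm_sub_norm_le u (X f)
          linarith
        · exact he.supp f hef
    · refine ⟨?_, he.supp f⟩
      have h1 := norm_sub_norm_le (X f - e f) u
      rw [← norm_neg (X f - e f - u), neg_sub] at h1
      linarith
  exact ⟨fun f => (key f).1, fun f => (key f).2⟩

/-- Some step of the repeated improvement of `e` goes wrong. -/
def BadRun (x X : Idx p d → ℂ) (R B H : ℕ) (a μ : ℝ) (e : Idx p d → ℂ) (τ : ℕ → Idx p d) : Prop :=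
  ∃ h < H, μ ≤ a / 2 ^ h ∧ Approx X μ (a / 2 ^ h) (runSteps x τ R B a e h) ∧
    ∃ f, BadAt x X R B (a / 2 ^ h) (runSteps x τ R B a e h) (h * (R * B)) f τ

theorem approx_runSteps {x X : Idx p d → ℂ} {R B H : ℕ} {a μ : ℝ} {e : Idx p d → ℂ}
    {τ : ℕ → Idx p d} (hμ : 0 < μ) (he : Approx X μ a e) (hgood : ¬ BadRun x X R B H a μ e τ)
    {h : ℕ} (hh : h ≤ H) (ha : ∀ i < h, μ ≤ a / 2 ^ i) :
    Approx X μ (a / 2 ^ h) (runSteps x τ R B a e h) := by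
  induction h with
  | zero => simpa [runSteps] using he
  | succ h ih =>
    have h1 := ih (by omega) (fun i hi => ha i (by omega))
    have h2 := ha h (by omega)
    rw [runSteps, pow_succ, ← div_div]
    refine approx_stepFn hμ h2 h1 fun f hf => hgood ⟨h, by omega, h2, h1, f, hf⟩

end Steps

/-! ### Rounding an approximation -/

/-- The mesh of the rounding that leads to precision `2 ^ E μ / 2`. -/
noncomputable def mesh (μ : ℝ) (E : ℕ) : ℝ := 2 ^ E * μ / 8

/-- The selected shift is computed from the approximation z, yet the rounded vector depends on z
only through j, because it equals the rounding of X. This is what allows the same samples to be used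
in all iterations. -/
theorem rndC_eq_of_selected {p d : ℕ} {X : Idx p d → ℂ} {k b E : ℕ} {μ : ℝ} {j : ℕ} {z : ℕ → ℂ}
    (hX : SmallTail X k μ) (hμ : 0 < μ) (hb : 8 * k + 1 < 2 ^ b) (hE : b + 4 ≤ E)
    (hz : ∀ f, ‖X f - z (addr f)‖ ≤ 2 ^ E * μ / 2 ^ (b + 4))
    (hj : Selected (mesh μ E) (mesh μ E / 2 ^ b) (2 * p ^ d) (parts (p ^ d) z) (2 ^ b) j) :
    j < 2 ^ b ∧ ∀ f, rndC (mesh μ E) (mesh μ E / 2 ^ b * j) (z (addr f)) =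
      rndC (mesh μ E) (mesh μ E / 2 ^ b * j) (X f) := by
  classical
  set g := mesh μ E with hg
  set η := g / 2 ^ b with hη
  have hg0 : 0 < g := by rw [hg, mesh]; positivity
  have hη0 : 0 < η := by positivity
  have hb2 : 2 ≤ 2 ^ b := by omega
  have hb2' : (2 : ℝ) ≤ 2 ^ b := by exact_mod_cast hb2
  have hgη : g = (2 ^ b : ℕ) * η := by rw [hη]; push_cast; field_simp
  -- The precision reached before rounding is half the spacing η of the shifts.
  have hδ : 2 ^ E * μ / 2 ^ (b + 4) = η / 2 := by
    rw [hη, hg, mesh, pow_add]; field_simp; norm_num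
  rw [hδ] at hz
  -- Since b ≥ 1, E ≥ 5 and the mesh is at least 2⁵μ/8. A part of z of size g/2 then comes from a
  -- coordinate with |X| ≥ g/2 - g/4 ≥ μ, of which there are at most 2k.
  have hgμ : 4 * μ ≤ g := by
    rw [hg, mesh]
    have : (2 : ℝ) ^ 5 ≤ 2 ^ E := by
      refine pow_le_pow_right₀ (by norm_num) ?_
      have : b ≠ 0 := by rintro rfl; simp at hb2
      omega
    nlinarith
  have hηg : η * 2 ≤ g := by rw [hgη]; push_cast; nlinarith
  have hlarge : ∀ f, g / 2 ≤ ‖z (addr f)‖ → μ ≤ ‖X f‖ := by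
    intro f hf
    have h1 := norm_sub_norm_le (z (addr f)) (X f)
    rw [← norm_neg (z (addr f) - X f), neg_sub] at h1
    have := hz f
    linarith
  set F := Finset.univ.filter fun f => μ ≤ ‖X f‖ with hF
  have hFcard : F.card ≤ 2 * k := hX.card_le (c := 1) hμ (by simp)
  have hcount : ((Finset.range (2 * p ^ d)).filter fun q => g / 2 ≤ |parts (p ^ d) z q|).card
      ≤ 4 * k := by
    have hsub : ((Finset.range (2 * p ^ d)).filter fun q => g / 2 ≤ |parts (p ^ d) z q|) ⊆
        F.image addr ∪ F.image fun f => p ^ d + addr f := by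
      intro q hq
      rw [Finset.mem_filter, Finset.mem_range, parts] at hq
      rw [Finset.mem_union, Finset.mem_image, Finset.mem_image]
      split_ifs at hq with hqn
      · obtain ⟨f, rfl⟩ := exists_addr hqn
        exact Or.inl ⟨f, Finset.mem_filter.2 ⟨Finset.mem_univ _,
          hlarge f (hq.2.trans (Complex.abs_re_le_norm _))⟩, rfl⟩
      · obtain ⟨f, hf⟩ := exists_addr (p := p) (d := d) (q := q - p ^ d) (by omega)
        rw [← hf] at hq
        exact Or.inr ⟨f, Finset.mem_filter.2 ⟨Finset.mem_univ _,
          hlarge f (hq.2.trans (Complex.abs_im_le_norm _))⟩, by omega⟩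
    have h1 := (Finset.card_le_card hsub).trans (Finset.card_union_le _ _)
    have h2 := Finset.card_image_le (s := F) (f := addr)
    have h3 := Finset.card_image_le (s := F) (f := fun f => p ^ d + addr f)
    omega
  -- At most 4k real or imaginary parts are large, and 2·4k + 1 < 2^b, so an unmarked shift exists.
  obtain ⟨j1, j2, j3⟩ := hj (exists_not_marked hcount (by omega))
  refine ⟨j2, fun f => ?_⟩
  have hlt := addr_lt f
  have hre : rnd g (η * j) (z (addr f)).re = rnd g (η * j) (X f).re := by
    refine rnd_eq_of_close hη0 hgη hb2 j1 j2 ?_ fun h => j3 ⟨addr f, by omega, ?_⟩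
    · rw [← abs_neg, neg_sub, ← Complex.sub_re]
      exact (Complex.abs_re_le_norm _).trans_lt ((hz f).trans_lt (by linarith))
    · simpa [parts, hlt] using h
  have him : rnd g (η * j) (z (addr f)).im = rnd g (η * j) (X f).im := by
    refine rnd_eq_of_close hη0 hgη hb2 j1 j2 ?_ fun h => j3 ⟨p ^ d + addr f, by omega, ?_⟩
    · rw [← abs_neg, neg_sub, ← Complex.sub_im]
      exact (Complex.abs_im_le_norm _).trans_lt ((hz f).trans_lt (by linarith))
    · simpa [parts] using h
  rw [rndC, rndC, hre, him]

end SparseFourier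

namespace SparseFourier

open ProbabilityTheory

/-! ### Orthogonality of characters -/

section Fourier

variable {p d : ℕ}

theorem norm_ru (a b : ℕ) : ‖ru a b‖ = 1 := by
  rw [ru, show (2 * Real.pi * Complex.I * (a : ℂ) / (b : ℂ)) =
    ((2 * Real.pi * a / b : ℝ) : ℂ) * Complex.I by push_cast; ring, Complex.norm_exp_ofReal_mul_I]

theorem ru_mul_conj (a b : ℕ) : ru a b * (starRingEnd ℂ) (ru a b) = 1 := by
  rw [Complex.mul_conj, Complex.normSq_eq_norm_sq, norm_ru]; norm_num

theorem norm_chi (f t : Idx p d) : ‖chi f t‖ = 1 := norm_ru _ _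

theorem chi_comm (f t : Idx p d) : chi f t = chi t f := by
  simp only [chi, mul_comm]

theorem conj_ru (a b : ℕ) (hb : b ≠ 0) : (starRingEnd ℂ) (ru a b) = ru ((b - 1) * a) b := by
  have h : ru a b * ru ((b - 1) * a) b = 1 := by
    have e : a + (b - 1) * a = a * b := by
      obtain ⟨b, rfl⟩ := Nat.exists_eq_succ_of_ne_zero hb
      simp only [Nat.succ_eq_add_one, Nat.add_sub_cancel]; ring
    rw [← ru_add, e, ru_mul_self]
  exact mul_left_cancel₀ (ru_ne_zero a b) ((ru_mul_conj a b).trans h.symm)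

/-- The sum factors over the coordinates into geometric sums, which vanish unless p divides f_i +
(p-1) g_i, that is f_i = g_i. -/
theorem sum_chi_mul_conj [NeZero p] (f g : Idx p d) :
    ∑ t, chi f t * (starRingEnd ℂ) (chi g t) = if f = g then ((p ^ d : ℕ) : ℂ) else 0 := by
  have hp : p ≠ 0 := NeZero.ne p
  have h1 : ∀ t : Idx p d, chi f t * (starRingEnd ℂ) (chi g t) =
      ∏ i, ru ((t i : ℕ) * ((f i : ℕ) + (p - 1) * (g i : ℕ))) p := by
    intro t
    rw [chi_eq_prod, chi_eq_prod, map_prod, ← Finset.prod_mul_distrib]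
    refine Finset.prod_congr rfl fun i _ => ?_
    rw [conj_ru _ _ hp, ← ru_add]
    congr 1; ring
  simp_rw [h1]
  have h2 := Finset.prod_univ_sum (fun _ : Fin d => (Finset.univ : Finset (Fin p)))
    (fun (i : Fin d) (a : Fin p) => ru ((a : ℕ) * ((f i : ℕ) + (p - 1) * (g i : ℕ))) p)
  rw [Fintype.piFinset_univ] at h2
  rw [← h2]
  have h3 : ∀ i, ∑ a : Fin p, ru ((a : ℕ) * ((f i : ℕ) + (p - 1) * (g i : ℕ))) p =
      if f i = g i then (p : ℂ) else 0 := by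
    intro i
    rw [Finset.sum_range (fun a => ru (a * ((f i : ℕ) + (p - 1) * (g i : ℕ))) p) |>.symm, sum_ru hp]
    have hiff : p ∣ (f i : ℕ) + (p - 1) * (g i : ℕ) ↔ f i = g i := by
      have hf := (f i).2
      have hg := (g i).2
      have e1 : (f i : ℕ) + (p - 1) * (g i : ℕ) + g i = f i + p * g i := by
        rw [add_assoc, ← Nat.succ_mul, Nat.succ_eq_add_one, Nat.sub_add_cancel (by omega)]
      constructor
      · intro h
        have h4 : ((f i : ℕ) + (p - 1) * (g i : ℕ) + g i) % p = (g i : ℕ) := by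
          rw [Nat.add_mod, Nat.mod_eq_zero_of_dvd h, zero_add, Nat.mod_mod, Nat.mod_eq_of_lt hg]
        rw [e1, Nat.add_mul_mod_self_left, Nat.mod_eq_of_lt hf] at h4
        exact Fin.ext h4
      · intro h
        rw [← h] at e1 ⊢
        exact ⟨f i, by omega⟩
    simp only [hiff]
  simp_rw [h3]
  split_ifs with h
  · subst h; simp
  · obtain ⟨i, hi⟩ := Function.ne_iff.1 h
    exact Finset.prod_eq_zero (Finset.mem_univ i) (if_neg hi)

theorem dft_eq (x : Idx p d → ℂ) (f : Idx p d) :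
    dft x f = 1 / (Real.sqrt ((p : ℝ) ^ d) : ℂ) * dftU x f := by
  rw [dft, dftU]
  congr 1
  refine Finset.sum_congr rfl fun t _ => ?_
  rw [chi, ru, ← Complex.exp_nat_mul]
  congr 2
  push_cast
  ring

theorem sqrt_mul_self_card (p d : ℕ) :
    (Real.sqrt ((p : ℝ) ^ d) : ℂ) * (Real.sqrt ((p : ℝ) ^ d) : ℂ) = ((p ^ d : ℕ) : ℂ) := by
  rw [← Complex.ofReal_mul, Real.mul_self_sqrt (by positivity)]; push_cast; rfl

theorem sqrt_card_ne_zero [NeZero p] (d : ℕ) : (Real.sqrt ((p : ℝ) ^ d) : ℂ) ≠ 0 := by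
  have : 0 < (p : ℝ) := by exact_mod_cast NeZero.pos p
  rw [Complex.ofReal_ne_zero]; positivity

theorem invDft_eq (e : Idx p d → ℂ) (t : Idx p d) :
    invDft e t = (∑ f, e f * (starRingEnd ℂ) (chi f t)) / (Real.sqrt ((p : ℝ) ^ d) : ℂ) := by
  rw [invDft, dftU, map_sum]
  congr 1
  refine Finset.sum_congr rfl fun f _ => ?_
  rw [map_mul, Complex.conj_conj, chi_comm]

theorem dft_invDft [NeZero p] (e : Idx p d → ℂ) : dft (invDft e) = e := by
  funext f
  rw [dft_eq, dftU]
  simp_rw [invDft_eq, div_mul_eq_mul_div, Finset.sum_mul]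
  rw [← Finset.sum_div, Finset.sum_comm]
  have h : ∀ g : Idx p d, ∑ t, e g * (starRingEnd ℂ) (chi g t) * chi f t =
      if f = g then e g * ((p ^ d : ℕ) : ℂ) else 0 := by
    intro g
    have := sum_chi_mul_conj f g
    simp_rw [mul_assoc, ← Finset.mul_sum, mul_comm ((starRingEnd ℂ) (chi g _)), this]
    split_ifs <;> simp
  simp_rw [h]
  rw [Finset.sum_ite_eq, if_pos (Finset.mem_univ _), ← sqrt_mul_self_card]
  have := sqrt_card_ne_zero (p := p) d
  field_simp

theorem dft_sub (x y : Idx p d → ℂ) (f : Idx p d) :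
    dft (fun t => x t - y t) f = dft x f - dft y f := by
  simp only [dft_eq, dftU, sub_mul, Finset.sum_sub_distrib, mul_sub]

theorem invDft_dft [NeZero p] (x : Idx p d → ℂ) : invDft (dft x) = x := by
  funext t
  rw [invDft_eq]
  simp_rw [dft_eq, dftU, mul_assoc, Finset.sum_mul]
  rw [← Finset.mul_sum, Finset.sum_comm]
  have h : ∀ s : Idx p d, ∑ f, x s * chi f s * (starRingEnd ℂ) (chi f t) =
      if s = t then x s * ((p ^ d : ℕ) : ℂ) else 0 := by
    intro s
    have := sum_chi_mul_conj s t
    simp_rw [chi_comm _ s, chi_comm _ t, mul_assoc, ← Finset.mul_sum, this]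
    split_ifs <;> simp
  simp_rw [h]
  rw [Finset.sum_ite_eq', if_pos (Finset.mem_univ _), ← sqrt_mul_self_card]
  have := sqrt_card_ne_zero (p := p) d
  field_simp

theorem sum_norm_sq_dft [NeZero p] (w : Idx p d → ℂ) : ∑ f, ‖dft w f‖ ^ 2 = ∑ t, ‖w t‖ ^ 2 := by
  have hs := sqrt_card_ne_zero (p := p) d
  have h1 : ∑ f, dft w f * (starRingEnd ℂ) (dft w f) = ∑ t, w t * (starRingEnd ℂ) (w t) := by
    have h2 : ∀ f, dft w f * (starRingEnd ℂ) (dft w f) =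
        ∑ t, (starRingEnd ℂ) (w t) * (dft w f * (starRingEnd ℂ) (chi f t)) /
          (Real.sqrt ((p : ℝ) ^ d) : ℂ) := by
      intro f
      conv_lhs => rw [dft_eq w f, map_mul, ← dft_eq w f]
      rw [dftU, map_sum, Finset.mul_sum, Finset.mul_sum]
      refine Finset.sum_congr rfl fun t _ => ?_
      rw [map_mul, map_div₀, map_one, Complex.conj_ofReal]
      ring
    simp_rw [h2]
    rw [Finset.sum_comm]
    refine Finset.sum_congr rfl fun t _ => ?_
    rw [← Finset.sum_div, ← Finset.mul_sum, mul_div_assoc, ← invDft_eq, invDft_dft, mul_comm]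
  simp_rw [Complex.mul_conj, Complex.normSq_eq_norm_sq] at h1
  exact_mod_cast h1

end Fourier

/-! ### Independent uniform samples -/

section Samples

variable {p d : ℕ} [NeZero p]

/-- The distribution of the sample positions. -/
noncomputable def sampleMeasure (p d : ℕ) : Measure (ℕ → Idx p d) :=
  Measure.infinitePi fun _ : ℕ => uniformOn (Set.univ : Set (Idx p d))

instance : IsProbabilityMeasure (sampleMeasure p d) := by
  unfold sampleMeasure; infer_instance

omit [NeZero p] in
theorem tapeMeasure_fst (A : Set (ℕ → Idx p d)) :
    tapeMeasure p d {ω | ω.1 ∈ A} = sampleMeasure p d A := by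
  have : {ω : Tape p d | ω.1 ∈ A} = A ×ˢ Set.univ := by ext; simp
  rw [this, tapeMeasure, Measure.prod_prod, measure_univ, mul_one, sampleMeasure]

/-- The set `A` of sequences depends only on the entries in `S`. -/
def DependsOn (A : Set (ℕ → Idx p d)) (S : Finset ℕ) : Prop :=
  ∀ τ τ' : ℕ → Idx p d, (∀ i ∈ S, τ i = τ' i) → (τ ∈ A ↔ τ' ∈ A)

omit [NeZero p] in
theorem DependsOn.eq_preimage {A : Set (ℕ → Idx p d)} {S : Finset ℕ} (h : DependsOn A S) :
    A = (fun (τ : ℕ → Idx p d) (i : S) => τ i) ⁻¹' ((fun τ (i : S) => τ i) '' A) := by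
  ext τ
  constructor
  · exact fun hτ => ⟨τ, hτ, rfl⟩
  · rintro ⟨τ', hτ', he⟩
    exact (h τ' τ fun i hi => congrFun he ⟨i, hi⟩).1 hτ'

theorem iIndepFun_sample : iIndepFun (fun (i : ℕ) (τ : ℕ → Idx p d) => τ i) (sampleMeasure p d) :=
  iIndepFun_infinitePi (P := fun _ : ℕ => uniformOn (Set.univ : Set (Idx p d)))
    (X := fun _ τ => τ) (fun _ => measurable_id)

/-- A set determined by finitely many entries is the preimage of a finite set, so measurability is
automatic and independence of disjoint blocks of coordinates applies. -/
theorem DependsOn.inter {A A' : Set (ℕ → Idx p d)} {S S' : Finset ℕ} (h : DependsOn A S)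
    (h' : DependsOn A' S') (hd : Disjoint S S') :
    sampleMeasure p d (A ∩ A') = sampleMeasure p d A * sampleMeasure p d A' := by
  have hi := iIndepFun_sample (p := p) (d := d).indepFun_finset S S' hd
    (fun i => measurable_pi_apply i)
  rw [h.eq_preimage, h'.eq_preimage]
  exact hi.measure_inter_preimage_eq_mul _ _ (Set.toFinite _).measurableSet
    (Set.toFinite _).measurableSet

/-- Choosing a set of small measure depending on earlier samples. -/
theorem measure_adaptive_le {E : Type*} {S S' : Finset ℕ} (hd : Disjoint S S')
    (ξ : (ℕ → Idx p d) → E) (hξ : ∀ τ τ', (∀ i ∈ S, τ i = τ' i) → ξ τ = ξ τ')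
    (A : E → Set (ℕ → Idx p d)) (hA : ∀ e, DependsOn (A e) S') {ε : ENNReal}
    (hε : ∀ e, sampleMeasure p d (A e) ≤ ε) : sampleMeasure p d {τ | τ ∈ A (ξ τ)} ≤ ε := by
  classical
  set ρ : (ℕ → Idx p d) → (S → Idx p d) := fun τ i => τ i with hρ
  have hρm : Measurable ρ := measurable_pi_lambda _ fun i => measurable_pi_apply _
  -- The earlier samples take finitely many values σ. On each piece ξ is constant, equal to its
  -- value at σ extended arbitrarily, and the piece is independent of the later samples.
  set ext : (S → Idx p d) → ℕ → Idx p d := fun σ i =>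
    if h : i ∈ S then σ ⟨i, h⟩ else fun _ => 0 with hext
  have hdep : ∀ σ, DependsOn (ρ ⁻¹' {σ}) S := by
    intro σ τ τ' h
    have : ρ τ = ρ τ' := funext fun i => h i i.2
    simp [Set.mem_preimage, this]
  calc sampleMeasure p d {τ | τ ∈ A (ξ τ)}
      ≤ sampleMeasure p d (⋃ σ, ρ ⁻¹' {σ} ∩ A (ξ (ext σ))) := by
        refine measure_mono fun τ hτ => ?_
        rw [Set.mem_iUnion]
        refine ⟨ρ τ, rfl, ?_⟩
        rw [hξ (ext (ρ τ)) τ fun i hi => by simp [hext, hρ, hi]]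
        exact hτ
    _ ≤ ∑ σ, sampleMeasure p d (ρ ⁻¹' {σ} ∩ A (ξ (ext σ))) := measure_iUnion_fintype_le _ _
    _ ≤ ∑ σ, sampleMeasure p d (ρ ⁻¹' {σ}) * ε := by
        refine Finset.sum_le_sum fun σ _ => ?_
        rw [(hdep σ).inter (hA _) hd]
        gcongr
        exact hε _
    _ = ε := by
        rw [← Finset.sum_mul, sum_measure_preimage_singleton _ fun σ _ =>
          hρm (Set.toFinite _).measurableSet]
        simp

/-! #### Chebyshev's inequality for a batch of samples -/

theorem map_sample (i : ℕ) : (sampleMeasure p d).map (fun τ => τ i) =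
    uniformOn (Set.univ : Set (Idx p d)) :=
  Measure.infinitePi_map_eval (fun _ : ℕ => uniformOn (Set.univ : Set (Idx p d))) i

theorem integral_sample (h : Idx p d → ℝ) (i : ℕ) :
    ∫ τ, h (τ i) ∂(sampleMeasure p d) = (∑ t, h t) / (p : ℝ) ^ d := by
  rw [← integral_map (φ := fun τ : ℕ → Idx p d => τ i) (f := h) (measurable_pi_apply i).aemeasurable
    (measurable_of_finite h).aestronglyMeasurable, map_sample, integral_fintype .of_finite,
    Finset.sum_div]
  refine Finset.sum_congr rfl fun t _ => ?_
  rw [Measure.real, uniformOn_univ]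
  simp [div_eq_inv_mul]

/-- Chebyshev's inequality: by independence the variances add up, and each is at most the mean
square. -/
theorem measure_batch_le (h : Idx p d → ℝ) (s : ℕ) {B : ℕ} (hB : 0 < B) {ε : ℝ} (hε : 0 < ε) :
    sampleMeasure p d {τ | ε ≤ |(∑ i ∈ Finset.range B, h (τ (s + i))) / B -
      (∑ t, h t) / (p : ℝ) ^ d|} ≤
      ENNReal.ofReal ((∑ t, h t ^ 2) / (p : ℝ) ^ d / (B * ε ^ 2)) := by
  have hB' : (0 : ℝ) < B := by exact_mod_cast hB
  set Y : ℕ → (ℕ → Idx p d) → ℝ := fun i τ => h (τ (s + i)) with hY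
  have hmeas : ∀ i, Measurable (Y i) := fun i =>
    (measurable_of_finite h).comp (measurable_pi_apply (s + i))
  obtain ⟨C, hC⟩ : ∃ C, ∀ t, ‖h t‖ ≤ C := by
    obtain ⟨C, hC⟩ := (Set.finite_range fun t => ‖h t‖).bddAbove
    exact ⟨C, fun t => hC ⟨t, rfl⟩⟩
  have hLp : ∀ i, MemLp (Y i) 2 (sampleMeasure p d) := fun i =>
    MemLp.of_bound (hmeas i).aestronglyMeasurable C (Filter.Eventually.of_forall fun τ => hC _)
  have hind : ∀ i j, i ≠ j → IndepFun (Y i) (Y j) (sampleMeasure p d) := fun i j hij =>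
    (iIndepFun_sample (p := p) (d := d).indepFun (i := s + i) (j := s + j) (by omega)).comp
      (measurable_of_finite h) (measurable_of_finite h)
  set Z := ∑ i ∈ Finset.range B, Y i with hZ
  have hZval : ∀ τ, Z τ = ∑ i ∈ Finset.range B, h (τ (s + i)) := fun τ => by simp [hZ, hY]
  have hZLp : MemLp Z 2 (sampleMeasure p d) := memLp_finsetSum' _ fun i _ => hLp i
  have hmean : ∫ τ, Z τ ∂(sampleMeasure p d) = B * ((∑ t, h t) / (p : ℝ) ^ d) := by
    simp_rw [hZval]
    rw [integral_finsetSum _ fun i _ => (hLp i).integrable one_le_two]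
    rw [Finset.sum_congr rfl fun i _ => integral_sample h (s + i)]
    simp
  have hvar : variance Z (sampleMeasure p d) ≤ B * ((∑ t, h t ^ 2) / (p : ℝ) ^ d) := by
    rw [hZ, IndepFun.variance_sum (fun i _ => hLp i) fun i _ j _ hij => hind i j hij]
    calc _ ≤ ∑ i ∈ Finset.range B, (∑ t, h t ^ 2) / (p : ℝ) ^ d := by
          refine Finset.sum_le_sum fun i _ => ?_
          refine (variance_le_expectation_sq (hmeas i).aestronglyMeasurable).trans_eq ?_
          exact integral_sample (fun t => h t ^ 2) (s + i)
      _ = _ := by simp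
  refine le_trans (measure_mono fun τ hτ => ?_) ((meas_ge_le_variance_div_sq hZLp
    (mul_pos hB' hε)).trans (ENNReal.ofReal_le_ofReal ?_))
  · rw [Set.mem_ofPred_eq] at hτ ⊢
    rw [hmean, hZval]
    rw [div_sub' hB'.ne', abs_div, abs_of_pos hB', le_div_iff₀ hB'] at hτ
    linarith
  · calc variance Z (sampleMeasure p d) / (B * ε) ^ 2
        ≤ B * ((∑ t, h t ^ 2) / (p : ℝ) ^ d) / (B * ε) ^ 2 := by gcongr
      _ = _ := by field_simp

omit [NeZero p] in
theorem est_eq_re_im (w : Idx p d → ℂ) (τ : ℕ → Idx p d) (s B : ℕ) (f : Idx p d) :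
    (est w τ s B f).re = (∑ i ∈ Finset.range B, (fun t => (w t * chi f t *
      (Real.sqrt ((p : ℝ) ^ d) : ℂ)).re) (τ (s + i))) / B ∧
    (est w τ s B f).im = (∑ i ∈ Finset.range B, (fun t => (w t * chi f t *
      (Real.sqrt ((p : ℝ) ^ d) : ℂ)).im) (τ (s + i))) / B := by
  rw [est, Finset.sum_mul]
  simp only [← Complex.re_sum, ← Complex.im_sum]
  rw [← Complex.ofReal_natCast, Complex.div_ofReal_re, Complex.div_ofReal_im]
  exact ⟨rfl, rfl⟩

/-- The estimate is an average of independent copies of w χ_f √n with t uniform; its mean is `dft w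
f` and its mean square is the square sum of w. Real and imaginary parts are allowed ε/2 each, whence
the factor 4. -/
theorem measure_est_le (w : Idx p d → ℂ) (s : ℕ) {B : ℕ} (hB : 0 < B) {ε : ℝ} (hε : 0 < ε)
    (f : Idx p d) :
    sampleMeasure p d {τ | ε < ‖est w τ s B f - dft w f‖} ≤
      ENNReal.ofReal (4 * (∑ t, ‖w t‖ ^ 2) / (B * ε ^ 2)) := by
  have hB' : (0 : ℝ) < B := by exact_mod_cast hB
  have hp : (0 : ℝ) < (p : ℝ) ^ d := by
    have : 0 < (p : ℝ) := by exact_mod_cast NeZero.pos p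
    positivity
  have hs := sqrt_card_ne_zero (p := p) d
  set z : Idx p d → ℂ := fun t => w t * chi f t * (Real.sqrt ((p : ℝ) ^ d) : ℂ) with hz
  have hmean : dft w f = (∑ t, z t) / ((p : ℝ) ^ d : ℝ) := by
    rw [dft_eq, dftU, hz, ← Finset.sum_mul]
    have := sqrt_mul_self_card p d
    push_cast at this ⊢
    rw [← this]
    field_simp
  have hre : (dft w f).re = (∑ t, (z t).re) / (p : ℝ) ^ d := by
    rw [hmean, Complex.div_ofReal_re, Complex.re_sum]
  have him : (dft w f).im = (∑ t, (z t).im) / (p : ℝ) ^ d := by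
    rw [hmean, Complex.div_ofReal_im, Complex.im_sum]
  have h1 := measure_batch_le (fun t => (z t).re) s hB (half_pos hε)
  have h2 := measure_batch_le (fun t => (z t).im) s hB (half_pos hε)
  have hz2 : ∀ t, (z t).re ^ 2 + (z t).im ^ 2 = ‖w t‖ ^ 2 * (p : ℝ) ^ d := by
    intro t
    rw [show (z t).re ^ 2 + (z t).im ^ 2 = ‖z t‖ ^ 2 by
      rw [Complex.sq_norm, Complex.normSq_apply]; ring, hz]
    simp only [norm_mul, norm_chi, Complex.norm_real, Real.norm_eq_abs, mul_one]
    rw [mul_pow, sq_abs, Real.sq_sqrt hp.le]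
  calc _ ≤ sampleMeasure p d ({τ | ε / 2 ≤ |(∑ i ∈ Finset.range B, (z (τ (s + i))).re) / B -
          (∑ t, (z t).re) / (p : ℝ) ^ d|} ∪ {τ | ε / 2 ≤
          |(∑ i ∈ Finset.range B, (z (τ (s + i))).im) / B - (∑ t, (z t).im) / (p : ℝ) ^ d|}) := by
        refine measure_mono fun τ hτ => ?_
        rw [Set.mem_ofPred_eq] at hτ
        by_contra hc
        simp only [Set.mem_union, Set.mem_ofPred_eq, not_or, not_le] at hc
        obtain ⟨e1, e2⟩ := est_eq_re_im w τ s B f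
        have h3 := Complex.norm_le_abs_re_add_abs_im (est w τ s B f - dft w f)
        rw [Complex.sub_re, Complex.sub_im, e1, e2, hre, him] at h3
        linarith [hc.1, hc.2]
    _ ≤ _ := measure_union_le _ _
    _ ≤ _ := add_le_add h1 h2
    _ = _ := by
        rw [← ENNReal.ofReal_add (by positivity) (by positivity), ← add_div, ← add_div,
          ← Finset.sum_add_distrib]
        simp_rw [hz2]
        rw [← Finset.sum_mul]
        congr 1
        field_simp
        ring

/-! #### Most batches are good -/

omit [NeZero p] in
theorem est_congr (w : Idx p d → ℂ) {τ τ' : ℕ → Idx p d} {s B : ℕ}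
    (h : ∀ i ∈ Finset.Ico s (s + B), τ i = τ' i) (f : Idx p d) : est w τ s B f = est w τ' s B f := by
  rw [est, est]
  congr 2
  refine Finset.sum_congr rfl fun i hi => ?_
  rw [h (s + i) (by have := Finset.mem_range.1 hi; rw [Finset.mem_Ico]; omega)]

theorem measure_biInter_le {A : ℕ → Set (ℕ → Idx p d)} {s B : ℕ}
    (hA : ∀ r, DependsOn (A r) (Finset.Ico (s + r * B) (s + r * B + B))) {q : ENNReal}
    (hq : ∀ r, sampleMeasure p d (A r) ≤ q) (D : Finset ℕ) :
    sampleMeasure p d (⋂ r ∈ D, A r) ≤ q ^ D.card := by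
  classical
  induction D using Finset.induction_on with
  | empty => simp
  | insert r D hr ih =>
    have hdep : DependsOn (⋂ r ∈ D, A r)
        (D.biUnion fun r => Finset.Ico (s + r * B) (s + r * B + B)) := by
      intro τ τ' h
      simp only [Set.mem_iInter]
      refine forall₂_congr fun r hr => hA r τ τ' fun i hi => h i ?_
      exact Finset.mem_biUnion.2 ⟨r, hr, hi⟩
    rw [Finset.set_biInter_insert, (hA r).inter hdep, Finset.card_insert_of_notMem hr, pow_succ']
    · exact mul_le_mul' (hq r) ih
    · rw [Finset.disjoint_biUnion_right]
      intro r' hr'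
      rw [Finset.disjoint_left]
      intro i hi hi'
      rw [Finset.mem_Ico] at hi hi'
      have hne : r ≠ r' := fun h => hr (h ▸ hr')
      rcases lt_or_gt_of_ne hne with h | h
      · have : (r + 1) * B ≤ r' * B := Nat.mul_le_mul_right _ h
        have h' : (r + 1) * B = r * B + B := by ring
        omega
      · have : (r' + 1) * B ≤ r * B := Nat.mul_le_mul_right _ h
        have h' : (r' + 1) * B = r' * B + B := by ring
        omega

variable {x : Idx p d → ℂ} {R B : ℕ}

omit [NeZero p] in
theorem dependsOn_badAt (X : Idx p d → ℂ) (a : ℝ) (e : Idx p d → ℂ) (s : ℕ) (f : Idx p d) :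
    DependsOn {τ | BadAt x X R B a e s f τ} (Finset.Ico s (s + R * B)) := by
  classical
  intro τ τ' h
  simp only [Set.mem_ofPred_eq, BadAt]
  have : ∀ r ∈ Finset.range R, est (fun t => x t - invDft e t) τ (s + r * B) B f =
      est (fun t => x t - invDft e t) τ' (s + r * B) B f := by
    intro r hr
    refine est_congr _ (fun i hi => h i ?_) f
    rw [Finset.mem_range] at hr
    rw [Finset.mem_Ico] at hi ⊢
    have : (r + 1) * B ≤ R * B := Nat.mul_le_mul_right _ hr
    have h' : (r + 1) * B = r * B + B := by ring
    omega
  rw [Finset.filter_congr fun r hr => by rw [this r hr]]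

/-- For a fixed e, a batch fails with probability at most 1/16. If half of the batches fail, some
set D of at least R/2 batches fails entirely, which has probability at most 2^(-2R) by independence;
there are at most 2^R sets D. -/
theorem measure_badAt_le {k : ℕ} {a μ : ℝ} {e : Idx p d → ℂ} (hk : 0 < k)
    (hX : SmallTail (dft x) k μ) (hμ : 0 < μ) (ha : μ ≤ a) (he : Approx (dft x) μ a e)
    (hB : 4194304 * k ≤ B) (s : ℕ) (f : Idx p d) :
    sampleMeasure p d {τ | BadAt x (dft x) R B a e s f τ} ≤ (2⁻¹ : ENNReal) ^ R := by
  classical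
  have ha0 : 0 < a := by linarith
  have hk' : (0 : ℝ) < k := by exact_mod_cast hk
  have hB0 : 0 < B := by omega
  have hB' : (4194304 * k : ℝ) ≤ B := by exact_mod_cast hB
  set w : Idx p d → ℂ := fun t => x t - invDft e t with hw
  have hdw : ∀ f, dft w f = dft x f - e f := fun f => by rw [hw, dft_sub, dft_invDft]
  set A : ℕ → Set (ℕ → Idx p d) := fun r =>
    {τ | a / 24 < ‖est w τ (s + r * B) B f - (dft x f - e f)‖} with hA
  have hdep : ∀ r, DependsOn (A r) (Finset.Ico (s + r * B) (s + r * B + B)) := by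
    intro r τ τ' h
    simp only [hA, Set.mem_ofPred_eq, est_congr w h f]
  have hq : ∀ r, sampleMeasure p d (A r) ≤ (2⁻¹ : ENNReal) ^ 4 := by
    intro r
    have h1 := measure_est_le w (s + r * B) hB0 (show 0 < a / 24 by positivity) f
    rw [hdw] at h1
    refine h1.trans ?_
    have h2 : ∑ t, ‖w t‖ ^ 2 ≤ 67 * k * a ^ 2 := by
      rw [← sum_norm_sq_dft]
      simp_rw [hdw]
      exact he.sum_le hX hμ ha
    have h3 : (2⁻¹ : ENNReal) ^ 4 = ENNReal.ofReal ((2⁻¹ : ℝ) ^ 4) := by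
      rw [ENNReal.ofReal_pow (by norm_num), ENNReal.ofReal_inv_of_pos (by norm_num)]; simp
    rw [h3]
    refine ENNReal.ofReal_le_ofReal ?_
    rw [div_le_iff₀ (by positivity)]
    -- The bound of the second moment gives 4·67·24² k/B = 154368 k/B, and 16·154368 < 2²².
    have h4 : 4194304 * k * a ^ 2 ≤ B * a ^ 2 := by gcongr
    have h5 : 0 < k * a ^ 2 := by positivity
    nlinarith
  calc _ ≤ sampleMeasure p d (⋃ D ∈ (Finset.range R).powerset.filter (fun D => R ≤ 2 * D.card),
        ⋂ r ∈ D, A r) := by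
        refine measure_mono fun τ hτ => ?_
        simp only [Set.mem_iUnion, Set.mem_iInter]
        exact ⟨_, Finset.mem_filter.2 ⟨Finset.mem_powerset.2 (Finset.filter_subset _ _), hτ⟩,
          fun r hr => (Finset.mem_filter.1 hr).2⟩
    _ ≤ ∑ D ∈ (Finset.range R).powerset.filter (fun D => R ≤ 2 * D.card),
        sampleMeasure p d (⋂ r ∈ D, A r) := measure_biUnion_finset_le _ _
    _ ≤ ∑ D ∈ (Finset.range R).powerset.filter (fun D => R ≤ 2 * D.card),
        (2⁻¹ : ENNReal) ^ (2 * R) := by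
        refine Finset.sum_le_sum fun D hD => ?_
        refine (measure_biInter_le hdep hq D).trans ?_
        rw [← pow_mul]
        have := (Finset.mem_filter.1 hD).2
        exact pow_le_pow_right_of_le_one' (by norm_num) (by omega)
    _ ≤ 2 ^ R * (2⁻¹ : ENNReal) ^ (2 * R) := by
        rw [Finset.sum_const, nsmul_eq_mul]
        gcongr
        have := Finset.card_filter_le (Finset.range R).powerset (fun D => R ≤ 2 * D.card)
        rw [Finset.card_powerset, Finset.card_range] at this
        exact_mod_cast this
    _ = (2⁻¹ : ENNReal) ^ R := by
        rw [two_mul, pow_add, ← mul_assoc, ← mul_pow, ENNReal.mul_inv_cancel (by norm_num)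
          (by norm_num), one_pow, one_mul]

omit [NeZero p] in
theorem stepFn_congr {τ τ' : ℕ → Idx p d} {s : ℕ} (a : ℝ) (e : Idx p d → ℂ)
    (h : ∀ i ∈ Finset.Ico s (s + R * B), τ i = τ' i) :
    stepFn x τ R B s a e = stepFn x τ' R B s a e := by
  have hpick : ∀ (θ : ℝ) (v v' : ℕ → ℂ), (∀ r < R, v r = v' r) → ∀ i ≤ R,
      pick R θ v i = pick R θ v' i := by
    intro θ v v' hv i
    induction i with
    | zero => intro _; rfl
    | succ i ih =>
      intro hi
      rw [pick, pick, ih (by omega), hv i hi]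
      rw [Finset.filter_congr fun r hr => by rw [hv r (Finset.mem_range.1 hr)]]
  funext f
  simp only [stepFn]
  rw [hpick _ _ (fun r => est (fun t => x t - invDft e t) τ' (s + r * B) B f) (fun r hr => ?_) R
    le_rfl]
  refine est_congr _ (fun i hi => h i ?_) f
  rw [Finset.mem_Ico] at hi ⊢
  have : (r + 1) * B ≤ R * B := Nat.mul_le_mul_right _ hr
  have h' : (r + 1) * B = r * B + B := by ring
  omega

omit [NeZero p] in
theorem runSteps_congr {τ τ' : ℕ → Idx p d} (a : ℝ) (e : Idx p d → ℂ) {h : ℕ}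
    (hτ : ∀ i ∈ Finset.range (h * (R * B)), τ i = τ' i) :
    runSteps x τ R B a e h = runSteps x τ' R B a e h := by
  induction h with
  | zero => rfl
  | succ h ih =>
    have h1 : (h + 1) * (R * B) = h * (R * B) + R * B := by ring
    rw [runSteps, runSteps, ih fun i hi => hτ i (by rw [Finset.mem_range] at hi ⊢; omega)]
    exact stepFn_congr _ _ fun i hi => hτ i (by rw [Finset.mem_Ico] at hi; rw [Finset.mem_range]; omega)

/-- Only the initial vector must be independent of the samples: the vector before step h depends on
the earlier blocks, and step h reads a disjoint one. -/
theorem measure_badRun_le {k H : ℕ} {a μ : ℝ} (hk : 0 < k) (hX : SmallTail (dft x) k μ)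
    (hμ : 0 < μ) (hB : 4194304 * k ≤ B) (e : Idx p d → ℂ) :
    sampleMeasure p d {τ | BadRun x (dft x) R B H a μ e τ} ≤
      H * ((p ^ d : ℕ) * (2⁻¹ : ENNReal) ^ R) := by
  classical
  -- The accuracy of e' is made part of the event, which is empty for inaccurate e'. So one bound
  -- holds for all values of the adaptive vector.
  set A : ℕ → Idx p d → (Idx p d → ℂ) → Set (ℕ → Idx p d) := fun h f e' =>
    {τ | μ ≤ a / 2 ^ h ∧ Approx (dft x) μ (a / 2 ^ h) e' ∧
      BadAt x (dft x) R B (a / 2 ^ h) e' (h * (R * B)) f τ} with hA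
  have h1 : ∀ h f, sampleMeasure p d {τ | τ ∈ A h f (runSteps x τ R B a e h)} ≤
      (2⁻¹ : ENNReal) ^ R := by
    intro h f
    refine measure_adaptive_le (S := Finset.range (h * (R * B)))
      (S' := Finset.Ico (h * (R * B)) (h * (R * B) + R * B)) ?_
      (fun τ => runSteps x τ R B a e h) (fun τ τ' hτ => runSteps_congr a e hτ) (A h f) ?_ ?_
    · rw [Finset.disjoint_left]
      intro i hi hi'
      rw [Finset.mem_range] at hi
      rw [Finset.mem_Ico] at hi'
      omega
    · intro e' τ τ' hτ
      have := dependsOn_badAt (x := x) (R := R) (B := B) (dft x) (a / 2 ^ h) e' (h * (R * B)) f τ τ' hτ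
      simp only [Set.mem_ofPred_eq] at this
      simp only [hA, Set.mem_ofPred_eq, this]
    · intro e'
      by_cases hc : μ ≤ a / 2 ^ h ∧ Approx (dft x) μ (a / 2 ^ h) e'
      · exact (measure_mono fun τ hτ => hτ.2.2).trans
          (measure_badAt_le hk hX hμ hc.1 hc.2 hB (h * (R * B)) f)
      · have : A h f e' = ∅ := by
          ext τ
          simp only [hA, Set.mem_ofPred_eq, Set.mem_empty_iff_false, iff_false]
          exact fun h => hc ⟨h.1, h.2.1⟩
        simp [this]
  calc _ ≤ sampleMeasure p d (⋃ h ∈ Finset.range H, ⋃ f : Idx p d,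
        {τ | τ ∈ A h f (runSteps x τ R B a e h)}) := by
        refine measure_mono ?_
        rintro τ ⟨h, hh, g1, g2, f, g3⟩
        simp only [Set.mem_iUnion]
        exact ⟨h, Finset.mem_range.2 hh, f, g1, g2, g3⟩
    _ ≤ ∑ h ∈ Finset.range H, sampleMeasure p d (⋃ f : Idx p d,
        {τ | τ ∈ A h f (runSteps x τ R B a e h)}) := measure_biUnion_finset_le _ _
    _ ≤ ∑ h ∈ Finset.range H, ∑ f : Idx p d, (2⁻¹ : ENNReal) ^ R := by
        refine Finset.sum_le_sum fun h _ => (measure_iUnion_fintype_le _ _).trans ?_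
        exact Finset.sum_le_sum fun f _ => h1 h f
    _ = _ := by simp

end Samples

end SparseFourier

namespace SparseFourier

/-! ### Setting up parameters -/

notation "iA" => (70 : ℕ)
notation "tA" => (71 : ℕ)
notation "nLg" => (72 : ℕ)
notation "nH" => (73 : ℕ)
notation "nTot" => (74 : ℕ)
notation "nRB" => (75 : ℕ)
notation "eIt" => (76 : ℕ)
notation "nL" => (77 : ℕ)
notation "nE" => (78 : ℕ)
notation "cNz" => (79 : ℕ)
notation "nLim" => (80 : ℕ)
notation "iB" => (81 : ℕ)
notation "cTri" => (82 : ℕ)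
notation "vPow" => (30 : ℕ)
notation "vSig" => (31 : ℕ)

open NExp Prog

/-- Register `c` receives the product of registers `a` and `b`. -/
def mulProg (c a b i : ℕ) : Prog :=
  .seq (asg c (.lit 0)) (.for i b (asg c (.add (reg c) (reg a))))

/-- Register `pw` receives the least power of two that is at least register `bd`, and `c` its
exponent. -/
def clogProg (c pw bd : ℕ) : Prog :=
  .seq (asg c (.lit 0)) (.seq (asg pw (.lit 1))
    (.loop (.not (.nle (reg bd) (reg pw)))
      (.seq (asg pw (.add (reg pw) (reg pw))) (asg c (.add (reg c) (.lit 1))))))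

/-- `n = p ^ d` and `p ^ (d - 1)`. -/
def powProg : Prog :=
  .seq (asg nN (.lit 1)) (.for iB nD (.seq (asg nQ (reg nN)) (mulProg nN nQ nP iA)))

section Basic

variable {p' d' : ℕ} {x : Idx p' d' → ℂ} {ω : Tape p' d'} {m : Mem}

theorem mulProg_spec {c a b i u w : ℕ} (ha : m.n a 0 = u) (hb : m.n b 0 = w) (hca : a ≠ c)
    (hcb : b ≠ c) (hic : i ≠ c) (hia : a ≠ i) (hib : b ≠ i) :
    Tri x ω (mulProg c a b i) m (w * 25 + 20) fun m' => m'.n c 0 = w * u := by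
  apply Tri.le
  · apply Tri.seq
    apply Tri.setN
    refine Tri.for (T := 7) (fun j m' => m'.n c 0 = j * u) (N := w) (by simp [hcb, hb])
      (by simpa [Prog.wN] using hic) (by simpa [Prog.wN] using hcb) hib (by simp [hic.symm]) ?_ (fun m' h _ => h)
    intro j hj m' hI hj' hF
    refine (Tri.setN ?_).le (by simp [NExp.cost])
    have : m'.n a = m.n a := by
      rw [hF.n _ (by simp [Prog.wN_for, Prog.wN, hia, hca])]; simp [hca]
    simp [hic.symm, hI, this, ha]; ring
  · simp [NExp.cost]; omega

theorem clogProg_spec {c pw bd v : ℕ} (hv : m.n bd 0 = v) (h1 : bd ≠ c) (h2 : bd ≠ pw)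
    (h3 : c ≠ pw) :
    Tri x ω (clogProg c pw bd) m (Nat.clog 2 v * 25 + 20) fun m' =>
      m'.n c 0 = Nat.clog 2 v ∧ m'.n pw 0 = 2 ^ Nat.clog 2 v := by
  apply Tri.le
  · apply Tri.seq
    apply Tri.setN
    apply Tri.seq
    apply Tri.setN
    refine Tri.loop (T := 16) (fun j m' => m'.n c 0 = j ∧ m'.n pw 0 = 2 ^ j) (Nat.clog 2 v)
      (by simp [h3]) ?_ ?_
    · intro j hj m' hI hF
      have hbd : m'.n bd = m.n bd := by
        rw [hF.n _ (by simp [Prog.wN, h1, h2])]; simp [h1, h2]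
      refine ⟨?_, ?_⟩
      · simp only [BExp.ev_not, BExp.ev_nle, ev_get, ev_lit, hbd, hv, hI.2, not_le]
        exact (Nat.lt_clog_iff_pow_lt one_lt_two).1 hj
      · refine Tri.le (Tri.seq (Tri.setN (Tri.setN ⟨?_, ?_⟩))) (by simp [NExp.cost])
        · simp [h3, hI.1]
        · simp [h3.symm, hI.2, pow_succ, mul_two]
    · intro m' hI hF
      have hbd : m'.n bd = m.n bd := by
        rw [hF.n _ (by simp [Prog.wN, h1, h2])]; simp [h1, h2]
      refine ⟨?_, hI⟩
      simp only [BExp.ev_not, BExp.ev_nle, ev_get, ev_lit, hbd, hv, hI.2, not_not]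
      exact Nat.le_pow_clog one_lt_two _
  · simp [NExp.cost, BExp.cost]; omega

theorem powProg_spec {p d : ℕ} (h1 : m.n nP 0 = p) (h2 : m.n nD 0 = d) :
    Tri x ω powProg m (d * (p * 25 + 50) + 20) fun m' =>
      m'.n nN 0 = p ^ d ∧ (0 < d → m'.n nQ 0 = p ^ (d - 1)) := by
  apply Tri.le
  · apply Tri.seq
    apply Tri.setN
    refine Tri.for (T := p * 25 + 25) (fun j m' => m'.n nN 0 = p ^ j ∧
      (0 < j → m'.n nQ 0 = p ^ (j - 1))) (N := d) (by simpa using h2) (by decide) (by decide) (by decide) (by simp) ?_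
      (fun m' h _ => h)
    intro j hj m' hI hj' hF
    have hp : m'.n nP 0 = p := by rw [hF.n _ (by decide)]; simpa using h1
    apply Tri.le
    · apply Tri.seq
      apply Tri.setN
      refine (mulProg_spec (u := p ^ j) (w := p) (by simpa using hI.1) (by simpa using hp) (by decide)
        (by decide) (by decide) (by decide) (by decide)).imp ?_
      intro m'' h hF'
      have := hF'.n nQ (by decide)
      refine ⟨by simp [h]; ring, fun _ => by simp [this, hI.1]⟩
    · simp [NExp.cost]; omega
  · simp [NExp.cost]; nlinarith

/-- The registers in `ks` have the values prescribed by `f`. -/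
def Regs (f : ℕ → ℕ) (ks : List ℕ) (m : Mem) : Prop := ∀ a ∈ ks, m.n a 0 = f a

variable {f : ℕ → ℕ} {ks : List ℕ} {P P₁ P₂ : Prog} {T₁ T₂ : ℕ} {Q Q' : Mem → Prop}

theorem Regs.frame {m' : Mem} (h : Regs f ks m) (hF : Frame P m m') (hk : ∀ a ∈ ks, a ∉ P.wN) :
    Regs f ks m' := fun a ha => by rw [hF.n a (hk a ha), h a ha]

/-- Sequential composition where the first part computes new registers `rs`. -/
theorem Tri.bindRegs (rs : List ℕ) (h : Regs f ks m)
    (hP : Tri x ω P₁ m T₁ (Regs f rs)) (hk : ∀ a ∈ ks, a ∉ P₁.wN)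
    (hn : ∀ m', Regs f (rs ++ ks) m' → Frame P₁ m m' → Tri x ω P₂ m' T₂ Q) :
    Tri x ω (.seq P₁ P₂) m (T₁ + T₂) Q :=
  Tri.bind hP fun m' hm' hF => hn m' (fun a ha => (List.mem_append.1 ha).elim (hm' a)
    (h.frame hF hk a)) hF

end Basic

/-- The number of samples in an estimate is `4194304 k = 2 ^ 22 k`. -/
def batchSize : ℕ := 4194304

/-- The intended contents of the number registers. -/
def regVal (c p d k r : ℕ) : ℕ :=
  if r = nP then p else if r = nD then d else if r = nK then k else
  if r = nN then p ^ d else if r = nQ then p ^ (d - 1) else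
  if r = nLM then Nat.clog 2 (2 * p) else if r = nM then 2 ^ Nat.clog 2 (2 * p) else
  if r = nOff then Nat.clog 2 (2 * p) * 2 ^ Nat.clog 2 (2 * p) else
  if r = nLg then Nat.clog 2 (p ^ d) else
  if r = nR then (c + 4) * Nat.clog 2 (p ^ d) else
  if r = nB then batchSize * k else
  if r = nLJ then Nat.clog 2 (8 * k + 2) else if r = nJ then 2 ^ Nat.clog 2 (8 * k + 2) else
  if r = nH then Nat.clog 2 (8 * k + 2) + 4 else
  if r = rNN then 2 * p ^ d else
  if r = nRB then (c + 4) * Nat.clog 2 (p ^ d) * (batchSize * k) else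
  if r = nTot then (Nat.clog 2 (8 * k + 2) + 4) * ((c + 4) * Nat.clog 2 (p ^ d) * (batchSize * k)) else
  if r = nLim then 65 * k else 0

/-- Computation of the number registers. -/
def numProg (c : ℕ) : Prog :=
  .seq (asg nP (.get 0 (.lit 0)))
  (.seq (asg nD (.get 0 (.lit 1)))
  (.seq (asg nK (.get 0 (.lit 2)))
  (.seq powProg
  (.seq (.seq (asg tA (.add (reg nP) (reg nP))) (clogProg nLM nM tA))
  (.seq (mulProg nOff nM nLM iA)
  (.seq (clogProg nLg tA nN)
  (.seq (.seq (asg tA (.lit (c + 4))) (mulProg nR nLg tA iA))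
  (.seq (.seq (asg tA (.lit batchSize)) (mulProg nB nK tA iA))
  (.seq (.seq (asg tA (.lit 8)) (.seq (mulProg iB nK tA iA)
    (.seq (asg tA (.add (reg iB) (.lit 2))) (clogProg nLJ nJ tA))))
  (.seq (asg nH (.add (reg nLJ) (.lit 4)))
  (.seq (asg rNN (.add (reg nN) (reg nN)))
  (.seq (mulProg nRB nB nR iA)
  (.seq (mulProg nTot nRB nH iA)
  (.seq (asg tA (.lit 65)) (mulProg nLim nK tA iA)))))))))))))))

/-- A bound for the running time of `numProg`. -/
def numTime (c p d k : ℕ) : ℕ :=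
  d * (p * 25 + 50) + Nat.clog 2 (2 * p) * 50 + Nat.clog 2 (p ^ d) * 25 + (c + 4) * 25 +
    batchSize * 25 + Nat.clog 2 (8 * k + 2) * 50 + (c + 4) * Nat.clog 2 (p ^ d) * 25 + 3000

/-- The registers set by `numProg`. -/
def numRegs : List ℕ :=
  [nP, nD, nK, nN, nQ, nLM, nM, nOff, nR, nB, nLJ, nJ, nH, rNN, nTot, nLim]

section Numbers

variable {p' d' : ℕ} {x : Idx p' d' → ℂ} {ω : Tape p' d'} {m : Mem}

theorem numProg_spec {c p d k : ℕ} (h0 : m.n 0 0 = p) (h1 : m.n 0 1 = d) (h2 : m.n 0 2 = k)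
    (hd : 0 < d) :
    Tri x ω (numProg c) m (numTime c p d k) (Regs (regVal c p d k) numRegs) := by
  have hr : Regs (regVal c p d k) [] m := fun a ha => by simp at ha
  apply Tri.le
  · apply Tri.bindRegs [nP] hr (Tri.setN (by simp [Regs, regVal, h0])) (by simp)
    intro m1 r1 F1
    apply Tri.bindRegs [nD] r1 (Tri.setN (by simp [Regs, regVal, F1.n 0 (by decide), h1])) (by decide)
    intro m2 r2 F2
    apply Tri.bindRegs [nK] r2
      (Tri.setN (by simp [Regs, regVal, F2.n 0 (by decide), F1.n 0 (by decide), h2])) (by decide)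
    intro m3 r3 F3
    apply Tri.bindRegs [nN, nQ] r3 ((powProg_spec (p := p) (d := d) (r3 nP (by decide)) (r3 nD (by decide))).imp
      fun m' h _ => by simpa [Regs, regVal] using ⟨h.1, h.2 hd⟩) (by decide)
    intro m4 r4 F4
    apply Tri.bindRegs [nLM, nM] r4 (Tri.seq (Tri.setN ((clogProg_spec (v := 2 * p)
      (by have := r4 nP (by decide); simp [regVal] at this; simp [this]; omega) (by decide) (by decide) (by decide)).imp
      fun m' h _ => by simpa [Regs, regVal] using h))) (by decide)
    intro m5 r5 F5
    apply Tri.bindRegs [nOff] r5 ((mulProg_spec (r5 nM (by decide)) (r5 nLM (by decide))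
      (by decide) (by decide) (by decide) (by decide) (by decide)).imp
      fun m' h _ => by simpa [Regs, regVal] using h) (by decide)
    intro m6 r6 F6
    apply Tri.bindRegs [nLg] r6 ((clogProg_spec (r6 nN (by decide)) (by decide) (by decide) (by decide)).imp
      fun m' h _ => by simpa [Regs, regVal] using h.1) (by decide)
    intro m7 r7 F7
    apply Tri.bindRegs [nR] r7 (Tri.seq (Tri.setN ((mulProg_spec (w := c + 4)
      (by simpa using r7 nLg (by decide)) (by simp)
      (by decide) (by decide) (by decide) (by decide) (by decide)).imp
      fun m' h _ => by simpa [Regs, regVal] using h))) (by simp [Prog.wN, mulProg, Prog.wN_for])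
    intro m8 r8 F8
    apply Tri.bindRegs [nB] r8 (Tri.seq (Tri.setN ((mulProg_spec (w := batchSize)
      (by simpa using r8 nK (by decide)) (by simp)
      (by decide) (by decide) (by decide) (by decide) (by decide)).imp
      fun m' h _ => by simpa [Regs, regVal] using h))) (by decide)
    intro m9 r9 F9
    apply Tri.bindRegs [nLJ, nJ] r9 (Tri.seq (Tri.setN (Tri.bind (mulProg_spec (w := 8) (u := k)
      (by simpa [regVal] using r9 nK (by decide)) (by simp)
      (by decide) (by decide) (by decide) (by decide) (by decide)) fun m' h _ =>
      Tri.seq (Tri.setN ((clogProg_spec (v := 8 * k + 2) (by simp [h])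
        (by decide) (by decide) (by decide)).imp
      fun m' h _ => by simpa [Regs, regVal] using h))))) (by decide)
    intro m10 r10 F10
    apply Tri.bindRegs [nH] r10 (Tri.setN (by
      have := r10 nLJ (by decide); simp [regVal] at this; simp [Regs, regVal, this])) (by decide)
    intro m11 r11 F11
    apply Tri.bindRegs [rNN] r11 (Tri.setN (by
      have := r11 nN (by decide); simp [regVal] at this; simp [Regs, regVal, this]; omega)) (by decide)
    intro m12 r12 F12
    apply Tri.bindRegs [nRB] r12 ((mulProg_spec (r12 nB (by decide)) (r12 nR (by decide))
      (by decide) (by decide) (by decide) (by decide) (by decide)).imp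
      fun m' h _ => by simpa [Regs, regVal] using h) (by decide)
    intro m13 r13 F13
    apply Tri.bindRegs [nTot] r13 ((mulProg_spec (r13 nRB (by decide)) (r13 nH (by decide))
      (by decide) (by decide) (by decide) (by decide) (by decide)).imp
      fun m' h _ => by simpa [Regs, regVal] using h) (by decide)
    intro m14 r14 F14
    refine Tri.imp (Tri.seq (Tri.setN ((mulProg_spec (w := 65) (u := k)
      (by simpa [regVal] using r14 nK (by decide)) (by simp)
      (by decide) (by decide) (by decide) (by decide) (by decide)).imp
      fun m' h _ => h))) ?_
    intro m15 h F15 a ha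
    by_cases hc : a = nLim
    · subst hc; simpa [regVal] using h
    · have h1 : ∀ a ∈ numRegs, a ≠ nLim → a ∈ [nTot] ++ ([nRB] ++ ([rNN] ++ ([nH] ++ ([nLJ, nJ] ++ ([nB] ++ ([nR] ++ ([nLg] ++ ([nOff] ++ ([nLM, nM] ++ ([nN, nQ] ++ ([nK] ++ ([nD] ++ ([nP] ++ []))))))))))))) := by
        decide
      have h2 : ∀ a ∈ numRegs, a ≠ nLim → a ∉ (Prog.seq (asg tA (.lit 65)) (mulProg nLim nK tA iA)).wN := by decide
      rw [F15.n a (h2 a ha hc)]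
      exact r14 a (h1 a ha hc)
  · simp [NExp.cost, numTime, regVal]
    omega

end Numbers

end SparseFourier

namespace SparseFourier

open NExp Prog

/-! ### Tables, scales and samples -/

/-- Chirps are written to the entries `idx` of the array `A`. -/
def chirpProg (A bd : ℕ) (idx : NExp) : Prog :=
  .seq (asg cTri (.lit 0)) (.for iA bd (.seq (.setV A idx (.rootOfUnity (reg cTri) (reg nP)))
    (asg cTri (.add (reg cTri) (reg iA)))))

/-- The tables used by the transform. -/
def tableProg : Prog :=
  .seq (.seq (asg tA (.lit 1))
    (.for iA nLM (.seq (.setN aPw (reg iA) (reg tA)) (asg tA (.add (reg tA) (reg tA))))))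
  (.seq (chirpProg vW nP (reg iA))
  (.seq (chirpProg vA nM (.sub (reg nM) (reg iA)))
  (.seq (.setV vA (.lit 0) (.ofNat (.lit 1)))
  (.seq fft (.for iA nM (.setV vCh (reg iA) (.get vA (.add (reg nOff) (reg iA)))))))))

/-- The scales. -/
def scaleProg : Prog :=
  .seq (asg nE (.lit 0)) (.seq (asgV vPow (.ofNat (.lit 1)))
  (.seq (.loop (.not (.vle (.add (.get 0 (.lit 1)) (.get 0 (.lit 1))) (.reg vPow)))
    (.seq (asgV vPow (.add (.reg vPow) (.reg vPow))) (asg nE (.add (reg nE) (.lit 1)))))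
  (.seq (asgV vRt (.sqrt (.ofNat (reg nN))))
  (.seq (asgV vTop (.mul (.reg vPow) (.get 0 (.lit 0))))
  (.seq (asgV vSig (.div (.reg vTop) (.ofNat (.lit 2))))
  (asg nL (.sub (reg nE) (reg nH))))))))

/-- The samples. -/
def sampleProg : Prog := .for iA nTot (.sample aT (reg iA) vX (reg iA))

section Spec

variable {p' d' : ℕ} {x : Idx p' d' → ℂ} {ω : Tape p' d'} {m : Mem}

theorem chirpProg_spec {A bd N p : ℕ} {idx : NExp} {ix : ℕ → ℕ} (hN : m.n bd 0 = N)
    (hp : m.n nP 0 = p) (h1 : bd ≠ iA) (h2 : bd ≠ cTri)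
    (hinj : ∀ i j, i < j → j < N → ix i ≠ ix j)
    (hidx : ∀ j < N, ∀ m' : Mem, m'.n iA 0 = j → (∀ a, a ≠ iA → a ≠ cTri → m'.n a = m.n a) →
      idx.ev m' = ix j) :
    Tri x ω (chirpProg A bd idx) m (N * (idx.cost + 30) + 20) fun m' =>
      ∀ j < N, m'.v A (ix j) = chirp p j := by
  apply Tri.le
  · apply Tri.seq
    apply Tri.setN
    refine Tri.for (T := idx.cost + 15) (fun j m' => m'.n cTri 0 = j.choose 2 ∧
      ∀ i < j, m'.v A (ix i) = chirp p i) (N := N) (by simp [h2, hN]) (by simp [Prog.wN])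
      (by simpa [Prog.wN] using h2) h1 (by simp) ?_ (fun m' h _ => h.2)
    intro j hj m' hI hj' hF
    have hn : ∀ a, a ≠ iA → a ≠ cTri → m'.n a = m.n a := fun a ha ha' => by
      rw [hF.n a (by simp [Prog.wN_for, Prog.wN, ha, ha'])]; simp [ha']
    refine (Tri.seq (Tri.setV (Tri.setN ⟨?_, fun i hi => ?_⟩))).le
      (by simp [NExp.cost, VExp.cost])
    · simp [hI.1, hj', Nat.choose_succ_succ' j 1, add_comm]
    · simp only [Mem.setN_v, Mem.setV_v, hidx j hj m' hj' hn]
      rcases Nat.lt_succ_iff_lt_or_eq.1 hi with h | rfl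
      · rw [if_neg (hinj i j h hj), hI.2 i h]
      · simp [hI.1, hn nP (by decide) (by decide), hp, chirp, ru]
  · simp [NExp.cost]; nlinarith

theorem tableProg_spec {c p d k : ℕ} (hr : Regs (regVal c p d k) numRegs m) :
    Tri x ω tableProg m (Nat.clog 2 (2 * p) * (2 ^ Nat.clog 2 (2 * p) * 300) +
        2 ^ Nat.clog 2 (2 * p) * 150 + 200) fun m' =>
      DFTReady p d (Nat.clog 2 (2 * p)) m' := by
  have hM : m.n nM 0 = 2 ^ Nat.clog 2 (2 * p) := hr nM (by decide)
  have hLM : m.n nLM 0 = Nat.clog 2 (2 * p) := hr nLM (by decide)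
  have hP : m.n nP 0 = p := hr nP (by decide)
  have hOff : m.n nOff 0 = Nat.clog 2 (2 * p) * 2 ^ Nat.clog 2 (2 * p) := hr nOff (by decide)
  have h2p : 2 * p ≤ 2 ^ Nat.clog 2 (2 * p) := Nat.le_pow_clog one_lt_two _
  have hlM : Nat.clog 2 (2 * p) ≤ 2 ^ Nat.clog 2 (2 * p) := Nat.lt_two_pow_self.le
  have hMpos : 0 < 2 ^ Nat.clog 2 (2 * p) := by positivity
  obtain ⟨lm, hlm⟩ : ∃ lm, lm = Nat.clog 2 (2 * p) := ⟨_, rfl⟩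
  simp only [← hlm] at hM hLM hOff h2p hlM hMpos ⊢
  apply Tri.le
  · apply Tri.bind (Q' := fun m' => ∀ i < lm, m'.n aPw i = 2 ^ i)
    · apply Tri.seq
      apply Tri.setN
      refine Tri.for (T := 15) (fun j m' => m'.n tA 0 = 2 ^ j ∧ ∀ i < j, m'.n aPw i = 2 ^ i)
        (N := lm) (by simpa using hLM) (by decide) (by decide) (by decide) (by simp) ?_
        (fun m' h _ => h.2)
      intro j hj m' hI hj' hF
      refine (Tri.seq (Tri.setN (Tri.setN ⟨?_, fun i hi => ?_⟩))).le (by simp [NExp.cost])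
      · simp [hI.1, pow_succ, mul_two]
      · simp only [ev_get, ev_lit, hj']
        rw [Mem.setN_n_ne _ _ _ (by decide), Mem.setN_n_ne _ _ _ (by decide), Mem.setN_n]
        rcases Nat.lt_succ_iff_lt_or_eq.1 hi with h | rfl
        · rw [if_neg (by omega), hI.2 i h]
        · simp [hI.1]
    intro m1 h1 F1
    apply Tri.bind (chirpProg_spec (p := p) (ix := fun j => j) (N := p)
      (by rw [F1.n _ (by decide), hP]) (by rw [F1.n _ (by decide), hP]) (by decide) (by decide)
      (fun i j h _ => h.ne) (fun j _ m' h _ => by simpa using h))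
    intro m2 h2 F2
    apply Tri.bind (chirpProg_spec (p := p) (ix := fun j => 2 ^ lm - j) (N := 2 ^ lm)
      (by rw [F2.n _ (by decide), F1.n _ (by decide), hM])
      (by rw [F2.n _ (by decide), F1.n _ (by decide), hP]) (by decide) (by decide)
      (fun i j h hj => by omega) (fun j _ m' h hn => by
        simp [h, hn nM (by decide) (by decide), F2.n nM (by decide), F1.n nM (by decide), hM]))
    intro m3 h3 F3
    apply Tri.seq
    apply Tri.setV
    have hn3 : ∀ a, a ≠ iA → a ≠ cTri → a ≠ tA → a ≠ aPw → m3.n a = m.n a := fun a g1 g2 g3 g4 => by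
      rw [F3.n a (by simp [chirpProg, Prog.wN_for, Prog.wN, g1, g2]),
        F2.n a (by simp [chirpProg, Prog.wN_for, Prog.wN, g1, g2]),
        F1.n a (by simp [Prog.wN_for, Prog.wN, g1, g3, g4])]
    have hpw : ∀ i < lm, m3.n aPw i = 2 ^ i := fun i hi => by
      rw [F3.n _ (by decide), F2.n _ (by decide), h1 i hi]
    -- Writing chirp j at entry 2^lm - j for j < 2^lm fills the entries 1, …, 2^lm. Entry 0 is
    -- missed and was set to 1 separately.
    have hrev : ∀ q < 2 ^ lm, (m3.setV vA 0 1).v vA q = revChirp p (2 ^ lm) q := by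
      intro q hq
      rw [Mem.setV_v, revChirp]
      split_ifs with h0
      · rfl
      · have := h3 (2 ^ lm - q) (by omega)
        rwa [show 2 ^ lm - (2 ^ lm - q) = q by omega] at this
    simp only [ev_lit, VExp.ev_ofNat, Nat.cast_one]
    apply Tri.bind (fft_spec (lm := lm) ⟨?_, ?_, ?_⟩)
    · intro m4 h4 F4
      have hn4 : ∀ a, a ≠ iA → a ≠ cTri → a ≠ tA → a ≠ aPw → a ∉ fft.wN → m4.n a = m.n a :=
        fun a g1 g2 g3 g4 g5 => by rw [F4.n a g5, Mem.setV_n, hn3 a g1 g2 g3 g4]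
      refine (Tri.fill 0 (fun j => revChirpHat p (2 ^ lm) j) (N := 2 ^ lm)
        (by rw [hn4 _ (by decide) (by decide) (by decide) (by decide) (by decide), hM])
        (by decide) ?_).imp ?_
      · intro q hq m' hq' hn hv _ _
        refine ⟨by simp [hq'], ?_⟩
        simp only [VExp.ev_get, ev_add, ev_get, ev_lit, hq', hn nOff (by decide),
          hn4 nOff (by decide) (by decide) (by decide) (by decide) (by decide), hOff,
          hv vA (by decide), h4 q hq, revChirpHat]
        exact Finset.sum_congr rfl fun i hi => by rw [hrev i (Finset.mem_range.1 hi)]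
      · intro m5 h5 F5
        have hn5 : ∀ a, a ≠ iA → a ≠ cTri → a ≠ tA → a ≠ aPw → a ∉ fft.wN → m5.n a = m.n a :=
          fun a g1 g2 g3 g4 g5 => by
            rw [F5.n a (by simp [Prog.wN_for, Prog.wN, g1]), hn4 a g1 g2 g3 g4 g5]
        have hn6 : ∀ a ∈ [nP, nD, nN, nQ, nM, nLM, nOff], m5.n a = m.n a := fun a ha => by
          refine hn5 a ?_ ?_ ?_ ?_ ?_ <;> fin_cases ha <;> decide
        constructor
        · refine ⟨?_, ?_, fun i hi => ?_⟩
          · rw [hn6 _ (by decide), hLM]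
          · rw [hn6 _ (by decide), hM]
          · rw [F5.n _ (by decide), F4.n _ (by decide)]; exact hpw i hi
        · exact h2p
        · rw [hn6 _ (by decide), hP]
        · rw [hn6 _ (by decide)]; exact hr nD (by decide)
        · rw [hn6 _ (by decide)]; exact hr nN (by decide)
        · rw [hn6 _ (by decide)]; exact hr nQ (by decide)
        · rw [hn6 _ (by decide), hOff]
        · intro i hi
          rw [F5.v _ (by decide), F4.v _ (by decide), Mem.setV_v_ne _ _ _ (by decide),
            F3.v _ (by decide), h2 i hi]
        · intro j hj
          have := h5.1 j hj
          rwa [zero_add] at this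
    · rw [Mem.setV_n, hn3 _ (by decide) (by decide) (by decide) (by decide), hLM]
    · rw [Mem.setV_n, hn3 _ (by decide) (by decide) (by decide) (by decide), hM]
    · exact hpw
  · simp [NExp.cost, VExp.cost]
    nlinarith

/-- E is the least exponent with 2r ≤ 2^E. When r bounds the ratio of maximum norm to μ, the number
2^E μ/2 bounds every coefficient and serves as the first error bound, for the zero vector. -/
theorem scaleProg_spec {c p d k E : ℕ} {μ r : ℝ} (hr : Regs (regVal c p d k) numRegs m)
    (h0 : m.v 0 0 = (μ : ℂ)) (h1 : m.v 0 1 = (r : ℂ)) (hE : 2 * r ≤ 2 ^ E)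
    (hE' : ∀ e < E, (2 : ℝ) ^ e < 2 * r) :
    Tri x ω scaleProg m (E * 40 + 100) fun m' => m'.n nE 0 = E ∧
      m'.n nL 0 = E - (Nat.clog 2 (8 * k + 2) + 4) ∧
      m'.v vRt 0 = (Real.sqrt ((p : ℝ) ^ d) : ℂ) ∧ m'.v vTop 0 = ((2 ^ E * μ : ℝ) : ℂ) ∧
      m'.v vSig 0 = ((2 ^ E * μ / 2 : ℝ) : ℂ) := by
  apply Tri.le
  · apply Tri.seq
    apply Tri.setN
    apply Tri.seq
    apply Tri.setV
    apply Tri.bind (Q' := fun m' => m'.n nE 0 = E ∧ m'.v vPow 0 = ((2 ^ E : ℝ) : ℂ))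
    · have key : ∀ j m', m'.v vPow 0 = ((2 ^ j : ℝ) : ℂ) → m'.v 0 = m.v 0 →
          ((BExp.not (.vle (.add (.get 0 (.lit 1)) (.get 0 (.lit 1))) (.reg vPow))).ev m' ↔
            (2 : ℝ) ^ j < 2 * r) := by
        intro j m' h h'
        simp only [BExp.ev_not, BExp.ev_vle, VExp.ev_add, VExp.ev_get, ev_lit, h', h1, h,
          Complex.add_re, Complex.ofReal_re, not_le, two_mul]
      refine Tri.loop (T := 20) (fun j m' => m'.n nE 0 = j ∧ m'.v vPow 0 = ((2 ^ j : ℝ) : ℂ)) E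
        (by simp) ?_ ?_
      · intro j hj m' hI hF
        refine ⟨(key j m' hI.2 (by rw [hF.v _ (by decide)]; simp)).2 (hE' j hj), ?_⟩
        refine (Tri.seq (Tri.setV (Tri.setN ⟨?_, ?_⟩))).le (by simp [NExp.cost, VExp.cost])
        · simp [hI.1]
        · simp [hI.2, pow_succ, mul_two]
      · intro m' hI hF
        exact ⟨fun h => absurd hE (not_le.2 ((key E m' hI.2 (by rw [hF.v _ (by decide)]; simp)).1 h)), hI⟩
    intro m1 h1 F1
    have hN : m1.n nN 0 = p ^ d := by
      rw [F1.n _ (by decide)]; simpa [regVal] using hr nN (by decide)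
    have hH : m1.n nH 0 = Nat.clog 2 (8 * k + 2) + 4 := by
      rw [F1.n _ (by decide)]; simpa [regVal] using hr nH (by decide)
    have hμ : m1.v 0 0 = (μ : ℂ) := by
      rw [F1.v _ (by decide)]; simpa using h0
    apply Tri.seq
    apply Tri.setV
    apply Tri.seq
    apply Tri.setV
    apply Tri.seq
    apply Tri.setV
    apply Tri.setN
    refine ⟨?_, ?_, ?_, ?_, ?_⟩
    · simp [h1.1]
    · simp [h1.1, hH]
    · simp [hN, ← Complex.ofReal_natCast, ← Complex.ofReal_pow]
    · simp [h1.2, hμ]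
    · simp [h1.2, hμ]
  · simp [NExp.cost, VExp.cost, BExp.cost]; omega

end Spec

/-- This is the only place where the signal is sampled; all iterations read the stored samples. -/
theorem sampleProg_spec {p d : ℕ} {x : Idx p d → ℂ} {ω : Tape p d} {m : Mem} {tot : ℕ}
    (ht : m.n nTot 0 = tot) (hc : m.c = 0) :
    Tri x ω sampleProg m (tot * 20 + 10) fun m' => m'.c = tot ∧
      ∀ i < tot, m'.n aT i = addr (ω.1 i) ∧ m'.v vX i = x (ω.1 i) := by
  apply Tri.le
  · refine Tri.for (T := 7) (fun j m' => m'.c = j ∧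
      ∀ i < j, m'.n aT i = addr (ω.1 i) ∧ m'.v vX i = x (ω.1 i)) (N := tot) ht (by decide)
      (by decide) (by decide) (by simp [hc]) ?_ (fun m' h _ => h)
    intro j hj m' hI hj' hF
    refine (Tri.sample ⟨?_, fun i hi => ?_⟩).le (by simp [NExp.cost])
    · simp [hI.1]
    · simp only [ev_get, ev_lit, hj', hI.1, Mem.setN_v, Mem.setC_v, Mem.setV_v]
      rw [Mem.setN_n_ne _ _ _ (by decide), Mem.setC_n, Mem.setV_n, Mem.setN_n]
      rcases Nat.lt_succ_iff_lt_or_eq.1 hi with h | rfl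
      · simpa [h.ne] using hI.2 i h
      · simp
  · omega

end SparseFourier

namespace SparseFourier

open NExp Prog

/-! ### The main program -/

/-- The improvement steps of one iteration, followed by rounding to a grid. -/
def iterProg : Prog :=
  .seq (asgV vSc (.reg vSig))
  (.seq (asg eCount (reg nH))
  (.seq stepsProg
  (.seq (asgV vSig (.div (.reg vSig) (.ofNat (.lit 2))))
  (.seq (asgV vG (.div (.reg vSig) (.ofNat (.lit 4))))
  (.seq (asgV vEta (.div (.reg vG) (.ofNat (reg nJ))))
  (.seq (asg rK (.add (reg eIt) (.lit 4)))
  roundProg))))))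

/-- The last improvement steps. -/
def lastProg : Prog :=
  .seq (asgV vSc (.reg vSig)) (.seq (asg eCount (.sub (reg nE) (reg nL))) stepsProg)

/-- The result is copied to the output if it is sparse enough. -/
def outProg : Prog :=
  .seq (.seq (asg cNz (.lit 0)) (.for iA nN
    (.cond (.vle (nsqE (.get vE (reg iA))) (.ofNat (.lit 0))) .skip
      (asg cNz (.add (reg cNz) (.lit 1))))))
  (.cond (.nle (reg cNz) (reg nLim)) (.for iA nN (.setV 1 (reg iA) (.get vE (reg iA)))) .skip)

/-- What the main loop relies on. -/
structure MainReady {p d : ℕ} (x : Idx p d → ℂ) (τ : ℕ → Idx p d) (lm R B b E₀ : ℕ) (μ : ℝ)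
    (m : Mem) : Prop extends EstReady x τ lm R B ((b + 4) * (R * B)) m where
  nn_eq : m.n rNN 0 = 2 * p ^ d
  b_eq : m.n nLJ 0 = b
  J_eq : m.n nJ 0 = 2 ^ b
  H_eq : m.n nH 0 = b + 4
  E_eq : m.n nE 0 = E₀
  L_eq : m.n nL 0 = E₀ - (b + 4)
  top_eq : m.v vTop 0 = ((2 ^ E₀ * μ : ℝ) : ℂ)

/-- The number arrays that `MainReady` depends on. -/
def mainParams : List ℕ :=
  [rNN, nLJ, nJ, nH, nE, nL, nR, nB, aT, nP, nD, nN, nQ, nM, nLM, aPw, nOff]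

theorem MainReady.of_frame {p d : ℕ} {x : Idx p d → ℂ} {τ : ℕ → Idx p d} {lm R B b E₀ : ℕ} {μ : ℝ}
    {m m' : Mem} (h : MainReady x τ lm R B b E₀ μ m)
    (hn : ∀ a ∈ mainParams, m'.n a = m.n a) (hv : ∀ a ∈ [vTop, vW, vCh, vRt, vX], m'.v a = m.v a) :
    MainReady x τ lm R B b E₀ μ m' := by
  constructor
  · exact h.toEstReady.of_frame (fun a ha => hn a (by fin_cases ha <;> decide))
      (fun a ha => hv a (by fin_cases ha <;> decide))
  · rw [hn _ (by decide)]; exact h.nn_eq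
  · rw [hn _ (by decide)]; exact h.b_eq
  · rw [hn _ (by decide)]; exact h.J_eq
  · rw [hn _ (by decide)]; exact h.H_eq
  · rw [hn _ (by decide)]; exact h.E_eq
  · rw [hn _ (by decide)]; exact h.L_eq
  · rw [hv _ (by decide)]; exact h.top_eq

/-- The vectors that rounding can produce at level `E`, and zero. -/
noncomputable def cand {p d : ℕ} (X : Idx p d → ℂ) (μ : ℝ) (b E j : ℕ) : Idx p d → ℂ :=
  fun f => if j < 2 ^ b then rndC (mesh μ E) (mesh μ E / 2 ^ b * j) (X f) else 0

/-- The rounding error is at most 4 · `mesh μ E` = 2^E μ/2, and a nonzero rounded value forces |X f|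
to be at least the mesh, hence at least μ/8. -/
theorem approx_cand {p d : ℕ} {X : Idx p d → ℂ} {μ : ℝ} (hμ : 0 < μ) {b E j : ℕ} (hj : j < 2 ^ b) :
    Approx X μ (2 ^ E * μ / 2) (cand X μ b E j) := by
  have hg : 0 < mesh μ E := by rw [mesh]; positivity
  have h1 : (1 : ℝ) ≤ 2 ^ E := one_le_pow₀ one_le_two
  have hj' : (j : ℝ) ≤ 2 ^ b := by exact_mod_cast hj.le
  have h2 : mesh μ E / 2 ^ b * j ≤ mesh μ E := by
    rw [div_mul_eq_mul_div, div_le_iff₀ (by positivity)]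
    exact mul_le_mul_of_nonneg_left hj' hg.le
  have h3 := approx_rndC (X := X) hg (μ := μ) (by rw [mesh]; nlinarith)
    (show 0 ≤ mesh μ E / 2 ^ b * j by positivity) h2
  have h4 : 4 * mesh μ E = 2 ^ E * μ / 2 := by rw [mesh]; ring
  rw [h4] at h3
  have h5 : cand X μ b E j = fun f => rndC (mesh μ E) (mesh μ E / 2 ^ b * j) (X f) := by
    funext f; rw [cand, if_pos hj]
  rw [h5]; exact h3

/-! ### One iteration, the last steps and the output. -/

section Spec

variable {p d : ℕ} {x : Idx p d → ℂ} {ω : Tape p d} {m : Mem} {lm R B b E₀ k : ℕ} {μ : ℝ}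

theorem abs_parts_lt {z : ℕ → ℂ} {c : ℝ} (h : ∀ f : Idx p d, ‖z (addr f)‖ < c) {q : ℕ}
    (hq : q < 2 * p ^ d) : |parts (p ^ d) z q| < c := by
  rw [parts]
  split_ifs with hlt
  · obtain ⟨f, rfl⟩ := exists_addr hlt
    exact (Complex.abs_re_le_norm _).trans_lt (h f)
  · obtain ⟨f, hf⟩ := exists_addr (show q - p ^ d < p ^ d by omega)
    rw [← hf]
    exact (Complex.abs_im_le_norm _).trans_lt (h f)

/-- The time of one iteration. -/
def iterTime (p d lm R B b it : ℕ) : ℕ :=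
  (b + 4) * (stepTime p d lm R B + 13) + p ^ d * ((it + 4) * 250 + b * 150 + 1500) + 2 ^ b * 100 + 300

/-- b + 4 halvings followed by rounding give up most of the accuracy gained: the error bound only
drops from 2^(E+1) μ/2 to 2^E μ/2. In exchange the new vector belongs to the family `cand`, fixed
before any sample is seen. -/
theorem iterProg_spec (hR : MainReady x ω.1 lm R B b E₀ μ m) (hp : 0 < p) (hd : 0 < d)
    (hX : SmallTail (dft x) k μ) (hμ : 0 < μ) (hb : 8 * k + 1 < 2 ^ b)
    (hE₀ : ∀ f, ‖dft x f‖ ≤ 2 ^ E₀ * μ / 2) {it E : ℕ} (hit : m.n eIt 0 = it)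
    (hE : it + (E + 1) = E₀) (hbE : b + 4 ≤ E) (hs : m.v vSig 0 = ((2 ^ (E + 1) * μ / 2 : ℝ) : ℂ)) :
    Tri x ω iterProg m (iterTime p d lm R B b it) fun m' =>
      m'.v vSig 0 = ((2 ^ E * μ / 2 : ℝ) : ℂ) ∧
      ∀ e : Idx p d → ℂ, (∀ f, m.v vE (addr f) = e f) → Approx (dft x) μ (2 ^ (E + 1) * μ / 2) e →
        ¬ BadRun x (dft x) R B (b + 4) (2 ^ (E + 1) * μ / 2) μ e ω.1 →
        ∃ j < 2 ^ b, ∀ f, m'.v vE (addr f) = cand (dft x) μ b E j f := by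
  have hg : 0 < mesh μ E := by rw [mesh]; positivity
  apply Tri.le
  · apply Tri.seq
    apply Tri.setV
    apply Tri.seq
    apply Tri.setN
    apply Tri.bind (stepsProg_spec (a := 2 ^ (E + 1) * μ / 2) (H := b + 4) (R := R) (B := B)
      (lm := lm) (τ := ω.1) (tot := (b + 4) * (R * B)) ?_ hp hd ?_ le_rfl ?_)
    · intro m1 ⟨h1, h2⟩ F1
      have hR1 : MainReady x ω.1 lm R B b E₀ μ m1 := hR.of_frame
        (fun a ha => (F1.n a (by fin_cases ha <;> decide)).trans (by fin_cases ha <;> simp))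
        (fun a ha => (F1.v a (by fin_cases ha <;> decide)).trans (by fin_cases ha <;> simp))
      have hs1 : m1.v vSig 0 = ((2 ^ (E + 1) * μ / 2 : ℝ) : ℂ) := by
        rw [F1.v _ (by decide)]; simpa using hs
      have hit1 : m1.n eIt 0 = it := by rw [F1.n _ (by decide)]; simpa using hit
      have e1 : ((2 ^ (E + 1) * μ / 2 : ℝ) : ℂ) / ((2 : ℕ) : ℂ) = ((2 ^ E * μ / 2 : ℝ) : ℂ) := by
        push_cast; rw [pow_succ]; ring
      have e2 : ((2 ^ E * μ / 2 : ℝ) : ℂ) / ((4 : ℕ) : ℂ) = ((mesh μ E : ℝ) : ℂ) := by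
        rw [mesh]; push_cast; ring
      have e3 : ((mesh μ E : ℝ) : ℂ) / ((2 ^ b : ℕ) : ℂ) = ((mesh μ E / 2 ^ b : ℝ) : ℂ) := by
        push_cast; ring
      -- The mesh halves with each iteration, so with one more division step per iteration the same
      -- top scale can be used throughout.
      have e4 : mesh μ E * 2 ^ (it + 4) = 2 ^ E₀ * μ := by
        rw [mesh, ← hE]; ring
      apply Tri.seq
      apply Tri.setV
      apply Tri.seq
      apply Tri.setV
      apply Tri.seq
      apply Tri.setV
      apply Tri.seq
      apply Tri.setN
      simp only [ev_lit, VExp.ev_div, VExp.ev_get, hs1, VExp.ev_ofNat, e1, Mem.setV_v_same, e2,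
        ev_get, hR1.J_eq, e3, Mem.setV_n, ev_add, hit1]
      refine (roundProg_spec (n := p ^ d) (K := it + 4) (b := b) (g := mesh μ E) ?_ hg).imp ?_
      · constructor
        · simpa using hR1.n_eq
        · simpa using hR1.nn_eq
        · simp
        · simpa using hR1.b_eq
        · simpa using hR1.J_eq
        · simp
        · simp
        · simpa [e4] using hR1.top_eq
      · intro m2 h3 F2
        refine ⟨by rw [F2.v _ (by decide)]; simp, fun e he ha hgood => ?_⟩
        simp only [Mem.setN_v] at h3
        rw [Mem.setV_v_ne _ _ _ (by decide), Mem.setV_v_ne _ _ _ (by decide),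
          Mem.setV_v_ne _ _ _ (by decide), e4] at h3
        have he' : (fun f => ((m.setV vSc (ev m (lit 0)) (VExp.ev m (.reg vSig))).setN eCount
            (ev (m.setV vSc (ev m (lit 0)) (VExp.ev m (.reg vSig))) (lit 0))
            (ev (m.setV vSc (ev m (lit 0)) (VExp.ev m (.reg vSig))) (reg nH))).v vE (addr f)) = e := by
          funext f; simp [he f]
        rw [he'] at h2
        -- Step i starts from precision 2^E μ/2^i, which is at least μ because i < b + 4 ≤ E.
        have hrun := approx_runSteps hμ ha hgood le_rfl (fun i hi => by
          have : (2 : ℝ) ^ i * 2 ≤ 2 ^ (E + 1) := by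
            rw [← pow_succ]; exact pow_le_pow_right₀ one_le_two (by omega)
          rw [le_div_iff₀ (by positivity)]
          nlinarith)
        have hz : ∀ f, ‖dft x f - m1.v vE (addr f)‖ ≤ 2 ^ E * μ / 2 ^ (b + 4) := fun f => by
          rw [h2 f]
          refine (hrun.le f).trans (le_of_eq ?_)
          rw [pow_succ]; ring
        -- The approximation stays below the top scale, as the long division demands: |X| is at most
        -- half of it and the error is less than the other half.
        have hlt : ∀ f : Idx p d, ‖m1.v vE (addr f)‖ < 2 ^ E₀ * μ := fun f => by
          have a1 := norm_sub_le (dft x f) (dft x f - m1.v vE (addr f))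
          rw [sub_sub_cancel] at a1
          have a2 := hE₀ f
          have a3 := hz f
          have a4 : (2 : ℝ) ^ E * μ / 2 ^ (b + 4) ≤ 2 ^ E * μ / 2 ^ 2 := by
            gcongr
            · norm_num
            · omega
          have a5 : (2 : ℝ) ^ E ≤ 2 ^ E₀ := pow_le_pow_right₀ one_le_two (by omega)
          have a6 : (0 : ℝ) < 2 ^ E₀ := by positivity
          nlinarith
        obtain ⟨j, hj, hvE⟩ := h3 fun q hq => abs_parts_lt hlt hq
        obtain ⟨hj1, hj2⟩ := rndC_eq_of_selected hX hμ hb hbE hz hj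
        refine ⟨j, hj1, fun f => ?_⟩
        rw [cand, if_pos hj1, ← hj2 f, hvE _ (addr_lt f), rndC]
    · exact hR.toEstReady.of_frame (fun a ha => by fin_cases ha <;> simp)
        (fun a ha => by fin_cases ha <;> simp)
    · simpa using hR.H_eq
    · simpa using hs
  · simp [NExp.cost, VExp.cost, iterTime]
    omega

theorem lastProg_spec (hR : MainReady x ω.1 lm R B b E₀ μ m) (hp : 0 < p) (hd : 0 < d)
    (hμ : 0 < μ) {E : ℕ} (hE : E = E₀ - (E₀ - (b + 4)))
    (hs : m.v vSig 0 = ((2 ^ E * μ / 2 : ℝ) : ℂ)) :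
    Tri x ω lastProg m (E * (stepTime p d lm R B + 13) + 40) fun m' =>
      ∀ e : Idx p d → ℂ, (∀ f, m.v vE (addr f) = e f) → Approx (dft x) μ (2 ^ E * μ / 2) e →
        ¬ BadRun x (dft x) R B (b + 4) (2 ^ E * μ / 2) μ e ω.1 →
        Approx (dft x) μ (μ / 2) fun f => m'.v vE (addr f) := by
  apply Tri.le
  · apply Tri.seq
    apply Tri.setV
    apply Tri.seq
    apply Tri.setN
    refine (stepsProg_spec (a := 2 ^ E * μ / 2) (H := E) (R := R) (B := B)
      (lm := lm) (τ := ω.1) (tot := (b + 4) * (R * B)) ?_ hp hd ?_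
      (Nat.mul_le_mul_right _ (by omega)) ?_).imp ?_
    · exact hR.toEstReady.of_frame (fun a ha => by fin_cases ha <;> simp)
        (fun a ha => by fin_cases ha <;> simp)
    · simp [hR.E_eq, hR.L_eq, hE]
    · simpa using hs
    · rintro m1 ⟨-, h2⟩ F1 e he ha hgood
      have he' : (fun f => ((m.setV vSc (ev m (lit 0)) (VExp.ev m (.reg vSig))).setN eCount
          (ev (m.setV vSc (ev m (lit 0)) (VExp.ev m (.reg vSig))) (lit 0))
          (ev (m.setV vSc (ev m (lit 0)) (VExp.ev m (.reg vSig)))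
            (.sub (reg nE) (reg nL)))).v vE (addr f)) = e := by
        funext f; simp [he f]
      rw [he'] at h2
      have hrun := approx_runSteps (h := E) hμ ha hgood (by omega) (fun i hi => by
        have : (2 : ℝ) ^ i * 2 ≤ 2 ^ E := by
          rw [← pow_succ]; exact pow_le_pow_right₀ one_le_two (by omega)
        rw [le_div_iff₀ (by positivity)]
        nlinarith)
      -- Here E = min(E₀, b + 4): as many halvings as remain, and no more than there are blocks of
      -- samples.
      have e1 : 2 ^ E * μ / 2 / 2 ^ E = μ / 2 := by field_simp
      rw [e1] at hrun
      rwa [show (fun f => m1.v vE (addr f)) = _ from funext h2]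
  · simp [NExp.cost, VExp.cost]
    omega

/-- Counting before copying makes sparsity unconditional; a vector that is too dense occurs only on
a failing run and is replaced by zero. -/
theorem outProg_spec (hN : m.n nN 0 = p ^ d) (hL : m.n nLim 0 = 65 * k)
    (h0 : ∀ q, m.v 1 q = 0) :
    Tri x ω outProg m (p ^ d * 80 + 50) fun m' =>
      nnzCount (fun f : Idx p d => m'.v 1 (addr f)) ≤ 65 * k ∧
      (nnzCount (fun f : Idx p d => m.v vE (addr f)) ≤ 65 * k →
        ∀ f : Idx p d, m'.v 1 (addr f) = m.v vE (addr f)) := by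
  classical
  have hcard : nnzCount (fun f : Idx p d => m.v vE (addr f)) =
      ((Finset.range (p ^ d)).filter fun q => m.v vE q ≠ 0).card := by
    rw [nnzCount, ← Set.ncard_image_of_injective _ addr_injective, ← Set.ncard_coe_finset]
    congr 1
    ext q
    simp only [Set.mem_image, Set.mem_ofPred_eq, Finset.coe_filter, Finset.mem_range]
    constructor
    · rintro ⟨f, hf, rfl⟩
      exact ⟨addr_lt f, hf⟩
    · rintro ⟨hq, h⟩
      obtain ⟨f, rfl⟩ := exists_addr hq
      exact ⟨f, h, rfl⟩
  rw [hcard]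
  apply Tri.le
  · apply Tri.bind (Q' := fun m' => m'.n cNz 0 =
      ((Finset.range (p ^ d)).filter fun q => m.v vE q ≠ 0).card)
    · apply Tri.seq
      apply Tri.setN
      refine Tri.for (T := 36) (fun j m' => m'.n cNz 0 =
        ((Finset.range j).filter fun q => m.v vE q ≠ 0).card) (N := p ^ d) (by simpa using hN)
        (by decide) (by decide) (by decide) (by simp) ?_ (fun m' h _ => h)
      intro j hj m' hI hj' hF
      have hv : m'.v vE = m.v vE := by rw [hF.v _ (by decide)]; simp
      have hb : (BExp.vle (nsqE (.get vE (reg iA))) (.ofNat (.lit 0))).ev m' ↔ m.v vE j = 0 := by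
        rw [← Complex.normSq_eq_zero, le_antisymm_iff]
        simp [hj', hv, Complex.normSq_nonneg]
      apply Tri.le
      · refine Tri.cond (T := 6) (fun h => ?_) (fun h => ?_)
        · refine (Tri.skip ?_).le (by simp)
          rw [Finset.range_add_one, Finset.filter_insert, if_neg (by simpa using hb.1 h)]
          simpa using hI
        · refine (Tri.setN ?_).le (by simp [NExp.cost])
          rw [Finset.range_add_one, Finset.filter_insert, if_pos (by rwa [hb] at h),
            Finset.card_insert_of_notMem (by simp)]
          simp [hI]
      · simp [BExp.cost, NExp.cost, VExp.cost, cost_nsqE]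
    intro m1 h1 F1
    have hN1 : m1.n nN 0 = p ^ d := by rw [F1.n _ (by decide), hN]
    have hv1 : m1.v = m.v := by
      funext a; rw [F1.v a (by simp [Prog.wV, Prog.for])]
    refine Tri.cond (T := p ^ d * 25 + 10) (fun hb => ?_) (fun hb => ?_)
    · simp only [BExp.ev_nle, ev_get, ev_lit, h1, F1.n nLim (by decide), hL] at hb
      refine ((Tri.fill 0 (fun q => m.v vE q) hN1 (by decide) ?_).imp ?_).le
        (by simp [NExp.cost, VExp.cost]; omega)
      · intro q hq m' hq' hn hv _ _
        simp [hq', hv, hv1]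
      · rintro m2 ⟨h2, -⟩ F2
        have h3 : ∀ f : Idx p d, m2.v 1 (addr f) = m.v vE (addr f) := fun f => by
          have := h2 _ (addr_lt f)
          rwa [zero_add] at this
        refine ⟨?_, fun _ => h3⟩
        simp only [h3]
        rw [hcard]; exact hb
    · simp only [BExp.ev_nle, ev_get, ev_lit, h1, F1.n nLim (by decide), hL] at hb
      refine (Tri.skip ⟨?_, fun h => absurd h hb⟩).le (by omega)
      simp [nnzCount, hv1, h0]
  · simp [NExp.cost, BExp.cost]; omega

end Spec

end SparseFourier

/-! ### The complete program and its correctness on good tapes. -/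

namespace SparseFourier

open NExp Prog

/-- The complete program; `c` governs the failure probability. -/
def sparseFourierProg (c : ℕ) : Prog :=
  .seq (numProg c) (.seq tableProg (.seq scaleProg (.seq sampleProg
    (.seq (.for eIt nL iterProg) (.seq lastProg outProg)))))

/-- The improvement steps succeed from every vector that can occur. -/
def GoodRun {p d : ℕ} (x : Idx p d → ℂ) (R B b E₀ : ℕ) (μ : ℝ) (τ : ℕ → Idx p d) : Prop :=
  ∀ E ≤ E₀, ∀ j ≤ 2 ^ b,
    ¬ BadRun x (dft x) R B (b + 4) (2 ^ E * μ / 2) μ (cand (dft x) μ b E j) τ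

section MainLoop

variable {p d : ℕ} {x : Idx p d → ℂ} {ω : Tape p d} {m : Mem} {lm R B b E₀ k : ℕ} {μ : ℝ}

/-- On a good tape the vector before every iteration is a member of `cand` at the current level, so
`GoodRun` covers the next run of steps. It remains so when the samples are read again. -/
theorem mainLoop_spec (hR : MainReady x ω.1 lm R B b E₀ μ m) (hp : 0 < p) (hd : 0 < d)
    (hX : SmallTail (dft x) k μ) (hμ : 0 < μ) (hb : 8 * k + 1 < 2 ^ b)
    (hE₀ : ∀ f, ‖dft x f‖ ≤ 2 ^ E₀ * μ / 2)
    (hs : m.v vSig 0 = ((2 ^ E₀ * μ / 2 : ℝ) : ℂ)) (h0 : ∀ q, m.v vE q = 0) :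
    Tri x ω (.for eIt nL iterProg) m (E₀ * (iterTime p d lm R B b E₀ + 13) + 10) fun m' =>
      MainReady x ω.1 lm R B b E₀ μ m' ∧
      m'.v vSig 0 = ((2 ^ (E₀ - (E₀ - (b + 4))) * μ / 2 : ℝ) : ℂ) ∧
      (GoodRun x R B b E₀ μ ω.1 → ∃ j ≤ 2 ^ b,
        (∀ f, m'.v vE (addr f) = cand (dft x) μ b (E₀ - (E₀ - (b + 4))) j f) ∧
        Approx (dft x) μ (2 ^ (E₀ - (E₀ - (b + 4))) * μ / 2)
          (cand (dft x) μ b (E₀ - (E₀ - (b + 4))) j)) := by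
  apply Tri.le
  · refine Tri.for (T := iterTime p d lm R B b E₀) (N := E₀ - (b + 4)) (fun it m' =>
      MainReady x ω.1 lm R B b E₀ μ m' ∧ m'.v vSig 0 = ((2 ^ (E₀ - it) * μ / 2 : ℝ) : ℂ) ∧
      (GoodRun x R B b E₀ μ ω.1 → ∃ j ≤ 2 ^ b,
        (∀ f, m'.v vE (addr f) = cand (dft x) μ b (E₀ - it) j f) ∧
        Approx (dft x) μ (2 ^ (E₀ - it) * μ / 2) (cand (dft x) μ b (E₀ - it) j))) hR.L_eq
      (by decide) (by decide) (by decide) ?_ ?_ (fun m' h _ => h)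
    -- The initial zero vector is the candidate with the dummy index j = 2^b, which is why `GoodRun`
    -- ranges over j ≤ 2^b.
    · refine ⟨hR.of_frame (fun a ha => by fin_cases ha <;> simp) (fun a ha => by simp),
        by simpa using hs, fun _ => ⟨2 ^ b, le_rfl, fun f => by simp [cand, h0], ?_⟩⟩
      have : cand (dft x) μ b (E₀ - 0) (2 ^ b) = 0 := by
        funext f; simp [cand]
      rw [this]
      exact approx_zero hE₀
    · rintro it hit m' ⟨r1, r2, r3⟩ hit' F
      obtain ⟨E, hE⟩ : ∃ E, E₀ - it = E + 1 := ⟨E₀ - it - 1, by omega⟩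
      have hE' : E₀ - (it + 1) = E := by omega
      rw [hE] at r2 r3
      refine ((iterProg_spec r1 hp hd hX hμ hb hE₀ hit' (by omega) (by omega) r2).le ?_).imp ?_
      · simp only [iterTime]; gcongr; omega
      · rintro m'' ⟨g1, g2⟩ F'
        rw [hE']
        refine ⟨r1.of_frame (fun a ha => ?_) (fun a ha => ?_), by simpa using g1, fun hgood => ?_⟩
        · rw [← F'.n a (by fin_cases ha <;> decide)]
          fin_cases ha <;> simp
        · rw [Mem.setN_v, F'.v a (by fin_cases ha <;> decide)]
        · obtain ⟨j, hj, hj1, hj2⟩ := r3 hgood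
          obtain ⟨j', hj', hj3⟩ := g2 _ hj1 hj2 (hgood (E + 1) (by omega) j hj)
          exact ⟨j', hj'.le, by simpa using hj3, approx_cand hμ hj'⟩
  · gcongr; omega

end MainLoop

/-- The memory at the start of a run. -/
noncomputable def startMem (p d k : ℕ) (μ r : ℝ) : Mem :=
  ⟨(initState p d k μ r).nats, (initState p d k μ r).vals, 0⟩

/-- A bound for the running time of the program. -/
def runTime (c p d k E₀ : ℕ) : ℕ :=
  let lm := Nat.clog 2 (2 * p)
  let R := (c + 4) * Nat.clog 2 (p ^ d)
  let B := batchSize * k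
  let b := Nat.clog 2 (8 * k + 2)
  numTime c p d k + (lm * (2 ^ lm * 300) + 2 ^ lm * 150 + 200) + (E₀ * 40 + 100) +
    ((b + 4) * (R * B) * 20 + 10) + (E₀ * (iterTime p d lm R B b E₀ + 13) + 10) +
    ((b + 4) * (stepTime p d lm R B + 13) + 40) + (p ^ d * 80 + 50)

theorem sparseFourierProg_spec {c p d k E₀ : ℕ} {x : Idx p d → ℂ} {ω : Tape p d} {μ r : ℝ}
    (hp : 0 < p) (hd : 0 < d) (hX : SmallTail (dft x) k μ) (hμ : 0 < μ) (hE : 2 * r ≤ 2 ^ E₀)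
    (hE' : ∀ e < E₀, (2 : ℝ) ^ e < 2 * r) (hr : ∀ f, ‖dft x f‖ ≤ r * μ) :
    Tri x ω (sparseFourierProg c) (startMem p d k μ r) (runTime c p d k E₀) fun m' =>
      m'.c = (Nat.clog 2 (8 * k + 2) + 4) * ((c + 4) * Nat.clog 2 (p ^ d) * (batchSize * k)) ∧
      nnzCount (fun f : Idx p d => m'.v 1 (addr f)) ≤ 65 * k ∧
      (GoodRun x ((c + 4) * Nat.clog 2 (p ^ d)) (batchSize * k) (Nat.clog 2 (8 * k + 2)) E₀ μ ω.1 →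
        ∀ f : Idx p d, ‖dft x f - m'.v 1 (addr f)‖ ≤ μ) := by
  have hb : 8 * k + 1 < 2 ^ Nat.clog 2 (8 * k + 2) :=
    lt_of_lt_of_le (by omega) (Nat.le_pow_clog one_lt_two (8 * k + 2))
  have hE₀ : ∀ f, ‖dft x f‖ ≤ 2 ^ E₀ * μ / 2 := fun f => (hr f).trans (by nlinarith)
  apply Tri.le
  · apply Tri.bind (numProg_spec (c := c) (p := p) (d := d) (k := k) rfl rfl rfl hd)
    intro m1 h1 F1
    apply Tri.bind (tableProg_spec h1)
    intro m2 h2 F2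
    have h2' : Regs (regVal c p d k) numRegs m2 := h1.frame F2 (by decide)
    apply Tri.bind (scaleProg_spec (μ := μ) (r := r) h2' ?_ ?_ hE hE')
    · intro m3 ⟨g1, g2, g3, g4, g5⟩ F3
      have h3 := h2'.frame F3 (by decide)
      have hc3 : m3.c = 0 := by
        rw [F3.c (by decide), F2.c (by decide), F1.c (by rfl)]; rfl
      apply Tri.bind (sampleProg_spec (h3 nTot (by decide)) hc3)
      intro m4 ⟨h4, h5⟩ F4
      have h4' := h3.frame F4 (by decide)
      have hR : MainReady x ω.1 (Nat.clog 2 (2 * p)) ((c + 4) * Nat.clog 2 (p ^ d))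
          (batchSize * k) (Nat.clog 2 (8 * k + 2)) E₀ μ m4 := by
        refine ⟨⟨(h2.frame F3 (by decide) (by decide)).frame F4 (by decide) (by decide),
          h4' nR (by decide), h4' nB (by decide), ?_, fun i hi => (h5 i hi).1,
          fun i hi => (h5 i hi).2⟩, h4' rNN (by decide), h4' nLJ (by decide), h4' nJ (by decide),
          h4' nH (by decide), ?_, ?_, ?_⟩
        · rw [F4.v _ (by decide), g3]
        · rw [F4.n _ (by decide), g1]
        · rw [F4.n _ (by decide), g2]
        · rw [F4.v _ (by decide), g4]
      apply Tri.bind (mainLoop_spec hR hp hd hX hμ hb hE₀ ?_ ?_)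
      · intro m5 ⟨r1, r2, r3⟩ F5
        have h5' := h4'.frame F5 (by decide)
        apply Tri.bind ((lastProg_spec r1 hp hd hμ rfl r2).le
          (Nat.add_le_add_right (Nat.mul_le_mul_right _
            (show _ ≤ Nat.clog 2 (8 * k + 2) + 4 by omega)) _))
        intro m6 h6 F6
        have h6' := h5'.frame F6 (by decide)
        refine (outProg_spec (k := k) (h6' nN (by decide)) (h6' nLim (by decide)) ?_).imp ?_
        · intro q
          rw [F6.v _ (by decide), F5.v _ (by decide), F4.v _ (by decide), F3.v _ (by decide),
            F2.v _ (by decide), F1.v _ (by simp [numProg, Prog.wV, powProg, mulProg, clogProg, Prog.for])]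
          simp [startMem, initState]
        · rintro m7 ⟨k1, k2⟩ F7
          refine ⟨?_, k1, fun hgood f => ?_⟩
          · rw [F7.c (by decide), F6.c (by decide), F5.c (by decide), h4]
            rfl
          · obtain ⟨j, hj, hj1, hj2⟩ := r3 hgood
            have ha := h6 _ hj1 hj2 (hgood _ (Nat.sub_le _ _) j hj)
            rw [k2 (ha.nnz_le hX hμ) f]
            exact (ha.le f).trans (by linarith)
      · rw [F4.v _ (by decide), g5]
      · intro q
        rw [F4.v _ (by decide), F3.v _ (by decide),
          F2.v _ (by decide), F1.v _ (by simp [numProg, Prog.wV, powProg, mulProg, clogProg, Prog.for])]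
        simp [startMem, initState]
    · rw [F2.v _ (by decide), F1.v _ (by simp [numProg, Prog.wV, powProg, mulProg, clogProg, Prog.for])]
      simp [startMem, initState]
    · rw [F2.v _ (by decide), F1.v _ (by simp [numProg, Prog.wV, powProg, mulProg, clogProg, Prog.for])]
      simp [startMem, initState]
  · simp only [runTime, regVal]
    simp
    omega

end SparseFourier

namespace SparseFourier

/-! ### Bounds for the parameters -/

theorem two_pow_clog_le {v : ℕ} (hv : 2 ≤ v) : 2 ^ Nat.clog 2 v ≤ 2 * v := by
  have h := Nat.pow_pred_clog_lt_self one_lt_two (show 1 < v by omega)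
  have h1 : 0 < Nat.clog 2 v := Nat.clog_pos one_lt_two hv
  have h2 : 2 ^ Nat.clog 2 v = 2 * 2 ^ (Nat.clog 2 v).pred := by
    rw [← pow_succ', Nat.pred_eq_sub_one, Nat.sub_add_cancel h1]
  omega

/-- 2^⌈log₂ 2p⌉ ≤ 4p, so lowering the exponent by 2 gives at most p; taking d-th powers yields one
multiple of log n, and 2d ≤ 2 log₂ n the other two. -/
theorem mul_clog_le {p d : ℕ} (hp : 2 ≤ p) :
    d * Nat.clog 2 (2 * p) ≤ 3 * Nat.clog 2 (p ^ d) := by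
  have h0 : p ^ d ≤ 2 ^ Nat.clog 2 (p ^ d) := Nat.le_pow_clog one_lt_two _
  have h1 : d ≤ Nat.clog 2 (p ^ d) := by
    refine (Nat.pow_le_pow_iff_right one_lt_two).1 (le_trans ?_ h0)
    exact Nat.pow_le_pow_left hp d
  have h2 : d * (Nat.clog 2 (2 * p) - 2) ≤ Nat.clog 2 (p ^ d) := by
    refine (Nat.pow_le_pow_iff_right one_lt_two).1 (le_trans ?_ h0)
    rw [mul_comm, pow_mul]
    refine Nat.pow_le_pow_left ?_ d
    have h3 := two_pow_clog_le (show 2 ≤ 2 * p by omega)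
    rcases le_or_gt 2 (Nat.clog 2 (2 * p)) with h | h
    · have : 2 ^ Nat.clog 2 (2 * p) = 2 ^ (Nat.clog 2 (2 * p) - 2) * 2 ^ 2 := by
        rw [← pow_add, Nat.sub_add_cancel h]
      omega
    · rw [Nat.sub_eq_zero_of_le h.le]; omega
  have h3 : d * Nat.clog 2 (2 * p) ≤ d * (Nat.clog 2 (2 * p) - 2) + d * 2 := by
    rw [← mul_add]; exact Nat.mul_le_mul_left _ (by omega)
  omega

/-- R + 1 transforms at O(n log n) each, and R² comparisons for each of the n coordinates, with R =
O(c log n). -/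
theorem stepTime_le {c p d k : ℕ} (hp : 2 ≤ p) (hd : 0 < d) (hk : k ≤ p ^ d) :
    stepTime p d (Nat.clog 2 (2 * p)) ((c + 4) * Nat.clog 2 (p ^ d)) (batchSize * k) + 13 ≤
      260000000 * ((c + 5) ^ 2 * (p ^ d * Nat.clog 2 (p ^ d) ^ 2)) := by
  have hn : p ^ d = p ^ (d - 1) * p := by rw [← pow_succ]; congr 1; omega
  have hn2 : 2 ≤ p ^ d := hp.trans (Nat.le_self_pow hd.ne' p)
  have hl : 1 ≤ Nat.clog 2 (p ^ d) := Nat.clog_pos one_lt_two hn2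
  have h1 := mul_clog_le (d := d) hp
  have h2 : 2 ^ Nat.clog 2 (2 * p) ≤ 4 * p := by
    have := two_pow_clog_le (show 2 ≤ 2 * p by omega)
    omega
  have h3 : dftTime p d (Nat.clog 2 (2 * p)) ≤ 11160 * (p ^ d * Nat.clog 2 (p ^ d)) := by
    calc dftTime p d (Nat.clog 2 (2 * p)) =
        (d * Nat.clog 2 (2 * p)) * (p ^ (d - 1) * 2 ^ Nat.clog 2 (2 * p)) * 930 := by
          rw [dftTime]; ring
      _ ≤ (3 * Nat.clog 2 (p ^ d)) * (p ^ (d - 1) * (4 * p)) * 930 := by gcongr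
      _ = 11160 * (p ^ d * Nat.clog 2 (p ^ d)) := by rw [hn]; ring
  rw [stepTime, batchSize]
  obtain ⟨l, hl'⟩ : ∃ l, l = Nat.clog 2 (p ^ d) := ⟨_, rfl⟩
  obtain ⟨n, hn'⟩ : ∃ n, n = p ^ d := ⟨_, rfl⟩
  obtain ⟨F, hF⟩ : ∃ F, F = dftTime p d (Nat.clog 2 (2 * p)) := ⟨_, rfl⟩
  obtain ⟨q, hq⟩ : ∃ q, q = c + 5 := ⟨_, rfl⟩
  rw [← hF, ← hl', ← hn'] at h3
  rw [← hl'] at hl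
  rw [← hn'] at hn2 hk
  rw [← hF, ← hl', ← hn', ← hq]
  have hR : (c + 4) * l + 1 ≤ q * l := by rw [hq]; nlinarith
  have hR' : (c + 4) * l ≤ q * l := by omega
  have hin : n * 100 + 100 + F + 4194304 * k * 60 ≤ 251670000 * (n * l) := by
    have : n ≤ n * l := Nat.le_mul_of_pos_right _ hl
    omega
  have hql : 1 ≤ q * l := by nlinarith
  calc _ ≤ (q * l) * (251670000 * (n * l)) + n * ((q * l) * (80 * (q * l)) + 100) + 100 + 13 := by
        have : (c + 4) * l * 80 + 80 ≤ 80 * (q * l) := by omega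
        gcongr
    _ ≤ 260000000 * (q ^ 2 * (n * l ^ 2)) := by
        have e1 : (q * l) * (251670000 * (n * l)) ≤ 251670000 * (q ^ 2 * (n * l ^ 2)) := by
          have : q * (n * l ^ 2) ≤ q ^ 2 * (n * l ^ 2) :=
            Nat.mul_le_mul_right _ (Nat.le_self_pow two_ne_zero q)
          calc _ = 251670000 * (q * (n * l ^ 2)) := by ring
            _ ≤ _ := Nat.mul_le_mul_left _ this
        have e2 : n * ((q * l) * (80 * (q * l)) + 100) = 80 * (q ^ 2 * (n * l ^ 2)) + 100 * n := by
          ring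
        have e3 : n ≤ q ^ 2 * (n * l ^ 2) := by
          have : q ^ 2 * (n * l ^ 2) = n * (q * l) ^ 2 := by ring
          rw [this]
          exact Nat.le_mul_of_pos_right _ (by positivity)
        omega

/-- The dominant term is E₀ · (b + 4) · `stepTime`; D measures E₀ in units of log n. The factor D²
is caused by the long divisions, whose length grows with the iteration. -/
theorem runTime_le {c p d k E₀ D : ℕ} (hp : 2 ≤ p) (hd : 0 < d) (hk0 : 0 < k) (hk : k ≤ p ^ d)
    (hE : E₀ + 1 ≤ D * Nat.clog 2 (p ^ d)) :
    runTime c p d k E₀ ≤ 2000000000 * ((c + 5) ^ 2 * D ^ 2 *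
      (p ^ d * Nat.clog 2 (p ^ d) ^ 3 * (Nat.clog 2 (8 * k + 2) + 4))) := by
  have hn2 : 2 ≤ p ^ d := hp.trans (Nat.le_self_pow hd.ne' p)
  have hpn : p ≤ p ^ d := Nat.le_self_pow hd.ne' p
  have hl : 1 ≤ Nat.clog 2 (p ^ d) := Nat.clog_pos one_lt_two hn2
  have h1 := mul_clog_le (d := d) hp
  have h2 : 2 ^ Nat.clog 2 (2 * p) ≤ 4 * p := by
    have := two_pow_clog_le (show 2 ≤ 2 * p by omega)
    omega
  have h3 := stepTime_le (c := c) hp hd hk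
  have h4 : 2 ^ Nat.clog 2 (8 * k + 2) ≤ 20 * p ^ d := by
    have := two_pow_clog_le (show 2 ≤ 8 * k + 2 by omega)
    omega
  have h5 : d ≤ Nat.clog 2 (p ^ d) := by
    refine (Nat.pow_le_pow_iff_right one_lt_two).1 (le_trans ?_ (Nat.le_pow_clog one_lt_two _))
    exact Nat.pow_le_pow_left hp d
  have h6 : Nat.clog 2 (2 * p) ≤ 3 * Nat.clog 2 (p ^ d) :=
    (Nat.le_mul_of_pos_left _ hd).trans h1
  simp only [runTime, numTime, iterTime, batchSize] at h3 ⊢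
  obtain ⟨S, hS⟩ : ∃ S, S = stepTime p d (Nat.clog 2 (2 * p)) ((c + 4) * Nat.clog 2 (p ^ d))
    (4194304 * k) + 13 := ⟨_, rfl⟩
  obtain ⟨b, hb⟩ : ∃ b, b = Nat.clog 2 (8 * k + 2) := ⟨_, rfl⟩
  obtain ⟨l, hl'⟩ : ∃ l, l = Nat.clog 2 (p ^ d) := ⟨_, rfl⟩
  obtain ⟨lm, hlm⟩ : ∃ lm, lm = Nat.clog 2 (2 * p) := ⟨_, rfl⟩
  rw [← hS] at h3
  rw [← hS]
  rw [← hl'] at h3 hl hE h5 h6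
  rw [← hb] at h4
  rw [← hlm] at h2 h6
  rw [← hl', ← hb, ← hlm]
  obtain ⟨n, hn⟩ : ∃ n, n = p ^ d := ⟨_, rfl⟩
  rw [← hn] at hn2 hk hpn h3 h4
  rw [← hn]
  obtain ⟨q, hq⟩ : ∃ q, q = c + 5 := ⟨_, rfl⟩
  obtain ⟨h, hh⟩ : ∃ h, h = b + 4 := ⟨_, rfl⟩
  rw [← hq] at h3
  rw [← hq, ← hh]
  clear hS hb hl' hlm hn h1
  have hD : 1 ≤ D := by
    rcases Nat.eq_zero_or_pos D with rfl | h
    · simp at hE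
    · exact h
  have hq1 : 1 ≤ q := by omega
  have hh1 : 1 ≤ h := by omega
  have hn1 : 1 ≤ n := by omega
  obtain ⟨Y, hY⟩ : ∃ Y, Y = q ^ 2 * D ^ 2 * (n * l ^ 3 * h) := ⟨_, rfl⟩
  rw [← hY]
  -- Every term of the running time is a multiple of a monomial in q, D, n, l, h with exponents at
  -- most (2, 2, 1, 3, 1), hence of Y.
  have mono : ∀ i j u v w : ℕ, (i ≤ 2 ∧ j ≤ 2 ∧ u ≤ 1 ∧ v ≤ 3 ∧ w ≤ 1) →
      q ^ i * D ^ j * (n ^ u * l ^ v * h ^ w) ≤ Y := by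
    rintro i j u v w ⟨hi, hj, hu, hv, hw⟩
    rw [hY]
    have a1 := Nat.pow_le_pow_right hq1 hi
    have a2 := Nat.pow_le_pow_right hD hj
    have a3 : n ^ u ≤ n := by simpa using Nat.pow_le_pow_right hn1 hu
    have a4 := Nat.pow_le_pow_right hl hv
    have a5 : h ^ w ≤ h := by simpa using Nat.pow_le_pow_right hh1 hw
    gcongr
  have y1 : 1 ≤ Y := by simpa using mono 0 0 0 0 0 (by decide)
  have yq : q ≤ Y := by simpa using mono 1 0 0 0 0 (by decide)
  have yl : l ≤ Y := by simpa using mono 0 0 0 1 0 (by decide)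
  have yn : n ≤ Y := by simpa using mono 0 0 1 0 0 (by decide)
  have yh : h ≤ Y := by simpa using mono 0 0 0 0 1 (by decide)
  have yql : q * l ≤ Y := by simpa using mono 1 0 0 1 0 (by decide)
  have ynl : n * l ≤ Y := by simpa using mono 0 0 1 1 0 (by decide)
  have yDl : D * l ≤ Y := by simpa using mono 0 1 0 1 0 (by decide)
  have yqlnh : q * (n * l * h) ≤ Y := by simpa using mono 1 0 1 1 1 (by decide)
  have yS : q ^ 2 * (n * l ^ 2 * h) ≤ Y := by simpa using mono 2 0 1 2 1 (by decide)
  have yDS : q ^ 2 * D * (n * l ^ 3 * h) ≤ Y := by simpa using mono 2 1 1 3 1 (by decide)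
  have yD2 : D ^ 2 * (n * l ^ 2) ≤ Y := by simpa using mono 0 2 1 2 0 (by decide)
  have yDh : D * (n * l * h) ≤ Y := by simpa using mono 0 1 1 1 1 (by decide)
  have yDn : D * (n * l) ≤ Y := by simpa using mono 0 1 1 1 0 (by decide)
  have t1 : d * (p * 25 + 50) ≤ 25 * Y + 50 * Y := by
    have : d * p ≤ l * n := Nat.mul_le_mul h5 hpn
    have e : d * (p * 25 + 50) = 25 * (d * p) + 50 * d := by ring
    rw [mul_comm l n] at this
    omega
  have t2 : lm * (2 ^ lm * 300) ≤ 3600 * Y := by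
    calc lm * (2 ^ lm * 300) ≤ (3 * l) * (4 * n * 300) := by gcongr; omega
      _ = 3600 * (n * l) := by ring
      _ ≤ _ := by omega
  have t3 : (c + 4) * l ≤ q * l := Nat.mul_le_mul_right _ (by omega)
  have t4 : h * ((c + 4) * l * (4194304 * k)) ≤ 4194304 * Y := by
    calc h * ((c + 4) * l * (4194304 * k)) ≤ h * (q * l * (4194304 * n)) := by gcongr
      _ = 4194304 * (q * (n * l * h)) := by ring
      _ ≤ _ := by omega
  have t5 : h * S ≤ 260000000 * Y := by
    calc h * S ≤ h * (260000000 * (q ^ 2 * (n * l ^ 2))) := by gcongr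
      _ = 260000000 * (q ^ 2 * (n * l ^ 2 * h)) := by ring
      _ ≤ _ := by omega
  have t6 : E₀ * (h * S) ≤ 260000000 * Y := by
    calc E₀ * (h * S) ≤ (D * l) * (h * (260000000 * (q ^ 2 * (n * l ^ 2)))) := by gcongr; omega
      _ = 260000000 * (q ^ 2 * D * (n * l ^ 3 * h)) := by ring
      _ ≤ _ := by omega
  have t7 : E₀ * (n * ((E₀ + 4) * 250)) ≤ 1000 * Y := by
    calc E₀ * (n * ((E₀ + 4) * 250)) ≤ (D * l) * (n * ((4 * (D * l)) * 250)) := by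
          gcongr
          · omega
          · omega
      _ = 1000 * (D ^ 2 * (n * l ^ 2)) := by ring
      _ ≤ _ := by omega
  have t8 : E₀ * (n * (b * 150)) ≤ 150 * Y := by
    calc E₀ * (n * (b * 150)) ≤ (D * l) * (n * (h * 150)) := by
          gcongr
          · omega
          · omega
      _ = 150 * (D * (n * l * h)) := by ring
      _ ≤ _ := by omega
  have t9 : E₀ * n ≤ Y := by
    calc E₀ * n ≤ (D * l) * n := by gcongr; omega
      _ = D * (n * l) := by ring
      _ ≤ _ := yDn
  have t10 : E₀ * 2 ^ b ≤ 20 * Y := by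
    calc E₀ * 2 ^ b ≤ (D * l) * (20 * n) := by gcongr; omega
      _ = 20 * (D * (n * l)) := by ring
      _ ≤ _ := by omega
  have t11 : E₀ * (h * S + n * ((E₀ + 4) * 250 + b * 150 + 1500) + 2 ^ b * 100 + 300 + 13) =
      E₀ * (h * S) + E₀ * (n * ((E₀ + 4) * 250)) + E₀ * (n * (b * 150)) + 1500 * (E₀ * n) +
        100 * (E₀ * 2 ^ b) + 313 * E₀ := by ring
  omega

/-- From 2^⌈log₂ v⌉ ≤ 2v and 1/log 2 < 3/2. -/
theorem clog_le_log {v : ℕ} (hv : 2 ≤ v) : (Nat.clog 2 v : ℝ) ≤ 1 + 3 / 2 * Real.log v := by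
  have h1 : ((2 ^ Nat.clog 2 v : ℕ) : ℝ) ≤ ((2 * v : ℕ) : ℝ) := by
    exact_mod_cast two_pow_clog_le hv
  have hv' : (0 : ℝ) < v := by exact_mod_cast (by omega : 0 < v)
  have h2 := Real.log_le_log (by positivity) h1
  push_cast at h2
  rw [Real.log_pow, Real.log_mul two_ne_zero hv'.ne'] at h2
  have h3 := Real.log_two_gt_d9
  have h4 : 0 ≤ Real.log v := Real.log_natCast_nonneg v
  by_contra hc
  push Not at hc
  nlinarith

theorem clog_le_three_log {n : ℕ} (hn : 2 ≤ n) : (Nat.clog 2 n : ℝ) ≤ 3 * Real.log n := by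
  have h1 := clog_le_log hn
  have h2 : Real.log 2 ≤ Real.log n := Real.log_le_log two_pos (by exact_mod_cast hn)
  have h3 := Real.log_two_gt_d9
  linarith

theorem clog_add_le_log {k : ℕ} (hk : 0 < k) :
    ((Nat.clog 2 (8 * k + 2) + 4 : ℕ) : ℝ) ≤ 15 * Real.log (k + 1) := by
  have h1 := clog_le_log (show 2 ≤ 8 * k + 2 by omega)
  have hk' : (1 : ℝ) ≤ k := by exact_mod_cast hk
  have h2 : Real.log ((8 * k + 2 : ℕ) : ℝ) ≤ Real.log (2 ^ 3 * (k + 1)) := by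
    apply Real.log_le_log
    · positivity
    · push_cast; linarith
  rw [Real.log_mul (by positivity) (by positivity), Real.log_pow] at h2
  have h3 := Real.log_two_lt_d9
  have h4 := Real.log_two_gt_d9
  have h5 : Real.log 2 ≤ Real.log (k + 1) := Real.log_le_log two_pos (by linarith)
  push_cast at h1 h2 ⊢
  linarith

/-- Minimality of E₀ gives 2^(E₀-1) < 2r, hence E₀ ≤ 2 + a⌈log₂ n⌉. The case E₀ = 0 is separate
because r > 0 is extracted from that inequality. -/
theorem level_le {n E₀ a : ℕ} {A r : ℝ} (hn : 2 ≤ n) (hE : ∀ e < E₀, (2 : ℝ) ^ e < 2 * r)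
    (hA : A ≤ a) (hr : Real.log r ≤ A * Real.log n) : E₀ + 1 ≤ (a + 3) * Nat.clog 2 n := by
  have hl : 1 ≤ Nat.clog 2 n := Nat.clog_pos one_lt_two hn
  rcases Nat.eq_zero_or_pos E₀ with rfl | hpos
  · nlinarith
  have h1 := hE (E₀ - 1) (by omega)
  have hr0 : 0 < r := by
    have : (0 : ℝ) < 2 ^ (E₀ - 1) := by positivity
    linarith
  have h2 := Real.log_le_log (by positivity) h1.le
  rw [Real.log_pow, Real.log_mul two_ne_zero hr0.ne', Nat.cast_sub hpos] at h2
  have h3 : Real.log n ≤ Nat.clog 2 n * Real.log 2 := by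
    rw [← Real.log_pow]
    apply Real.log_le_log (by exact_mod_cast (by omega : 0 < n))
    exact_mod_cast Nat.le_pow_clog one_lt_two n
  have h4 : 0 ≤ Real.log n := Real.log_natCast_nonneg n
  have h5 : A * Real.log n ≤ a * (Nat.clog 2 n * Real.log 2) :=
    (mul_le_mul_of_nonneg_right hA h4).trans (mul_le_mul_of_nonneg_left h3 (by positivity))
  have h6 : ((E₀ : ℝ) - 1) * Real.log 2 ≤ (1 + a * Nat.clog 2 n) * Real.log 2 := by
    push_cast at h2; linarith
  have h7 := le_of_mul_le_mul_right h6 (Real.log_pos one_lt_two)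
  have h8 : E₀ ≤ 2 + a * Nat.clog 2 n := by
    have : (E₀ : ℝ) ≤ ((2 + a * Nat.clog 2 n : ℕ) : ℝ) := by push_cast; linarith
    exact_mod_cast this
  nlinarith

/-! ### The failure probability -/

/-- The union bound over all starting vectors that rounding can ever produce; each is fixed in
advance, so `measure_badRun_le` applies to it. -/
theorem measure_not_goodRun_le {p d k : ℕ} [NeZero p] {x : Idx p d → ℂ} {R B b E₀ : ℕ} {μ : ℝ}
    (hk : 0 < k) (hX : SmallTail (dft x) k μ) (hμ : 0 < μ) (hB : 4194304 * k ≤ B) :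
    sampleMeasure p d {τ | ¬ GoodRun x R B b E₀ μ τ} ≤
      (((E₀ + 1) * (2 ^ b + 1) * (b + 4) * p ^ d : ℕ) : ENNReal) * (2⁻¹ : ENNReal) ^ R := by
  have hsub : {τ | ¬ GoodRun x R B b E₀ μ τ} ⊆ ⋃ E ∈ Finset.range (E₀ + 1),
      ⋃ j ∈ Finset.range (2 ^ b + 1),
        {τ | BadRun x (dft x) R B (b + 4) (2 ^ E * μ / 2) μ (cand (dft x) μ b E j) τ} := by
    intro τ hτ
    simp only [GoodRun, Set.mem_ofPred_eq, not_forall, not_not] at hτ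
    obtain ⟨E, hE, j, hj, h⟩ := hτ
    simp only [Set.mem_iUnion, Finset.mem_range]
    exact ⟨E, by omega, j, by omega, h⟩
  calc _ ≤ _ := measure_mono hsub
    _ ≤ ∑ E ∈ Finset.range (E₀ + 1), ∑ j ∈ Finset.range (2 ^ b + 1),
        (((b + 4 : ℕ) : ENNReal) * ((p ^ d : ℕ) * (2⁻¹ : ENNReal) ^ R)) :=
      (measure_biUnion_finset_le _ _).trans (Finset.sum_le_sum fun E _ =>
        (measure_biUnion_finset_le _ _).trans (Finset.sum_le_sum fun j _ =>
          measure_badRun_le hk hX hμ hB _))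
    _ = _ := by
      simp only [Finset.sum_const, Finset.card_range, nsmul_eq_mul]
      push_cast
      ring

/-- The four factors of the union bound are at most D n, 21 n, 24 n and n, and 2^(-R) ≤ n^(-(c+4)):
the 4 in R pays for the union bound. -/
theorem failure_le {c n k D E₀ : ℕ} (hn : 2 ≤ n) (hk : k ≤ n) (hE : E₀ + 1 ≤ D * Nat.clog 2 n) :
    (((E₀ + 1) * (2 ^ Nat.clog 2 (8 * k + 2) + 1) * (Nat.clog 2 (8 * k + 2) + 4) * n : ℕ) : ENNReal) *
      (2⁻¹ : ENNReal) ^ ((c + 4) * Nat.clog 2 n) ≤ ENNReal.ofReal (504 * D / (n : ℝ) ^ c) := by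
  have h1 : Nat.clog 2 n ≤ n := Nat.clog_le_of_le_pow Nat.lt_two_pow_self.le
  have h2 : 2 ^ Nat.clog 2 (8 * k + 2) ≤ 20 * n := by
    have := two_pow_clog_le (show 2 ≤ 8 * k + 2 by omega)
    omega
  have h3 : Nat.clog 2 (8 * k + 2) < 2 ^ Nat.clog 2 (8 * k + 2) := Nat.lt_two_pow_self
  have h4 : (E₀ + 1) * (2 ^ Nat.clog 2 (8 * k + 2) + 1) * (Nat.clog 2 (8 * k + 2) + 4) * n ≤
      504 * D * n ^ 4 := by
    calc _ ≤ (D * n) * (21 * n) * (24 * n) * n := by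
          gcongr
          · exact hE.trans (Nat.mul_le_mul_left _ h1)
          · omega
          · omega
      _ = _ := by ring
  have h5 : (n : ℝ) ^ (c + 4) ≤ 2 ^ ((c + 4) * Nat.clog 2 n) := by
    rw [mul_comm, pow_mul]
    gcongr
    exact_mod_cast Nat.le_pow_clog one_lt_two n
  have h6 : (2⁻¹ : ENNReal) ^ ((c + 4) * Nat.clog 2 n) =
      ENNReal.ofReal ((2 ^ ((c + 4) * Nat.clog 2 n))⁻¹) := by
    rw [ENNReal.ofReal_inv_of_pos (by positivity), ENNReal.ofReal_pow zero_le_two, ENNReal.inv_pow]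
    simp
  rw [h6, ← ENNReal.ofReal_natCast, ← ENNReal.ofReal_mul (by positivity)]
  apply ENNReal.ofReal_le_ofReal
  have hn0 : (0 : ℝ) < n := by exact_mod_cast (by omega : 0 < n)
  rw [← div_eq_mul_inv, div_le_div_iff₀ (by positivity) (by positivity)]
  calc _ ≤ ((504 * D * n ^ 4 : ℕ) : ℝ) * (n : ℝ) ^ c := by gcongr
    _ = 504 * D * (n : ℝ) ^ (c + 4) := by push_cast; ring
    _ ≤ _ := by gcongr

/-! ### Tails -/

/-- The exceptional set is the one that `zeroTop` has chosen; the tail bound then holds with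
equality. -/
theorem smallTail_of_zeroTop {α : Type*} [Fintype α] {k : ℕ} (hk : 0 < k) {X : α → ℂ} {μ : ℝ}
    (hμ : μ = (1 / Real.sqrt k) * l2norm (zeroTop k X)) : SmallTail X k μ := by
  classical
  refine ⟨Classical.choose (exists_isTop k X),
    (Classical.choose_spec (exists_isTop k X)).1.le.trans (min_le_left _ _), le_of_eq ?_⟩
  have hk' : (0 : ℝ) < k := by exact_mod_cast hk
  rw [hμ, mul_pow, div_pow, one_pow, Real.sq_sqrt hk'.le, l2norm,
    Real.sq_sqrt (Finset.sum_nonneg fun _ _ => by positivity), ← mul_assoc,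
    mul_one_div_cancel hk'.ne', one_mul, Finset.sum_filter]
  refine Finset.sum_congr rfl fun f _ => ?_
  by_cases h : f ∈ Classical.choose (exists_isTop k X) <;> simp [zeroTop, h]

theorem zeroTop_eq_zero {α : Type*} [Fintype α] {k : ℕ} (hk : Fintype.card α ≤ k) (X : α → ℂ) :
    zeroTop k X = 0 := by
  have h := (Classical.choose_spec (exists_isTop k X)).1
  rw [min_eq_right hk] at h
  have h' := (Finset.card_eq_iff_eq_univ _).1 h
  funext f
  simp [zeroTop, h']

end SparseFourier

/-! ### Assembly of the theorem. -/

open SparseFourier in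
theorem mainTheorem1 :
    ∃ Csparse : ℕ, ∀ c : ℕ, ∃ (P : SparseFourier.Prog) (Csample : ℝ), ∀ A : ℝ,
      ∃ Ctime Cfail : ℝ,
      ∀ (p d k : ℕ) [NeZero p] [NeZero d] (n : ℕ) (x : SparseFourier.Idx p d → ℂ) (μ Rstar : ℝ),
        n = p ^ d →
        1 ≤ k → k ≤ n →
        μ = (1 / Real.sqrt k) *
          SparseFourier.l2norm (SparseFourier.zeroTop k (SparseFourier.dft x)) →
        0 < μ →
        SparseFourier.linfNorm (SparseFourier.dft x) / μ ≤ Rstar →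
        Real.log Rstar ≤ A * Real.log n →
        ∃ final : SparseFourier.Tape p d → SparseFourier.State,
          (∀ ω : SparseFourier.Tape p d,
            SparseFourier.Exec x ω P (SparseFourier.initState p d k μ Rstar) (final ω) ∧
            ((final ω).samples : ℝ) ≤ Csample * (k * Real.log (k + 1) * Real.log n) ∧
            ((final ω).time : ℝ) ≤ Ctime * (n * Real.log n ^ 3 * Real.log (k + 1)) ∧
            SparseFourier.nnzCount (SparseFourier.output (p := p) (d := d) (final ω))
              ≤ Csparse * k) ∧
          SparseFourier.tapeMeasure p d
            {ω | ¬ SparseFourier.linfNorm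
                    (SparseFourier.dft x - SparseFourier.output (final ω)) ≤
                  (1 / Real.sqrt k) *
                    SparseFourier.l2norm (SparseFourier.zeroTop k (SparseFourier.dft x))}
            ≤ ENNReal.ofReal (Cfail / (n : ℝ) ^ c) := by
  -- ⌈log₂ n⌉ ≤ 3 log n and b + 4 ≤ 15 log(k+1) give 45 = 15·3 for the samples and 405 = 15·3³ for
  -- the time. D = ⌈|A|⌉ + 3 bounds the number of levels in units of ⌈log₂ n⌉.
  refine ⟨65, fun c => ⟨sparseFourierProg c, 45 * (c + 4) * 4194304, fun A =>
    ⟨2000000000 * ((c + 5) ^ 2 * ((⌈|A|⌉₊ + 3 : ℕ) : ℝ) ^ 2 * 405), 504 * ((⌈|A|⌉₊ + 3 : ℕ) : ℝ), ?_⟩⟩⟩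
  intro p d k _ _ n x μ r hn hk1 hkn hμ hμ0 hlinf hlog
  subst hn
  have hp0 : 0 < p := Nat.pos_of_ne_zero (NeZero.ne p)
  have hd0 : 0 < d := Nat.pos_of_ne_zero (NeZero.ne d)
  have hX := smallTail_of_zeroTop hk1 hμ
  -- For p = 1 there is one coefficient, the tail is empty and μ would be 0. This guarantees log n >
  -- 0.
  have hp : 2 ≤ p := by
    by_contra hp
    obtain rfl : p = 1 := by omega
    rw [zeroTop_eq_zero (by simpa using hk1)] at hμ
    simp [l2norm] at hμ
    exact hμ0.ne' hμ
  have hn2 : 2 ≤ p ^ d := hp.trans (Nat.le_self_pow hd0.ne' p)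
  have hr : ∀ f, ‖dft x f‖ ≤ r * μ := fun f =>
    (norm_le_pi_norm (dft x) f).trans ((div_le_iff₀ hμ0).1 hlinf)
  classical
  have hex : ∃ E : ℕ, 2 * r ≤ 2 ^ E := (pow_unbounded_of_one_lt _ one_lt_two).imp fun _ h => h.le
  obtain ⟨E₀, hE, hE'⟩ : ∃ E₀ : ℕ, 2 * r ≤ 2 ^ E₀ ∧ ∀ e < E₀, (2 : ℝ) ^ e < 2 * r :=
    ⟨Nat.find hex, Nat.find_spec hex, fun e he => not_le.1 (Nat.find_min hex he)⟩
  have hlev := level_le hn2 hE' ((le_abs_self A).trans (Nat.le_ceil _)) (by exact_mod_cast hlog)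
  -- The final 0 is the initial time; `choose` turns the triple into final configurations as
  -- functions of the tape.
  have hspec := fun ω => sparseFourierProg_spec (c := c) (ω := ω) hp0 hd0 hX hμ0 hE hE' hr 0
  choose m' t' hexec htime hc hnnz hgood using hspec
  have hl := clog_le_three_log hn2
  have hb := clog_add_le_log hk1
  have hlog0 : 0 ≤ Real.log ((p ^ d : ℕ) : ℝ) := Real.log_natCast_nonneg _
  have hlogk : 0 ≤ Real.log ((k : ℝ) + 1) := Real.log_nonneg (by simp)
  refine ⟨fun ω => (m' ω).st (t' ω), fun ω => ⟨hexec ω, ?_, ?_, hnnz ω⟩, ?_⟩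
  · change (((m' ω).c : ℕ) : ℝ) ≤ _
    rw [hc ω, batchSize]
    calc _ = ((Nat.clog 2 (8 * k + 2) + 4 : ℕ) : ℝ) *
          ((c + 4) * (Nat.clog 2 (p ^ d) : ℝ) * (4194304 * k)) := by push_cast; ring
      _ ≤ (15 * Real.log (k + 1)) * ((c + 4) * (3 * Real.log ((p ^ d : ℕ) : ℝ)) * (4194304 * k)) := by
        gcongr
      _ = _ := by ring
  · change ((t' ω : ℕ) : ℝ) ≤ _
    have h1 : t' ω ≤ runTime c p d k E₀ := by have := htime ω; omega
    have h2 := h1.trans (runTime_le (c := c) hp hd0 hk1 hkn hlev)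
    calc ((t' ω : ℕ) : ℝ) ≤ _ := Nat.cast_le.2 h2
      _ = 2000000000 * ((c + 5) ^ 2 * ((⌈|A|⌉₊ + 3 : ℕ) : ℝ) ^ 2 * (((p ^ d : ℕ) : ℝ) *
          (Nat.clog 2 (p ^ d) : ℝ) ^ 3 * ((Nat.clog 2 (8 * k + 2) + 4 : ℕ) : ℝ))) := by
        push_cast; ring
      _ ≤ 2000000000 * ((c + 5) ^ 2 * ((⌈|A|⌉₊ + 3 : ℕ) : ℝ) ^ 2 * (((p ^ d : ℕ) : ℝ) *
          (3 * Real.log ((p ^ d : ℕ) : ℝ)) ^ 3 * (15 * Real.log (k + 1)))) := by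
        gcongr
      _ = _ := by ring
  · rw [← hμ]
    refine le_trans (measure_mono ?_) ((tapeMeasure_fst _).le.trans
      ((measure_not_goodRun_le (E₀ := E₀) (R := (c + 4) * Nat.clog 2 (p ^ d))
        (B := batchSize * k) (b := Nat.clog 2 (8 * k + 2)) hk1 hX hμ0 le_rfl).trans
        (failure_le hn2 hkn hlev)))
    intro ω hω hg
    exact hω ((pi_norm_le_iff_of_nonneg hμ0.le).2 fun f => hgood ω hg f)
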